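/- **Setting.** Let $\mathbf g$ be a smooth Lorentzian metric of signature $(-,+,+,+)$ on an open coordinate domain $U\subset\mathbb R^4$, with Levi-Civita connection $\mathbf D$, and write $\langle\cdot,\cdot\rangle=\mathbf g$. The curvature is $\mathbf R(X,Y)Z=\mathbf D_X\mathbf D_YZ-\mathbf D_Y\mathbf D_XZ-\mathbf D_{[X,Y]}Z$, $\mathbf R_{abcd}=\langle e_a,\mathbf R(e_c,e_d)e_b\rangle$, and the Ricci tensor is $\mathbf R_{bd}=\mathbf g^{ac}\mathbf R_{abcd}$. Let $t$ be a smooth function on $U$ with timelike gradient $\mathbf Dt$; put $n=(-\langle \mathbf Dt,\mathbf Dt\rangle)^{-1/2}$ (lapse), $\mathbf T=-n\mathbf Dt$ (future unit normal of the slices $\Sigma_t$), and $\pi(X,Y)=-\langle \mathbf D_X\mathbf T,Y\rangle$. Let $O\in U$ with $t(O)=0$, and let $(e_0,\dots,e_3)$ be a $\mathbf g$-orthonormal frame at $O$ with $e_0$ future timelike. Let $\mathbb H_1=\{V\in\mathbb R^{4}:(V^0)^2-\sum_i(V^i)^2=1,\ V^0>0\}$, and write $\exp_O(y)$ for the exponential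 map at $O$ applied to $y^\mu e_\mu$. Let $i_*\in[0,\infty]$ be the supremum of all $s_0>0$ such that $(\rho,V)\mapsto\exp_O(\rho V)$ is defined on $(0,s_0)\times\mathbb H_1$ and is a diffeomorphism onto its image, and let $\mathcal I^+_*=\{\exp_O(\rho V):0<\rho<i_*,\ V\in\mathbb H_1\}$. On $\mathcal I^+_*$ let, at $\exp_O(\rho V)$: $\rho$ be the proper time, $y^\mu=\rho V^\mu$, $\tau=y^0$; let $\partial_\rho f$ be the $\rho$-derivative of $f(\exp_O(\rho V))$ at fixed $V$; and let $\mathcal R_i=(d\exp_O)(y^i\partial_{y^0}+y^0\partial_{y^i})$, $i=1,2,3$, be the boost vector fields. Put * $B=-\mathbf D\rho$; $b$ is defined by $\langle B,\mathbf T\rangle=-b^{-1}t/\rho$; $\tilde r=\sqrt{b^{-2}t^2-\rho^2}$; * $\nabla\rho$ is the projection of $\mathbf D\rho$ orthogonal to $\mathbf T$, $a^{-1}=|\nabla\rho|$, $N=-\nabla\rho/|\nabla\rho|$ (where $\nabla\rho=0$, the terms containing $N$ below have vanishing coefficient and are read as $0$); * $\bar g=\mathbf g+B^\flat\otimes B^\flat$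 is the induced metric of the hyperboloids $\mathcal H_\rho=\{\rho=\mathrm{const}\}$, and $k(X,Y)=\langle \mathbf D_XB,Y\rangle$ their second fundamental form (for $X,Y$ tangent to $\mathcal H_\rho$, extended as a spacetime tensor by $k(B,\cdot)=k(\cdot,B)=0$); * for a symmetric 2-tensor $F$: $\mathrm{tr}\,F=\bar g^{ij}F_{ij}$, $\hat F=F-\frac13(\mathrm{tr}\,F)\bar g$, $|F|^2=F_{ij}F^{ij}$, $(F*G)_{ij}=F_i{}^lG_{lj}+F_{jl}G^l{}_i$, $(F\hat\otimes F)_{ij}=\frac12(F*F)_{ij}-\frac13|F|^2\bar g_{ij}$, indices being raised with $\bar g$; * $\hat{\mathbf R}_{BiBj}=\mathbf R_{BiBj}-\frac13\mathbf R_{BB}\bar g_{ij}$, and ${}^{(\mathcal R)}\pi_{\alpha\beta}=\mathbf D_\alpha\mathcal R_\beta+\mathbf D_\beta\mathcal R_\alpha$ for $\mathcal R=\mathcal R_1,\mathcal R_2,\mathcal R_3$. **Proposition (structure equations).** At every point of $\mathcal I^+_*$ one has $t/\tau>0$, the scalars and tensor components differentiated along $B$ below are differentiable, and, with $i,j$ denoting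 components along arbitrary vectors tangent to $\mathcal H_\rho$ and $\mathcal R$ any of the three boost fields, $$\Big(B+\frac{n^{-1}b^{-1}}{\rho}\Big)(n-b^{-1})=-\frac{\tilde r}{t}a^{-1}\pi_{NN}+\frac{\tilde r\,b^{-1}}{\rho}\langle \mathbf D_{\mathbf T}\mathbf T,N\rangle+\partial_\rho n,$$ $$B\Big(\log\frac t\tau\Big)=\frac{b^{-1}n^{-1}-1}{\rho},$$ $$B(\mathrm{tr}\,k)+\tfrac13(\mathrm{tr}\,k)^2=-\mathbf R_{BB}-|\hat k|^2,$$ $$B\Big(\mathrm{tr}\,k-\frac3\rho\Big)+\frac2\rho\Big(\mathrm{tr}\,k-\frac3\rho\Big)=-\frac13\Big(\mathrm{tr}\,k-\frac3\rho\Big)^2-\mathbf R_{BB}-|\hat k|^2,$$ $$\mathbf D_B\hat k_{ij}+\tfrac23\,\mathrm{tr}\,k\,\hat k_{ij}=-\hat{\mathbf R}_{BiBj}-(\hat k\hat\otimes\hat k)_{ij},$$ $$B\big(\mathrm{tr}\,{}^{(\mathcal R)}\pi\big)=2\,\mathcal R\Big(\mathrm{tr}\,k-\frac3\rho\Big),$$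 $$\mathbf D_B{}^{(\mathcal R)}\hat\pi_{ij}+(\hat k*{}^{(\mathcal R)}\hat\pi)_{ij}=2\,\mathcal L_{\mathcal R}\hat k_{ij}-\tfrac23\,\mathrm{tr}\,{}^{(\mathcal R)}\pi\;\hat k_{ij}.$$ -/

import Mathlib

open scoped ContDiff Matrix ENNReal

noncomputable section

namespace Hyperboloid

/-- Coordinate points, and vectors given by their components in the coordinate basis. -/
abbrev Vec : Type := Fin 4 → ℝ

/-- A field of metric matrices `g_{ab}(p)`. -/
abbrev MetricField : Type := Vec → Matrix (Fin 4) (Fin 4) ℝ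

/-- A field of covariant 2-tensors, `F p x y = F_{ab}(p) x^a y^b`. -/
abbrev Tensor2 : Type := Vec → Vec → Vec → ℝ

/-- The Minkowski matrix `diag(-1,1,1,1)`. -/
def eta : Matrix (Fin 4) (Fin 4) ℝ := Matrix.diagonal ![-1, 1, 1, 1]

/-- Coordinate basis vector. -/
def basisVec (a : Fin 4) : Vec := Pi.single a 1

/-! ### Pseudo-Riemannian geometry in coordinates -/

/-- `⟨x, y⟩ = g_{ab} x^a y^b` at `p`. -/
def ip (g : MetricField) (p x y : Vec) : ℝ := x ⬝ᵥ (g p *ᵥ y)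

/-- The gradient `D^a f = g^{ab} ∂_b f`. -/
def grad (g : MetricField) (f : Vec → ℝ) (p : Vec) : Vec :=
  (g p)⁻¹ *ᵥ fun b => fderiv ℝ f p (basisVec b)

/-- Christoffel symbols as a bilinear map: the vector `Γ^a_{bc} x^b y^c`, with
`Γ^a_{bc} = (1/2) g^{ad} (∂_b g_{cd} + ∂_c g_{bd} - ∂_d g_{bc})`. -/
def christoffel (g : MetricField) (p x y : Vec) : Vec :=
  (g p)⁻¹ *ᵥ fun d => (1 / 2 : ℝ) *
    (fderiv ℝ (fun q => ip g q y (basisVec d)) p x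
      + fderiv ℝ (fun q => ip g q x (basisVec d)) p y
      - fderiv ℝ (fun q => ip g q x y) p (basisVec d))

/-- The Levi-Civita covariant derivative `D_v X` of a vector field at `p`. -/
def cov (g : MetricField) (X : Vec → Vec) (p v : Vec) : Vec :=
  fderiv ℝ X p v + christoffel g p v (X p)

/-- The covariant derivative `(D_v F)(x, y)` of a covariant 2-tensor field at `p`. -/
def covTensor (g : MetricField) (F : Tensor2) (p v x y : Vec) : ℝ :=
  fderiv ℝ (fun q => F q x y) p v
    - F p (christoffel g p v x) y - F p x (christoffel g p v y)

/-- The Lie derivative `(L_X F)(x, y)`, i.e.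
`(L_X F)_{ab} = X^c ∂_c F_{ab} + F_{cb} ∂_a X^c + F_{ac} ∂_b X^c`. -/
def lieTensor (X : Vec → Vec) (F : Tensor2) (p x y : Vec) : ℝ :=
  fderiv ℝ (fun q => F q x y) p (X p)
    + F p (fderiv ℝ X p x) y + F p x (fderiv ℝ X p y)

/-- The curvature operator `R(u,v)w = D_u D_v w - D_v D_u w - D_{[u,v]} w`, evaluated on
coordinate-constant extensions of `u, v, w`. -/
def curvature (g : MetricField) (p u v w : Vec) : Vec :=
  fderiv ℝ (fun q => christoffel g q v w) p u - fderiv ℝ (fun q => christoffel g q u w) p v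
    + christoffel g p u (christoffel g p v w) - christoffel g p v (christoffel g p u w)

/-- The curvature tensor `R_{abcd}` contracted with `x, y, z, w`: `⟨x, R(z,w) y⟩`. -/
def riemann (g : MetricField) (p x y z w : Vec) : ℝ := ip g p x (curvature g p z w y)

/-- The Ricci tensor: the trace of `u ↦ R(u,x) y`, that is `g^{ac} R_{abcd}`. -/
def ricci (g : MetricField) (p x y : Vec) : ℝ := ∑ a, curvature g p (basisVec a) x y a

/-- The deformation tensor `D_a X_b + D_b X_a`. -/
def deformation (g : MetricField) (X : Vec → Vec) : Tensor2 :=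
  fun p x y => ip g p (cov g X p x) y + ip g p (cov g X p y) x

/-- `c` is the endpoint of a geodesic in `U` parametrised by `[0,1]` that starts
at `O` with velocity `v`. -/
def IsGeodesicEndpoint (g : MetricField) (U : Set Vec) (O v c : Vec) : Prop :=
  ∃ γ w : ℝ → Vec, γ 0 = O ∧ w 0 = v ∧ γ 1 = c ∧ ∀ s ∈ Set.Icc (0 : ℝ) 1,
    γ s ∈ U ∧ HasDerivWithinAt γ (w s) (Set.Icc 0 1) s ∧
      HasDerivWithinAt w (-christoffel g (γ s) (w s) (w s)) (Set.Icc 0 1) s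

open Classical in
/-- The exponential map at `O`, with value `O` outside of its domain. -/
def expMap (g : MetricField) (U : Set Vec) (O v : Vec) : Vec :=
  if h : ∃ c, IsGeodesicEndpoint g U O v c then h.choose else O

/-! ### The spacetime, its time foliation and the origin -/

/-- A smooth Lorentzian metric `g` on a coordinate domain `U`, a smooth time function `t` on it
(with timelike gradient), an origin `O` with `t(O) = 0`, and an orthonormal frame of the tangent
space at `O` whose timelike member is future directed. -/
structure Spacetime where
  U : Set Vec
  isOpen_U : IsOpen U
  g : MetricField
  g_smooth : ∀ a b, ContDiffOn ℝ ∞ (fun p => g p a b) U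
  g_symm : ∀ p ∈ U, (g p).IsSymm
  g_lorentz : ∀ p ∈ U, ∃ f : Fin 4 → Vec, ∀ a b, ip g p (f a) (f b) = eta a b
  t : Vec → ℝ
  t_smooth : ContDiffOn ℝ ∞ t U
  t_timelike : ∀ p ∈ U, ip g p (grad g t p) (grad g t p) < 0
  O : Vec
  O_mem : O ∈ U
  t_O : t O = 0
  e : Fin 4 → Vec
  e_orthonormal : ∀ a b, ip g O (e a) (e b) = eta a b
  e_future : 0 < fderiv ℝ t O (e 0)

namespace Spacetime

variable (S : Spacetime)

/-- The lapse function `n` of the foliation by level sets of `t`: `-n⁻² = ⟨D t, D t⟩`. -/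
def n (p : Vec) : ℝ := (Real.sqrt (-ip S.g p (grad S.g S.t p) (grad S.g S.t p)))⁻¹

/-- The future directed unit normal `T = -n D t` of the level sets of `t`. -/
def T (p : Vec) : Vec := -(S.n p) • grad S.g S.t p

/-- `π(x, y) = -⟨D_x T, y⟩`, the second fundamental form of the level sets of `t`. -/
def secondFormT (p x y : Vec) : ℝ := -ip S.g p (cov S.g S.T p x) y

/-! ### The exponential map on the future cone, and normal coordinates -/

/-- `(y⁰)² - ∑ (yⁱ)²`. -/
def minkSq (y : Vec) : ℝ := y 0 ^ 2 - ∑ i : Fin 3, y i.succ ^ 2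

/-- The set `(0, r) × ℍ₁`, with `(ρ, V)` written as the vector `y = ρ V`: vectors of Minkowski
space that are future timelike of length less than `r`. -/
def cone (r : ℝ≥0∞) : Set Vec :=
  {y | 0 < y 0 ∧ 0 < minkSq y ∧ ENNReal.ofReal (Real.sqrt (minkSq y)) < r}

/-- The exponential map at the origin, on components with respect to the frame `e`. -/
def expO (y : Vec) : Vec := expMap S.g S.U S.O (∑ a, y a • S.e a)

/-- `exp_O` is defined on `(0, r) × ℍ₁` and is a diffeomorphism onto its (open) image. -/
def IsDiffeoUpTo (r : ℝ) : Prop :=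
  (∀ y ∈ cone (ENNReal.ofReal r), ∃ c, IsGeodesicEndpoint S.g S.U S.O (∑ a, y a • S.e a) c) ∧
  ∃ Φ : OpenPartialHomeomorph Vec Vec, Φ.source = cone (ENNReal.ofReal r) ∧
    Set.EqOn Φ S.expO Φ.source ∧ ContDiffOn ℝ ∞ Φ Φ.source ∧ ContDiffOn ℝ ∞ Φ.symm Φ.target

/-- The timelike radius of injectivity of the origin. -/
def injRadius : ℝ≥0∞ := ⨆ (r : ℝ) (_ : 0 < r ∧ S.IsDiffeoUpTo r), ENNReal.ofReal r

/-- The part of the chronological future of the origin within the timelike radius of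
injectivity. -/
def future : Set Vec := S.expO '' cone S.injRadius

/-- The geodesic normal coordinates `y` of a point of `future`. -/
def normalCoord (p : Vec) : Vec := Function.invFunOn S.expO (cone S.injRadius) p

/-- The proper time from the origin, `ρ(exp_O(ρ V)) = ρ` for `V` in `ℍ₁`. -/
def rho (p : Vec) : ℝ := Real.sqrt (minkSq (S.normalCoord p))

/-- `τ = y⁰ = ρ V⁰`. -/
def tau (p : Vec) : ℝ := S.normalCoord p 0

/-- The derivative `∂_ρ f` in the polar coordinates `(ρ, V) ↦ exp_O(ρ V)`. -/
def dRho (f : Vec → ℝ) (p : Vec) : ℝ :=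
  deriv (fun s : ℝ => f (S.expO (s • ((S.rho p)⁻¹ • S.normalCoord p)))) (S.rho p)

/-- The boost fields: image under `d exp_O` of `yⁱ ∂_τ + τ ∂_i`. -/
def boost (i : Fin 3) (p : Vec) : Vec :=
  fderiv ℝ S.expO (S.normalCoord p)
    (S.normalCoord p i.succ • basisVec 0 + S.normalCoord p 0 • basisVec i.succ)

/-! ### The hyperboloids, i.e. the level sets of `ρ` -/

/-- `B = -D ρ`. -/
def B (p : Vec) : Vec := -grad S.g S.rho p

/-- The lapse `b`, given by `⟨B, T⟩ = -b⁻¹ t / ρ`. -/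
def b (p : Vec) : ℝ := -(S.t p / (S.rho p * ip S.g p (S.B p) (S.T p)))

/-- `r̃ = √(b⁻² t² - ρ²)`. -/
def rTilde (p : Vec) : ℝ := Real.sqrt ((S.b p)⁻¹ ^ 2 * S.t p ^ 2 - S.rho p ^ 2)

/-- The gradient `∇ρ` of `ρ` on the level sets of `t`: the projection of `D ρ`. -/
def gradSlice (p : Vec) : Vec :=
  grad S.g S.rho p + ip S.g p (grad S.g S.rho p) (S.T p) • S.T p

/-- The norm `|∇ρ|` with respect to the induced metric on the level sets of `t`. -/
def normGradSlice (p : Vec) : ℝ := Real.sqrt (ip S.g p (S.gradSlice p) (S.gradSlice p))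

/-- The lapse `a`, given by `a⁻¹ = |∇ρ|`. -/
def a (p : Vec) : ℝ := (S.normGradSlice p)⁻¹

/-- The outward unit normal `N = -∇ρ / |∇ρ|` of the spheres `{t = const, ρ = const}` in the level
sets of `t` (zero at the points where `∇ρ = 0`). -/
def N (p : Vec) : Vec := -(S.normGradSlice p)⁻¹ • S.gradSlice p

/-- The projection `x + ⟨x, B⟩ B` to the tangent space of the hyperboloid. -/
def proj (p x : Vec) : Vec := x + ip S.g p x (S.B p) • S.B p

/-- Tangency to the hyperboloid through `p`. -/
def IsTangent (p x : Vec) : Prop := ip S.g p x (S.B p) = 0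

/-- The induced metric on the hyperboloids, as a spacetime tensor: `g_{ab} + B_a B_b`. -/
def hbar : Tensor2 := fun p x y => ip S.g p x y + ip S.g p x (S.B p) * ip S.g p y (S.B p)

/-- The inverse of the induced metric, `g^{ab} + B^a B^b`. -/
def hbarInv (p : Vec) (c d : Fin 4) : ℝ := (S.g p)⁻¹ c d + S.B p c * S.B p d

/-- The second fundamental form `k(x, y) = ⟨D_x B, y⟩` of the hyperboloids, extended to all vectors
as a tensor tangent to the hyperboloids. -/
def k : Tensor2 := fun p x y => ip S.g p (cov S.g S.B p (S.proj p x)) (S.proj p y)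

/-- The trace with respect to the induced metric of the hyperboloids. -/
def tr (F : Tensor2) (p : Vec) : ℝ :=
  ∑ c, ∑ d, S.hbarInv p c d * F p (basisVec c) (basisVec d)

/-- The traceless part `F - (1/3) (tr F) hbar`. -/
def traceless (F : Tensor2) : Tensor2 := fun p x y => F p x y - 1 / 3 * S.tr F p * S.hbar p x y

/-- `F_i^l G_{lj}` contracted with `x` and `y`; the indices `l` are tangent to the hyperboloid. -/
def comp (F G : Tensor2) : Tensor2 := fun p x y =>
  ∑ c, ∑ d, S.hbarInv p c d * F p x (basisVec c) * G p (basisVec d) y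

/-- `(F * G)_{ij} = F_i^l G_{lj} + F_{jl} G^l_i`. -/
def star (F G : Tensor2) : Tensor2 := fun p x y => S.comp F G p x y + S.comp F G p y x

/-- `|F|² = F_{ij} F^{ij}` with respect to the induced metric of the hyperboloids. -/
def normSq (F : Tensor2) (p : Vec) : ℝ :=
  ∑ c, ∑ d, ∑ c', ∑ d', S.hbarInv p c c' * S.hbarInv p d d' *
    F p (basisVec c) (basisVec d) * F p (basisVec c') (basisVec d')

/-- `F ⊗̂ F = (1/2) F * F - (1/3) |F|² hbar`. -/
def hatProd (F : Tensor2) : Tensor2 := fun p x y =>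
  1 / 2 * S.star F F p x y - 1 / 3 * S.normSq F p * S.hbar p x y

/-- The traceless part `k̂` of `k`. -/
def kHat : Tensor2 := S.traceless S.k

/-- `tr k - 3/ρ`. -/
def trkDev (p : Vec) : ℝ := S.tr S.k p - 3 / S.rho p

/-- `R_{BB}`. -/
def ricciBB (p : Vec) : ℝ := ricci S.g p (S.B p) (S.B p)

/-- `R̂_{BiBj} = R_{BiBj} - (1/3) R_{BB} hbar_{ij}`. -/
def curvHat (p x y : Vec) : ℝ :=
  riemann S.g p (S.B p) x (S.B p) y - 1 / 3 * S.ricciBB p * S.hbar p x y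

/-- The deformation tensor of the boost field with index `i`. -/
def boostPi (i : Fin 3) : Tensor2 := deformation S.g (S.boost i)

/-- The derivative of a function along `B`. -/
def derivB (f : Vec → ℝ) (p : Vec) : ℝ := fderiv ℝ f p (S.B p)

end Spacetime

end Hyperboloid

end

open scoped ContDiff Matrix ENNReal Topology
open Filter

noncomputable section

namespace Hyperboloid

/-! ### Bilinear fields -/

/-! The argument splits into local geometry that never mentions the exponential map, and the
verification that the future of `O` satisfies its hypotheses.

Local half (`IsHyperboloidal`): suppose only that `ρ` is smooth and positive and `B = -Dρ` has
`⟨B,B⟩ = -1`. The Hessian of `ρ` is symmetric, so `DB` is self-adjoint, annihilates `B`, and takes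
values orthogonal to `B`; in particular `B` is geodesic. Commuting derivatives of a geodesic field
gives the Riccati equation `D_B(DB) = R(B,·)B - (DB)²` (`fderiv_cov_geodesic`). Its trace is the
Raychaudhuri equation (`derivB_tr_k`), and removing the trace gives the equation for `k̂`. A field
`R` tangent to the hyperboloids and commuting with `B` satisfies `L_B L_R g = L_R L_B g = 2 L_R k`,
because `L_B g = 2k` (`lie_B_deformation`); the trace and traceless part of this identity are the
two deformation equations. The lapse equation comes from differentiating `b⁻¹ = -ρ⟨B,T⟩/t` along `B`
and splitting `B` into its components along `N` and `T`.

Global half: `gauss_lemma` identifies `B` with the push-forward of `y/|y|` (`B_expO`), which yields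
the unit length of `B` and the formula for `Bτ`. Boosts are linear and preserve the Minkowski form,
so they are tangent to the hyperboloids and commute with that field
(`boost_isHyperboloidalSymmetry`). Finally `t` increases strictly along radial timelike geodesics,
since its differential cannot vanish on a timelike vector (`t_pos`).

The cone excludes its vertex, so the Gauss lemma cannot be started at `y = 0` by smoothness of
`exp_O`. A Lipschitz bound for the exponential map near zero, from Picard–Lindelöf, takes its place.
-/

lemma sum_smul_basisVec (x : Vec) : ∑ a, x a • basisVec a = x := by
  ext b
  simp [basisVec, Finset.sum_apply, Pi.single_apply]

lemma clm_eq_sum {E : Type*} [NormedAddCommGroup E] [NormedSpace ℝ E] (L : Vec →L[ℝ] E) (x : Vec) :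
    L x = ∑ a, x a • L (basisVec a) := by
  conv_lhs => rw [← sum_smul_basisVec x]
  simp

lemma fderiv_fderiv_comm {E : Type*} [NormedAddCommGroup E] [NormedSpace ℝ E] {f : Vec → E}
    {p : Vec} (hf : ContDiffAt ℝ ∞ f p) (u v : Vec) :
    fderiv ℝ (fderiv ℝ f) p u v = fderiv ℝ (fderiv ℝ f) p v u :=
  (hf.isSymmSndFDerivAt (by
    rw [minSmoothness_of_isRCLikeNormedField]; exact WithTop.coe_le_coe.2 le_top)).eq u v

/-- `F` is a field of bilinear maps which is smooth at the points of `Ω`. -/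
structure IsSmoothBilin {E : Type*} [NormedAddCommGroup E] [NormedSpace ℝ E]
    (F : Vec → Vec → Vec → E) (Ω : Set Vec) : Prop where
  isOpen : IsOpen Ω
  bilin : ∀ q ∈ Ω, ∀ x y, F q x y = ∑ a, ∑ b, (x a * y b) • F q (basisVec a) (basisVec b)
  smooth : ∀ q ∈ Ω, ∀ x y, ContDiffAt ℝ ∞ (fun q' => F q' x y) q

section bilin

variable {E : Type*} [NormedAddCommGroup E] [NormedSpace ℝ E] {F : Vec → Vec → Vec → E}
  {Ω : Set Vec} {p : Vec}

/-- The field of continuous bilinear maps with the components of `F`. -/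
def bilinCLM (F : Vec → Vec → Vec → E) (q : Vec) : Vec →L[ℝ] Vec →L[ℝ] E :=
  ∑ a, ∑ b, (ContinuousLinearMap.proj (R := ℝ) (φ := fun _ : Fin 4 => ℝ) a).smulRight
    ((ContinuousLinearMap.proj (R := ℝ) (φ := fun _ : Fin 4 => ℝ) b).smulRight
      (F q (basisVec a) (basisVec b)))

lemma bilinCLM_apply (F : Vec → Vec → Vec → E) (q x y : Vec) :
    bilinCLM F q x y = ∑ a, ∑ b, (x a * y b) • F q (basisVec a) (basisVec b) := by
  simp [bilinCLM, smul_smul]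

namespace IsSmoothBilin

variable (hF : IsSmoothBilin F Ω)
include hF

lemma mem_nhds (hp : p ∈ Ω) : ∀ᶠ q in 𝓝 p, q ∈ Ω := hF.isOpen.mem_nhds hp

/-- The bridge from bare functions of three vectors to continuous bilinear maps; the algebraic rules
and the calculus below are all read off from it. -/
lemma eq_bilinCLM (hp : p ∈ Ω) (x y : Vec) : F p x y = bilinCLM F p x y := by
  rw [bilinCLM_apply, hF.bilin p hp]

lemma add_left (hp : p ∈ Ω) (x x' y : Vec) : F p (x + x') y = F p x y + F p x' y := by
  simp [hF.eq_bilinCLM hp]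

lemma add_right (hp : p ∈ Ω) (x y y' : Vec) : F p x (y + y') = F p x y + F p x y' := by
  simp [hF.eq_bilinCLM hp]

lemma sub_left (hp : p ∈ Ω) (x x' y : Vec) : F p (x - x') y = F p x y - F p x' y := by
  simp [hF.eq_bilinCLM hp]

lemma sub_right (hp : p ∈ Ω) (x y y' : Vec) : F p x (y - y') = F p x y - F p x y' := by
  simp [hF.eq_bilinCLM hp]

lemma neg_left (hp : p ∈ Ω) (x y : Vec) : F p (-x) y = -F p x y := by
  simp [hF.eq_bilinCLM hp]

lemma neg_right (hp : p ∈ Ω) (x y : Vec) : F p x (-y) = -F p x y := by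
  simp [hF.eq_bilinCLM hp]

lemma zero_left (hp : p ∈ Ω) (y : Vec) : F p 0 y = 0 := by
  simp [hF.eq_bilinCLM hp]

lemma zero_right (hp : p ∈ Ω) (x : Vec) : F p x 0 = 0 := by
  simp [hF.eq_bilinCLM hp]

lemma smul_left (hp : p ∈ Ω) (c : ℝ) (x y : Vec) : F p (c • x) y = c • F p x y := by
  simp [hF.eq_bilinCLM hp]

lemma smul_right (hp : p ∈ Ω) (c : ℝ) (x y : Vec) : F p x (c • y) = c • F p x y := by
  simp [hF.eq_bilinCLM hp]

lemma contDiffAt_bilinCLM (hp : p ∈ Ω) : ContDiffAt ℝ ∞ (bilinCLM F) p := by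
  unfold bilinCLM
  refine ContDiffAt.sum fun a _ => ContDiffAt.sum fun b _ => ?_
  exact contDiffAt_const.smulRight (contDiffAt_const.smulRight (hF.smooth p hp _ _))

/-- The product rule. -/
lemma hasFDerivAt_apply (hp : p ∈ Ω) {X Y : Vec → Vec} (hX : DifferentiableAt ℝ X p)
    (hY : DifferentiableAt ℝ Y p) :
    HasFDerivAt (fun q => F q (X q) (Y q))
      ((fderiv ℝ (fun q => F q (X p) (Y p)) p) + ((bilinCLM F p).flip (Y p)).comp (fderiv ℝ X p)
        + (bilinCLM F p (X p)).comp (fderiv ℝ Y p)) p := by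
  have hL : HasFDerivAt (bilinCLM F) (fderiv ℝ (bilinCLM F) p) p :=
    ((hF.contDiffAt_bilinCLM hp).differentiableAt (by simp)).hasFDerivAt
  have h1 := (hL.clm_apply hX.hasFDerivAt).clm_apply hY.hasFDerivAt
  have h2 := (hL.clm_apply (hasFDerivAt_const (X p) p)).clm_apply (hasFDerivAt_const (Y p) p)
  have e1 : (fun q => F q (X q) (Y q)) =ᶠ[𝓝 p] fun q => bilinCLM F q (X q) (Y q) := by
    filter_upwards [hF.mem_nhds hp] with q hq using hF.eq_bilinCLM hq _ _
  have e2 : (fun q => F q (X p) (Y p)) =ᶠ[𝓝 p] fun q => bilinCLM F q (X p) (Y p) := by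
    filter_upwards [hF.mem_nhds hp] with q hq using hF.eq_bilinCLM hq _ _
  rw [e2.fderiv_eq, h2.fderiv]
  refine (h1.congr_of_eventuallyEq e1).congr_fderiv ?_
  ext v
  simp
  abel

lemma fderiv_apply (hp : p ∈ Ω) {X Y : Vec → Vec} (hX : DifferentiableAt ℝ X p)
    (hY : DifferentiableAt ℝ Y p) (v : Vec) :
    fderiv ℝ (fun q => F q (X q) (Y q)) p v =
      fderiv ℝ (fun q => F q (X p) (Y p)) p v + F p (fderiv ℝ X p v) (Y p)
        + F p (X p) (fderiv ℝ Y p v) := by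
  rw [(hF.hasFDerivAt_apply hp hX hY).fderiv]
  simp [hF.eq_bilinCLM hp]

lemma contDiffAt_apply (hp : p ∈ Ω) {X Y : Vec → Vec} (hX : ContDiffAt ℝ ∞ X p)
    (hY : ContDiffAt ℝ ∞ Y p) : ContDiffAt ℝ ∞ (fun q => F q (X q) (Y q)) p := by
  have e1 : (fun q => F q (X q) (Y q)) =ᶠ[𝓝 p] fun q => bilinCLM F q (X q) (Y q) := by
    filter_upwards [hF.mem_nhds hp] with q hq using hF.eq_bilinCLM hq _ _
  exact (((hF.contDiffAt_bilinCLM hp).clm_apply hX).clm_apply hY).congr_of_eventuallyEq e1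

/-- The derivative of a field of bilinear maps is a field of bilinear maps. -/
lemma fderiv_bilin (hp : p ∈ Ω) (v x y : Vec) :
    fderiv ℝ (fun q => F q x y) p v = fderiv ℝ (bilinCLM F) p v x y := by
  have e2 : (fun q => F q x y) =ᶠ[𝓝 p] fun q => bilinCLM F q x y := by
    filter_upwards [hF.mem_nhds hp] with q hq using hF.eq_bilinCLM hq _ _
  have hL : HasFDerivAt (bilinCLM F) (fderiv ℝ (bilinCLM F) p) p :=
    ((hF.contDiffAt_bilinCLM hp).differentiableAt (by simp)).hasFDerivAt
  have h2 := (hL.clm_apply (hasFDerivAt_const x p)).clm_apply (hasFDerivAt_const y p)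
  rw [e2.fderiv_eq, h2.fderiv]
  simp

end IsSmoothBilin

end bilin

/-! ### Smoothness of derivatives and of matrix operations -/

lemma contDiffAt_fderiv_apply {E : Type*} [NormedAddCommGroup E] [NormedSpace ℝ E] {f : Vec → E}
    {X : Vec → Vec} {p : Vec} (hf : ContDiffAt ℝ ∞ f p) (hX : ContDiffAt ℝ ∞ X p) :
    ContDiffAt ℝ ∞ (fun q => fderiv ℝ f q (X q)) p :=
  (hf.fderiv_right (m := ∞) (by simp)).clm_apply hX

lemma contDiffAt_det {n : ℕ} {M : Vec → Matrix (Fin n) (Fin n) ℝ} {p : Vec}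
    (hM : ∀ a b, ContDiffAt ℝ ∞ (fun q => M q a b) p) :
    ContDiffAt ℝ ∞ (fun q => (M q).det) p := by
  simp only [Matrix.det_apply]
  refine ContDiffAt.sum fun σ _ => ?_
  exact (contDiffAt_prod fun i _ => hM _ _).const_smul _

lemma contDiffAt_inv {n : ℕ} {M : Vec → Matrix (Fin n) (Fin n) ℝ} {p : Vec}
    (hM : ∀ a b, ContDiffAt ℝ ∞ (fun q => M q a b) p) (hdet : (M p).det ≠ 0) (a b : Fin n) :
    ContDiffAt ℝ ∞ (fun q => (M q)⁻¹ a b) p := by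
  simp only [Matrix.inv_def, Ring.inverse_eq_inv', Matrix.smul_apply, Matrix.adjugate_apply,
    smul_eq_mul]
  refine ((contDiffAt_det hM).inv hdet).mul (contDiffAt_det fun c d => ?_)
  simp only [Matrix.updateRow_apply]
  split_ifs
  · exact contDiffAt_const
  · exact hM _ _

lemma contDiffAt_mulVec {n : ℕ} {M : Vec → Matrix (Fin n) (Fin n) ℝ} {f : Vec → Fin n → ℝ} {p : Vec}
    (hM : ∀ a b, ContDiffAt ℝ ∞ (fun q => M q a b) p)
    (hf : ∀ b, ContDiffAt ℝ ∞ (fun q => f q b) p) : ContDiffAt ℝ ∞ (fun q => M q *ᵥ f q) p := by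
  refine contDiffAt_pi.2 fun a => ?_
  simp only [Matrix.mulVec, dotProduct]
  exact ContDiffAt.sum fun b _ => (hM a b).mul (hf b)

lemma isSmoothBilin_matrix {M : Vec → Matrix (Fin 4) (Fin 4) ℝ} {Ω : Set Vec} (hO : IsOpen Ω)
    (hM : ∀ p ∈ Ω, ∀ a b, ContDiffAt ℝ ∞ (fun q => M q a b) p) :
    IsSmoothBilin (ip M) Ω where
  isOpen := hO
  bilin q _ x y := by
    simp only [ip, Matrix.mulVec, dotProduct, basisVec, Finset.mul_sum, smul_eq_mul]
    refine Finset.sum_congr rfl fun a _ => Finset.sum_congr rfl fun b _ => ?_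
    simp [Pi.single_apply]
    ring
  smooth q hq x y := by
    simp only [ip, Matrix.mulVec, dotProduct]
    exact ContDiffAt.sum fun a _ => contDiffAt_const.mul
      (ContDiffAt.sum fun b _ => (hM q hq a b).mul contDiffAt_const)

end Hyperboloid

namespace Hyperboloid

/-! ### The Levi-Civita connection of a smooth metric -/

/-- `g` is a smooth nondegenerate symmetric metric at the points of the open set `Ω`. -/
structure IsMetric (g : MetricField) (Ω : Set Vec) : Prop where
  isOpen : IsOpen Ω
  smooth : ∀ q ∈ Ω, ∀ a b, ContDiffAt ℝ ∞ (fun q' => g q' a b) q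
  symm : ∀ q ∈ Ω, (g q).IsSymm
  det_ne : ∀ q ∈ Ω, (g q).det ≠ 0

variable {g : MetricField} {Ω : Set Vec} {p : Vec}

/-- `v ↦ D_v X` as a linear map. -/
def covCLM (g : MetricField) (X : Vec → Vec) (q : Vec) : Vec →L[ℝ] Vec :=
  fderiv ℝ X q + bilinCLM (christoffel g) q (X q)

lemma curvature_swap (g : MetricField) (p u v w : Vec) :
    curvature g p u v w = -curvature g p v u w := by
  simp only [curvature]
  abel

namespace IsMetric

variable (hg : IsMetric g Ω)
include hg

lemma mono {Ω' : Set Vec} (hO : IsOpen Ω') (h : Ω' ⊆ Ω) : IsMetric g Ω' :=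
  ⟨hO, fun q hq => hg.smooth q (h hq), fun q hq => hg.symm q (h hq),
    fun q hq => hg.det_ne q (h hq)⟩

lemma mem_nhds (hp : p ∈ Ω) : ∀ᶠ q in 𝓝 p, q ∈ Ω := hg.isOpen.mem_nhds hp

lemma ipB : IsSmoothBilin (ip g) Ω := isSmoothBilin_matrix hg.isOpen hg.smooth

lemma ip_comm (hp : p ∈ Ω) (x y : Vec) : ip g p x y = ip g p y x := by
  simp only [ip]
  rw [Matrix.dotProduct_mulVec, ← Matrix.mulVec_transpose, (hg.symm p hp).eq, dotProduct_comm]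

lemma isUnit_det (hp : p ∈ Ω) : IsUnit (g p).det := isUnit_iff_ne_zero.2 (hg.det_ne p hp)

lemma ip_inv_right (hp : p ∈ Ω) (x w : Vec) : ip g p x ((g p)⁻¹ *ᵥ w) = x ⬝ᵥ w := by
  simp [ip, Matrix.mulVec_mulVec, Matrix.mul_nonsing_inv _ (hg.isUnit_det hp)]

lemma ip_inv_left (hp : p ∈ Ω) (w x : Vec) : ip g p ((g p)⁻¹ *ᵥ w) x = w ⬝ᵥ x := by
  rw [hg.ip_comm hp, hg.ip_inv_right hp, dotProduct_comm]

/-- Nondegeneracy. Several vector identities below are proved by pairing with an arbitrary vector.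
-/
lemma ext_ip (hp : p ∈ Ω) {x x' : Vec} (h : ∀ y, ip g p x y = ip g p x' y) : x = x' := by
  have h1 : (g p) *ᵥ x = (g p) *ᵥ x' := by
    ext a
    have := h (basisVec a)
    rw [hg.ip_comm hp, hg.ip_comm hp x'] at this
    simpa [ip, basisVec] using this
  have := congrArg (fun z => (g p)⁻¹ *ᵥ z) h1
  simpa [Matrix.mulVec_mulVec, Matrix.nonsing_inv_mul _ (hg.isUnit_det hp)] using this

lemma contDiffAt_inv (hp : p ∈ Ω) (a b : Fin 4) : ContDiffAt ℝ ∞ (fun q => (g q)⁻¹ a b) p :=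
  Hyperboloid.contDiffAt_inv (hg.smooth p hp) (hg.det_ne p hp) a b

/-- The Koszul formula for constant fields. Since the bracket is linear in `z`, contracting its
components with those of `z` evaluates it at `z`. -/
lemma ip_christoffel (hp : p ∈ Ω) (x y z : Vec) :
    ip g p (christoffel g p x y) z = (1 / 2 : ℝ) *
      (fderiv ℝ (fun q => ip g q y z) p x + fderiv ℝ (fun q => ip g q x z) p y
        - fderiv ℝ (fun q => ip g q x y) p z) := by
  rw [christoffel, hg.ip_inv_left hp]
  simp only [hg.ipB.fderiv_bilin hp, dotProduct]
  set D := fderiv ℝ (bilinCLM (ip g)) p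
  have h := clm_eq_sum ((1 / 2 : ℝ) • (D x y + D y x - (D.flip x).flip y)) z
  simp only [smul_apply, sub_apply, add_apply, ContinuousLinearMap.flip_apply, smul_eq_mul] at h
  rw [h]
  exact Finset.sum_congr rfl fun a _ => by ring

lemma christoffel_comm (hp : p ∈ Ω) (x y : Vec) : christoffel g p x y = christoffel g p y x := by
  refine hg.ext_ip hp fun z => ?_
  have e : (fun q => ip g q x y) =ᶠ[𝓝 p] fun q => ip g q y x := by
    filter_upwards [hg.mem_nhds hp] with q hq using hg.ip_comm hq _ _
  rw [hg.ip_christoffel hp, hg.ip_christoffel hp, e.fderiv_eq]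
  ring

/-- The connection is metric. -/
lemma fderiv_ip_const (hp : p ∈ Ω) (v x y : Vec) :
    fderiv ℝ (fun q => ip g q x y) p v =
      ip g p (christoffel g p v x) y + ip g p x (christoffel g p v y) := by
  have e (x y) : (fun q => ip g q x y) =ᶠ[𝓝 p] fun q => ip g q y x := by
    filter_upwards [hg.mem_nhds hp] with q hq using hg.ip_comm hq _ _
  rw [hg.ip_comm hp x, hg.ip_christoffel hp, hg.ip_christoffel hp, (e y x).fderiv_eq,
    (e v x).fderiv_eq, (e v y).fderiv_eq]
  ring

lemma christoffelB : IsSmoothBilin (christoffel g) Ω where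
  isOpen := hg.isOpen
  bilin q hq x y := by
    refine hg.ext_ip hq fun z => ?_
    have h1 (f : Fin 4 → Vec) : ip g q (∑ a, f a) z = ∑ a, ip g q (f a) z := by
      simp [hg.ipB.eq_bilinCLM hq]
    simp only [h1, hg.ipB.smul_left hq, hg.ip_christoffel hq, hg.ipB.fderiv_bilin hq]
    set D := fderiv ℝ (bilinCLM (ip g)) q
    have hx (y : Vec) := clm_eq_sum ((1 / 2 : ℝ) • ((D.flip y).flip z + (D y).flip z
      - (D z).flip y)) x
    have hy (x : Vec) := clm_eq_sum ((1 / 2 : ℝ) • ((D x).flip z + (D.flip x).flip z - D z x)) y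
    simp only [smul_apply, sub_apply, add_apply, ContinuousLinearMap.flip_apply] at hx hy
    simp only [smul_eq_mul] at hx hy ⊢
    rw [hx]
    refine Finset.sum_congr rfl fun a _ => ?_
    rw [hy, Finset.mul_sum]
    exact Finset.sum_congr rfl fun b _ => by ring
  smooth q hq x y := by
    refine contDiffAt_mulVec (fun a b => hg.contDiffAt_inv hq a b) fun d => ?_
    have h (x y z : Vec) : ContDiffAt ℝ ∞ (fun q' => fderiv ℝ (fun q => ip g q x y) q' z) q :=
      contDiffAt_fderiv_apply (hg.ipB.smooth q hq _ _) contDiffAt_const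
    exact contDiffAt_const.mul (((h _ _ _).add (h _ _ _)).sub (h _ _ _))

/-- Symmetry of the Christoffel symbols allows the direction `v` to be moved to the last slot. -/
lemma cov_eq (hp : p ∈ Ω) (X : Vec → Vec) (v : Vec) : cov g X p v = covCLM g X p v := by
  simp [cov, covCLM, hg.christoffel_comm hp v, hg.christoffelB.eq_bilinCLM hp]

lemma contDiffAt_covCLM (hp : p ∈ Ω) {X : Vec → Vec} (hX : ContDiffAt ℝ ∞ X p) :
    ContDiffAt ℝ ∞ (covCLM g X) p := by
  unfold covCLM
  refine (hX.fderiv_right (m := ∞) (by simp)).add ?_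
  exact (hg.christoffelB.contDiffAt_bilinCLM hp).clm_apply hX

lemma contDiffAt_cov (hp : p ∈ Ω) {X Y : Vec → Vec} (hX : ContDiffAt ℝ ∞ X p)
    (hY : ContDiffAt ℝ ∞ Y p) : ContDiffAt ℝ ∞ (fun q => cov g X q (Y q)) p := by
  have e : (fun q => cov g X q (Y q)) =ᶠ[𝓝 p] fun q => covCLM g X q (Y q) := by
    filter_upwards [hg.mem_nhds hp] with q hq using hg.cov_eq hq _ _
  exact ((hg.contDiffAt_covCLM hp hX).clm_apply hY).congr_of_eventuallyEq e

lemma fderiv_cov (hp : p ∈ Ω) {X Y : Vec → Vec} (hX : ContDiffAt ℝ ∞ X p)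
    (hY : DifferentiableAt ℝ Y p) (v : Vec) :
    fderiv ℝ (fun q => cov g X q (Y q)) p v =
      fderiv ℝ (fun q => cov g X q (Y p)) p v + cov g X p (fderiv ℝ Y p v) := by
  have e (Y : Vec → Vec) : (fun q => cov g X q (Y q)) =ᶠ[𝓝 p] fun q => covCLM g X q (Y q) := by
    filter_upwards [hg.mem_nhds hp] with q hq using hg.cov_eq hq _ _
  have hL := ((hg.contDiffAt_covCLM hp hX).differentiableAt (by simp)).hasFDerivAt
  rw [(e Y).fderiv_eq, (e fun _ => Y p).fderiv_eq, (hL.clm_apply hY.hasFDerivAt).fderiv,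
    (hL.clm_apply (hasFDerivAt_const (Y p) p)).fderiv, hg.cov_eq hp]
  simp
  abel

/-- The derivative of the inner product of two vector fields. -/
lemma fderiv_ip (hp : p ∈ Ω) {X Y : Vec → Vec} (hX : DifferentiableAt ℝ X p)
    (hY : DifferentiableAt ℝ Y p) (v : Vec) :
    fderiv ℝ (fun q => ip g q (X q) (Y q)) p v =
      ip g p (cov g X p v) (Y p) + ip g p (X p) (cov g Y p v) := by
  rw [hg.ipB.fderiv_apply hp hX hY, hg.fderiv_ip_const hp, cov, cov, hg.ipB.add_left hp,
    hg.ipB.add_right hp]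
  ring

lemma ip_grad (hp : p ∈ Ω) (f : Vec → ℝ) (x : Vec) :
    ip g p (grad g f p) x = fderiv ℝ f p x := by
  rw [grad, hg.ip_inv_left hp]
  conv_rhs => rw [← sum_smul_basisVec x]
  simp [dotProduct, mul_comm]

lemma contDiffAt_grad (hp : p ∈ Ω) {f : Vec → ℝ} (hf : ContDiffAt ℝ ∞ f p) :
    ContDiffAt ℝ ∞ (grad g f) p :=
  contDiffAt_mulVec (fun a b => hg.contDiffAt_inv hp a b) fun _ =>
    contDiffAt_fderiv_apply hf contDiffAt_const

/-- The Hessian of a function is symmetric. -/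
lemma ip_cov_grad_comm (hp : p ∈ Ω) {f : Vec → ℝ} (hf : ContDiffAt ℝ ∞ f p) (x y : Vec) :
    ip g p (cov g (grad g f) p x) y = ip g p (cov g (grad g f) p y) x := by
  have hX : DifferentiableAt ℝ (grad g f) p := (hg.contDiffAt_grad hp hf).differentiableAt (by simp)
  have key (x y : Vec) : ip g p (cov g (grad g f) p x) y =
      fderiv ℝ (fderiv ℝ f) p x y - fderiv ℝ f p (christoffel g p x y) := by
    have h1 := hg.fderiv_ip hp hX (differentiableAt_const y) x
    have e : (fun q => ip g q (grad g f q) y) =ᶠ[𝓝 p] fun q => fderiv ℝ f q y := by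
      filter_upwards [hg.mem_nhds hp] with q hq using hg.ip_grad hq _ _
    have hd : HasFDerivAt (fderiv ℝ f) (fderiv ℝ (fderiv ℝ f) p) p :=
      ((hf.fderiv_right (m := ∞) (by simp)).differentiableAt (by simp)).hasFDerivAt
    rw [e.fderiv_eq, (hd.clm_apply (hasFDerivAt_const y p)).fderiv] at h1
    have h2 : cov g (fun _ => y) p x = christoffel g p x y := by simp [cov]
    rw [h2, hg.ip_grad hp] at h1
    simp at h1
    linarith
  rw [key, key, hg.christoffel_comm hp x y]
  rw [fderiv_fderiv_comm hf]

/-- The Ricci identity. -/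
lemma ricci_identity (hp : p ∈ Ω) {X : Vec → Vec} (hX : ContDiffAt ℝ ∞ X p) (u v : Vec) :
    (fderiv ℝ (fun q => cov g X q v) p u + christoffel g p u (cov g X p v))
      - (fderiv ℝ (fun q => cov g X q u) p v + christoffel g p v (cov g X p u))
      = curvature g p u v (X p) := by
  have hXd : DifferentiableAt ℝ X p := hX.differentiableAt (by simp)
  have hd : HasFDerivAt (fderiv ℝ X) (fderiv ℝ (fderiv ℝ X) p) p :=
    ((hX.fderiv_right (m := ∞) (by simp)).differentiableAt (by simp)).hasFDerivAt
  -- The second derivatives of `X` are symmetric and drop out of the commutator, leaving only the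
  -- derivatives and products of `Γ` that make up the curvature.
  have key (u v : Vec) : fderiv ℝ (fun q => cov g X q v) p u =
      fderiv ℝ (fderiv ℝ X) p u v + fderiv ℝ (fun q => christoffel g q v (X p)) p u
        + christoffel g p v (fderiv ℝ X p u) := by
    have h1 := hd.clm_apply (hasFDerivAt_const v p)
    have h2 := hg.christoffelB.hasFDerivAt_apply hp (differentiableAt_const v) hXd
    have h3 := (h1.add h2).fderiv
    change fderiv ℝ (fun q => cov g X q v) p = _ at h3
    rw [h3, add_assoc, hg.christoffelB.eq_bilinCLM hp]
    simp [add_assoc]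
  have hs := fderiv_fderiv_comm hX u v
  rw [key, key, curvature, hs, cov, cov, hg.christoffelB.add_right hp,
    hg.christoffelB.add_right hp]
  abel

/-- The curvature operator is antisymmetric. -/
lemma ip_curvature_antisymm (hp : p ∈ Ω) (u v x w : Vec) :
    ip g p x (curvature g p u v w) = -ip g p w (curvature g p u v x) := by
  have hf : ContDiffAt ℝ ∞ (fun q => ip g q x w) p := hg.ipB.smooth p hp x w
  have hd : HasFDerivAt (fderiv ℝ fun q => ip g q x w) (fderiv ℝ (fderiv ℝ fun q => ip g q x w) p) p
    := ((hf.fderiv_right (m := ∞) (by simp)).differentiableAt (by simp)).hasFDerivAt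
  have hs := fderiv_fderiv_comm hf u v
  have hc (a b : Vec) : DifferentiableAt ℝ (fun q => christoffel g q a b) p :=
    (hg.christoffelB.smooth p hp a b).differentiableAt (by simp)
  -- Metric compatibility is used twice on the function `⟨x, w⟩`. Antisymmetrising in `u, v` kills
  -- the left side and the cross terms `⟨Γx, Γw⟩`.
  have key (u v : Vec) : fderiv ℝ (fderiv ℝ fun q => ip g q x w) p u v =
      ip g p (fderiv ℝ (fun q => christoffel g q v x) p u
        + christoffel g p u (christoffel g p v x)) w
      + ip g p (christoffel g p v x) (christoffel g p u w)
      + (ip g p (christoffel g p u x) (christoffel g p v w)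
      + ip g p x (fderiv ℝ (fun q => christoffel g q v w) p u
        + christoffel g p u (christoffel g p v w))) := by
    have h1 := congrArg (fun L => L u) (hd.clm_apply (hasFDerivAt_const v p)).fderiv
    have e : (fun q => fderiv ℝ (fun q => ip g q x w) q v) =ᶠ[𝓝 p]
        fun q => ip g q (christoffel g q v x) w + ip g q x (christoffel g q v w) := by
      filter_upwards [hg.mem_nhds hp] with q hq using hg.fderiv_ip_const hq _ _ _
    have h2 := hg.ipB.hasFDerivAt_apply hp (hc v x) (differentiableAt_const w)
    have h3 := hg.ipB.hasFDerivAt_apply hp (differentiableAt_const x) (hc v w)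
    have h4 := congrArg (fun L => L u) (h2.add h3).fderiv
    have h5 := hg.fderiv_ip hp (hc v x) (differentiableAt_const w) u
    have h6 := hg.fderiv_ip hp (differentiableAt_const x) (hc v w) u
    have h7 : fderiv ℝ (fun q => ip g q (christoffel g q v x) w + ip g q x (christoffel g q v w)) p u
        = _ := congrArg (fun L => L u) (fderiv_fun_add h2.differentiableAt h3.differentiableAt)
    rw [e.fderiv_eq, h7, add_apply, h5, h6] at h1
    simp only [cov, fderiv_fun_const] at h1
    simpa using h1.symm
  rw [key, key] at hs
  have c1 := hg.ip_comm hp w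
  rw [c1]
  simp only [curvature, hg.ipB.add_left hp, hg.ipB.sub_left hp, hg.ipB.add_right hp,
    hg.ipB.sub_right hp] at hs ⊢
  linarith

/-- The derivative of `D X` along a geodesic field `X`. -/
lemma fderiv_cov_geodesic (hp : p ∈ Ω) {X : Vec → Vec} (hX : ContDiffAt ℝ ∞ X p)
    (hgeo : ∀ᶠ q in 𝓝 p, cov g X q (X q) = 0) (v : Vec) :
    fderiv ℝ (fun q => cov g X q v) p (X p) = curvature g p (X p) v (X p)
      - cov g X p (cov g X p v) - christoffel g p (X p) (cov g X p v)
      + cov g X p (christoffel g p (X p) v) := by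
  have h1 := hg.ricci_identity hp hX (X p) v
  -- Differentiating `D_X X = 0` along `v` replaces a second derivative by `DX` applied to `∂_v X`:
  -- this is the source of the quadratic Riccati term. The Christoffel terms left over form a
  -- commutator with `DX`.
  have h2 := hg.fderiv_cov hp hX (hX.differentiableAt (by simp)) v
  have e : (fun q => cov g X q (X q)) =ᶠ[𝓝 p] fun _ => 0 := hgeo
  rw [e.fderiv_eq] at h2
  have h3 : fderiv ℝ X p v = cov g X p v - christoffel g p (X p) v := by
    rw [cov, hg.christoffel_comm hp v]
    abel
  rw [h3, hg.cov_eq hp X (_ - _), map_sub, ← hg.cov_eq hp, ← hg.cov_eq hp] at h2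
  simp only [fderiv_fun_const, Pi.zero_apply, zero_apply] at h2
  rw [hgeo.self_of_nhds, hg.christoffelB.zero_right hp, add_zero] at h1
  have h4 : fderiv ℝ (fun q => cov g X q (X p)) p v
      = -(cov g X p (cov g X p v) - cov g X p (christoffel g p (X p) v)) :=
    eq_neg_of_add_eq_zero_left h2.symm
  rw [h4] at h1
  rw [← h1]
  abel

end IsMetric

end Hyperboloid

namespace Hyperboloid

/-! ### Lie derivatives of bilinear fields -/

lemma isSmoothBilin_of_pointwise {E : Type*} [NormedAddCommGroup E] [NormedSpace ℝ E]
    {Ω : Set Vec} (hO : IsOpen Ω) {F : Vec → Vec → Vec → E}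
    (hL : ∀ q ∈ Ω, ∃ L : Vec →L[ℝ] Vec →L[ℝ] E, ∀ x y, F q x y = L x y)
    (hs : ∀ q ∈ Ω, ∀ x y, ContDiffAt ℝ ∞ (fun q' => F q' x y) q) :
    IsSmoothBilin F Ω where
  isOpen := hO
  bilin q hq x y := by
    obtain ⟨L, h⟩ := hL q hq
    simp only [h]
    rw [clm_eq_sum L x, sum_apply]
    refine Finset.sum_congr rfl fun a _ => ?_
    rw [smul_apply, clm_eq_sum (L (basisVec a)) y, Finset.smul_sum]
    exact Finset.sum_congr rfl fun b _ => smul_smul _ _ _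
  smooth := hs

lemma lieTensor_congr {F F' : Tensor2} {X : Vec → Vec} {Ω : Set Vec} {p : Vec} (hO : IsOpen Ω)
    (hp : p ∈ Ω) (h : ∀ q ∈ Ω, ∀ x y, F q x y = F' q x y) (x y : Vec) :
    lieTensor X F p x y = lieTensor X F' p x y := by
  have e : (fun q => F q x y) =ᶠ[𝓝 p] fun q => F' q x y := by
    filter_upwards [hO.mem_nhds hp] with q hq using h q hq _ _
  rw [lieTensor, lieTensor, e.fderiv_eq, h p hp, h p hp]

lemma lieTensor_const_mul (c : ℝ) {F : Tensor2} {X : Vec → Vec} {p : Vec} {x y : Vec}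
    (h : DifferentiableAt ℝ (fun q => F q x y) p) :
    lieTensor X (fun q x y => c * F q x y) p x y = c * lieTensor X F p x y := by
  rw [lieTensor, lieTensor, fderiv_const_mul h]
  simp only [smul_apply, smul_eq_mul]
  ring

/-- The shape is that of `traceless`, with `c` the trace and `H` the induced metric. -/
lemma lieTensor_sub_mul {F H : Tensor2} {c : Vec → ℝ} {X : Vec → Vec} {p x y : Vec}
    (hF : DifferentiableAt ℝ (fun q => F q x y) p) (hH : DifferentiableAt ℝ (fun q => H q x y) p)
    (hc : DifferentiableAt ℝ c p) :
    lieTensor X (fun q x y => F q x y - 1 / 3 * c q * H q x y) p x y =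
      lieTensor X F p x y - 1 / 3 * fderiv ℝ c p (X p) * H p x y
        - 1 / 3 * c p * lieTensor X H p x y := by
  simp only [lieTensor]
  rw [fderiv_fun_sub hF ((hc.const_mul _).fun_mul hH), fderiv_fun_mul (hc.const_mul _) hH,
    fderiv_const_mul hc]
  simp only [sub_apply, add_apply, smul_apply, smul_eq_mul]
  ring

lemma covTensor_sub_mul {g : MetricField} {F H : Tensor2} {c : Vec → ℝ} {p v x y : Vec}
    (hF : DifferentiableAt ℝ (fun q => F q x y) p) (hH : DifferentiableAt ℝ (fun q => H q x y) p)
    (hc : DifferentiableAt ℝ c p) :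
    covTensor g (fun q x y => F q x y - 1 / 3 * c q * H q x y) p v x y =
      covTensor g F p v x y - 1 / 3 * fderiv ℝ c p v * H p x y
        - 1 / 3 * c p * covTensor g H p v x y := by
  simp only [covTensor]
  rw [fderiv_fun_sub hF ((hc.const_mul _).fun_mul hH), fderiv_fun_mul (hc.const_mul _) hH,
    fderiv_const_mul hc]
  simp only [sub_apply, add_apply, smul_apply, smul_eq_mul]
  ring

namespace IsSmoothBilin

variable {F : Tensor2} {Ω : Set Vec} {p : Vec} {X Y : Vec → Vec} (hF : IsSmoothBilin F Ω)
include hF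

lemma lie (hX : ∀ q ∈ Ω, ContDiffAt ℝ ∞ X q) : IsSmoothBilin (lieTensor X F) Ω := by
  refine isSmoothBilin_of_pointwise hF.isOpen (fun q hq => ?_) fun q hq x y => ?_
  · refine ⟨fderiv ℝ (bilinCLM F) q (X q) + (bilinCLM F q).comp (fderiv ℝ X q)
      + ((bilinCLM F q).flip.comp (fderiv ℝ X q)).flip, fun x y => ?_⟩
    simp [lieTensor, hF.fderiv_bilin hq, hF.eq_bilinCLM hq]
  · refine ((contDiffAt_fderiv_apply (hF.smooth q hq _ _) (hX q hq)).add ?_).add ?_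
    · exact hF.contDiffAt_apply hq (contDiffAt_fderiv_apply (hX q hq) contDiffAt_const)
        contDiffAt_const
    · exact hF.contDiffAt_apply hq contDiffAt_const
        (contDiffAt_fderiv_apply (hX q hq) contDiffAt_const)

/-- Lie derivatives along commuting vector fields commute. -/
lemma lie_comm (hX : ∀ q ∈ Ω, ContDiffAt ℝ ∞ X q) (hY : ∀ q ∈ Ω, ContDiffAt ℝ ∞ Y q)
    (hXY : ∀ q ∈ Ω, fderiv ℝ Y q (X q) = fderiv ℝ X q (Y q)) (hp : p ∈ Ω) (x y : Vec) :
    lieTensor X (lieTensor Y F) p x y = lieTensor Y (lieTensor X F) p x y := by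
  have hd {E : Type} [NormedAddCommGroup E] [NormedSpace ℝ E] {f : Vec → E}
      (hf : ContDiffAt ℝ ∞ f p) : HasFDerivAt (fderiv ℝ f) (fderiv ℝ (fderiv ℝ f) p) p :=
    ((hf.fderiv_right (m := ∞) (by simp)).differentiableAt (by simp)).hasFDerivAt
  have hf := hF.smooth p hp x y
  have key {X Y : Vec → Vec} (hY : ContDiffAt ℝ ∞ Y p) (hX : ContDiffAt ℝ ∞ X p) :
      lieTensor X (lieTensor Y F) p x y =
      (fderiv ℝ (fderiv ℝ fun q => F q x y) p (X p) (Y p)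
        + fderiv ℝ (fun q => F q x y) p (fderiv ℝ Y p (X p))
        + (fderiv ℝ (fun q => F q (fderiv ℝ Y p x) y) p (X p)
          + F p (fderiv ℝ (fderiv ℝ Y) p (X p) x) y)
        + (fderiv ℝ (fun q => F q x (fderiv ℝ Y p y)) p (X p)
          + F p x (fderiv ℝ (fderiv ℝ Y) p (X p) y)))
      + (fderiv ℝ (fun q => F q (fderiv ℝ X p x) y) p (Y p)
        + F p (fderiv ℝ Y p (fderiv ℝ X p x)) y + F p (fderiv ℝ X p x) (fderiv ℝ Y p y))
      + (fderiv ℝ (fun q => F q x (fderiv ℝ X p y)) p (Y p)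
        + F p (fderiv ℝ Y p x) (fderiv ℝ X p y) + F p x (fderiv ℝ Y p (fderiv ℝ X p y))) := by
    have hDY (z : Vec) : HasFDerivAt (fun q => fderiv ℝ Y q z)
        ((fderiv ℝ (fderiv ℝ Y) p).flip z) p := by
      simpa using (hd hY).clm_apply (hasFDerivAt_const z p)
    have h1 := (hd hf).clm_apply (hY.differentiableAt (by simp)).hasFDerivAt
    have h2 := hF.hasFDerivAt_apply hp (hDY x).differentiableAt (differentiableAt_const y)
    have h3 := hF.hasFDerivAt_apply hp (differentiableAt_const x) (hDY y).differentiableAt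
    have e : fderiv ℝ (fun q => lieTensor Y F q x y) p = _ := ((h1.add h2).add h3).fderiv
    rw [lieTensor, e]
    simp only [lieTensor, (hDY x).fderiv, (hDY y).fderiv, hF.eq_bilinCLM hp]
    simp only [add_apply, ContinuousLinearMap.comp_apply, ContinuousLinearMap.flip_apply,
      fderiv_fun_const, Pi.zero_apply, zero_apply, map_zero, add_zero]
    ring
  -- The derivative of the commutation relation in the direction `z`. It matches the terms with
  -- second derivatives of the fields, the only ones not already symmetric in `X` and `Y` once `hXY`
  -- is applied.
  have hcomm (z : Vec) : fderiv ℝ (fderiv ℝ Y) p (X p) z + fderiv ℝ Y p (fderiv ℝ X p z)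
      = fderiv ℝ (fderiv ℝ X) p (Y p) z + fderiv ℝ X p (fderiv ℝ Y p z) := by
    have h1 := ((hd (hY p hp)).clm_apply ((hX p hp).differentiableAt (by simp)).hasFDerivAt).fderiv
    have h2 := ((hd (hX p hp)).clm_apply ((hY p hp).differentiableAt (by simp)).hasFDerivAt).fderiv
    have e : (fun q => fderiv ℝ Y q (X q)) =ᶠ[𝓝 p] fun q => fderiv ℝ X q (Y q) := by
      filter_upwards [hF.mem_nhds hp] with q hq using hXY q hq
    rw [e.fderiv_eq, h2] at h1
    have h3 := congrArg (fun L => L z) h1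
    simp only [add_apply, ContinuousLinearMap.comp_apply, ContinuousLinearMap.flip_apply] at h3
    rw [fderiv_fderiv_comm (hY p hp), fderiv_fderiv_comm (hX p hp), add_comm, ← h3, add_comm]
  have c1 := congrArg (fun z => F p z y) (hcomm x)
  have c2 := congrArg (fun z => F p x z) (hcomm y)
  simp only [hF.add_left hp, hF.add_right hp] at c1 c2
  rw [key (hY p hp) (hX p hp), key (hX p hp) (hY p hp), hXY p hp, fderiv_fderiv_comm hf]
  linarith

end IsSmoothBilin

/-! ### Traces -/

/-- The trace of a covariant tensor with respect to the spacetime metric. -/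
def gtr (g : MetricField) (F : Tensor2) (p : Vec) : ℝ :=
  ∑ c, ∑ d, (g p)⁻¹ c d * F p (basisVec c) (basisVec d)

/-- The full contraction of two covariant tensors with respect to the spacetime metric. -/
def contr (g : MetricField) (F G : Tensor2) (p : Vec) : ℝ :=
  ∑ c, ∑ d, ∑ c', ∑ d', (g p)⁻¹ c c' * (g p)⁻¹ d d' *
    F p (basisVec c) (basisVec d) * G p (basisVec c') (basisVec d')

/-- The matrix of components. -/
def compMatrix (F : Tensor2) (p : Vec) : Matrix (Fin 4) (Fin 4) ℝ :=
  Matrix.of fun a b => F p (basisVec a) (basisVec b)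

/-- Commutators are traceless; this removes the Christoffel terms when the Riccati equation is
traced. -/
lemma sum_clm_comm (L M : Vec →L[ℝ] Vec) :
    ∑ c, L (M (basisVec c)) c = ∑ c, M (L (basisVec c)) c := by
  have h (L M : Vec →L[ℝ] Vec) : ∑ c, L (M (basisVec c)) c
      = ∑ c, ∑ a, M (basisVec c) a * L (basisVec a) c := by
    refine Finset.sum_congr rfl fun c _ => ?_
    rw [clm_eq_sum L (M (basisVec c))]
    simp
  rw [h L M, h M L, Finset.sum_comm]
  exact Finset.sum_congr rfl fun c _ => Finset.sum_congr rfl fun a _ => mul_comm _ _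

lemma gtr_eq_trace (g : MetricField) (F : Tensor2) (p : Vec) :
    gtr g F p = ((g p)⁻¹ * (compMatrix F p)ᵀ).trace := by
  simp [gtr, Matrix.trace, Matrix.mul_apply, compMatrix]

namespace IsMetric

variable {g : MetricField} {Ω : Set Vec} {p : Vec} (hg : IsMetric g Ω)
include hg

lemma inv_transpose (hp : p ∈ Ω) : ((g p)⁻¹)ᵀ = (g p)⁻¹ := by
  rw [Matrix.transpose_nonsing_inv, (hg.symm p hp).eq]

lemma contr_eq_trace (hp : p ∈ Ω) (F G : Tensor2) :
    contr g F G p = ((g p)⁻¹ * compMatrix F p * (g p)⁻¹ * (compMatrix G p)ᵀ).trace := by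
  have hs (a b : Fin 4) : (g p)⁻¹ a b = (g p)⁻¹ b a := congrFun (congrFun (hg.inv_transpose hp) b) a
  simp only [contr, Matrix.trace, Matrix.diag, Matrix.mul_apply, compMatrix, Matrix.transpose_apply,
    Matrix.of_apply, Finset.sum_mul]
  have e1 : ∑ c, ∑ d, ∑ c', ∑ d', (g p)⁻¹ c c' * (g p)⁻¹ d d' * F p (basisVec c) (basisVec d)
      * G p (basisVec c') (basisVec d') = ∑ c, ∑ d, ∑ d', ∑ c', (g p)⁻¹ c c' * (g p)⁻¹ d d' *
        F p (basisVec c) (basisVec d) * G p (basisVec c') (basisVec d') :=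
    Finset.sum_congr rfl fun c _ => Finset.sum_congr rfl fun d _ => Finset.sum_comm
  rw [e1]
  have e2 (f : Fin 4 → Fin 4 → Fin 4 → Fin 4 → ℝ) : ∑ c, ∑ d, ∑ d', ∑ c', f c d d' c'
      = ∑ c', ∑ d', ∑ d, ∑ c, f c d d' c' := by
    simp only [Fin.sum_univ_four]
    ring
  rw [e2]
  refine Finset.sum_congr rfl fun a _ => Finset.sum_congr rfl fun b _ =>
    Finset.sum_congr rfl fun c _ => Finset.sum_congr rfl fun d _ => ?_
  rw [hs d a]
  ring

lemma contr_comm (hp : p ∈ Ω) (F G : Tensor2) : contr g F G p = contr g G F p := by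
  rw [hg.contr_eq_trace hp, hg.contr_eq_trace hp, ← Matrix.trace_transpose]
  simp only [Matrix.transpose_mul, Matrix.transpose_transpose, hg.inv_transpose hp]
  rw [Matrix.trace_mul_comm, Matrix.mul_assoc, Matrix.mul_assoc, ← Matrix.mul_assoc,
    Matrix.trace_mul_comm]
  simp only [Matrix.mul_assoc]

lemma sum_inv_mul (hp : p ∈ Ω) (z : Vec) (c : Fin 4) :
    ∑ d, (g p)⁻¹ c d * ip g p z (basisVec d) = z c := by
  have h : (fun d => ip g p z (basisVec d)) = g p *ᵥ z := by
    ext d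
    rw [hg.ip_comm hp]
    simp [ip, basisVec]
  have := congrFun (Matrix.mulVec_mulVec z (g p)⁻¹ (g p)) c
  rw [Matrix.nonsing_inv_mul _ (hg.isUnit_det hp), Matrix.one_mulVec, ← h] at this
  simpa [Matrix.mulVec, dotProduct] using this

/-- The derivative of the trace of a tensor. -/
lemma fderiv_gtr {F : Tensor2} {X : Vec → Vec} (hF : IsSmoothBilin F Ω) (hp : p ∈ Ω) :
    fderiv ℝ (gtr g F) p (X p) = gtr g (lieTensor X F) p - contr g (lieTensor X (ip g)) F p := by
  set v := X p with hv
  let dF : Matrix (Fin 4) (Fin 4) ℝ :=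
    Matrix.of fun a b => fderiv ℝ (fun q => F q (basisVec a) (basisVec b)) p v
  let dg : Matrix (Fin 4) (Fin 4) ℝ := Matrix.of fun a b => fderiv ℝ (fun q => g q a b) p v
  let dG : Matrix (Fin 4) (Fin 4) ℝ := Matrix.of fun a b => fderiv ℝ (fun q => (g q)⁻¹ a b) p v
  -- The Jacobian of `X`, which enters a Lie derivative as `Jᵀ F + F J`. Its contributions to the
  -- two terms on the right cancel by cyclicity of the trace.
  let J : Matrix (Fin 4) (Fin 4) ℝ := Matrix.of fun a b => fderiv ℝ X p (basisVec b) a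
  have hGd (a b : Fin 4) : DifferentiableAt ℝ (fun q => (g q)⁻¹ a b) p :=
    (hg.contDiffAt_inv hp a b).differentiableAt (by simp)
  have hgd (a b : Fin 4) : DifferentiableAt ℝ (fun q => g q a b) p :=
    (hg.smooth p hp a b).differentiableAt (by simp)
  have hFd (x y : Vec) : DifferentiableAt ℝ (fun q => F q x y) p :=
    (hF.smooth p hp x y).differentiableAt (by simp)
  have hlie {H : Tensor2} (hH : IsSmoothBilin H Ω) : compMatrix (lieTensor X H) p =
      Matrix.of (fun a b => fderiv ℝ (fun q => H q (basisVec a) (basisVec b)) p v)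
        + Jᵀ * compMatrix H p + compMatrix H p * J := by
    ext a b
    simp only [compMatrix, lieTensor, Matrix.add_apply, Matrix.of_apply, Matrix.mul_apply,
      Matrix.transpose_apply, J]
    congr 1
    · congr 1
      have := clm_eq_sum ((bilinCLM H p).flip (basisVec b)) (fderiv ℝ X p (basisVec a))
      simpa [hH.eq_bilinCLM hp] using this
    · have := clm_eq_sum (bilinCLM H p (basisVec a)) (fderiv ℝ X p (basisVec b))
      simpa [hH.eq_bilinCLM hp, mul_comm] using this
  have hcg (q : Vec) (a b : Fin 4) : ip g q (basisVec a) (basisVec b) = g q a b := by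
    simp [ip, basisVec]
  have hcg' : compMatrix (ip g) p = g p := by
    ext a b
    simp [compMatrix, hcg]
  have hdG : dG = -((g p)⁻¹ * dg * (g p)⁻¹) := by
    have h1 : dG * g p + (g p)⁻¹ * dg = 0 := by
      ext a b
      have e : (fun q => ∑ c, (g q)⁻¹ a c * g q c b) =ᶠ[𝓝 p] fun _ => (1 : Matrix _ _ ℝ) a b := by
        filter_upwards [hg.mem_nhds hp] with q hq
        rw [← Matrix.mul_apply, Matrix.nonsing_inv_mul _ (hg.isUnit_det hq)]
      have h2 := congrArg (fun L : Vec →L[ℝ] ℝ => L v) (e.fderiv_eq (𝕜 := ℝ))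
      rw [fderiv_fun_sum fun c _ => (hGd a c).fun_mul (hgd c b)] at h2
      simp only [fderiv_fun_mul (hGd _ _) (hgd _ _), sum_apply, add_apply, smul_apply, smul_eq_mul,
        fderiv_fun_const, Pi.zero_apply, zero_apply] at h2
      simp only [Matrix.add_apply, Matrix.mul_apply, Matrix.zero_apply, dG, dg, Matrix.of_apply,
        ← Finset.sum_add_distrib]
      rw [← h2]
      exact Finset.sum_congr rfl fun c _ => by ring
    have h2 := congrArg (· * (g p)⁻¹) h1
    simp only [Matrix.add_mul, Matrix.mul_assoc, Matrix.mul_nonsing_inv _ (hg.isUnit_det hp),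
      Matrix.mul_one, Matrix.zero_mul] at h2
    rw [Matrix.mul_assoc]
    exact eq_neg_of_add_eq_zero_left h2
  have hL : fderiv ℝ (gtr g F) p v = (dG * (compMatrix F p)ᵀ).trace + ((g p)⁻¹ * dFᵀ).trace := by
    unfold gtr
    rw [fderiv_fun_sum fun c _ => DifferentiableAt.fun_sum fun d _ => (hGd c d).fun_mul (hFd _ _)]
    simp only [fderiv_fun_sum fun d _ => (hGd _ d).fun_mul (hFd _ _), fderiv_fun_mul (hGd _ _) (hFd _ _),
      sum_apply, add_apply, smul_apply, smul_eq_mul, Matrix.trace, Matrix.diag, Matrix.mul_apply,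
      Matrix.transpose_apply, compMatrix, Matrix.of_apply, dG, dF, ← Finset.sum_add_distrib]
    exact Finset.sum_congr rfl fun c _ => Finset.sum_congr rfl fun d _ => by ring
  rw [hL, gtr_eq_trace, hg.contr_eq_trace hp, hlie hF, hlie hg.ipB, hcg', hdG]
  have hdg : (Matrix.of fun a b => fderiv ℝ (fun q => ip g q (basisVec a) (basisVec b)) p v) = dg :=
    by simp only [hcg, dg]
  rw [hdg]
  change _ = ((g p)⁻¹ * (dF + Jᵀ * compMatrix F p + compMatrix F p * J)ᵀ).trace - _
  have hG1 := Matrix.nonsing_inv_mul _ (hg.isUnit_det hp)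
  have hG2 := Matrix.mul_nonsing_inv _ (hg.isUnit_det hp)
  set G := (g p)⁻¹
  set M := (compMatrix F p)ᵀ
  have e1 : G * (dg + Jᵀ * g p + g p * J) * G * M = G * dg * G * M + G * Jᵀ * M + J * G * M := by
    have : G * (dg + Jᵀ * g p + g p * J) * G * M
        = G * dg * G * M + G * Jᵀ * (g p * G) * M + (G * g p) * J * G * M := by noncomm_ring
    rw [this, hG1, hG2]
    noncomm_ring
  have e2 : G * (dF + Jᵀ * compMatrix F p + compMatrix F p * J)ᵀ
      = G * dFᵀ + G * M * J + G * Jᵀ * M := by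
    simp only [Matrix.transpose_add, Matrix.transpose_mul, Matrix.transpose_transpose, M]
    noncomm_ring
  rw [e1, e2]
  simp only [Matrix.trace_add, Matrix.neg_mul, Matrix.trace_neg]
  rw [Matrix.trace_mul_comm (G * M) J, ← Matrix.mul_assoc]
  ring

lemma contDiffAt_gtr {F : Tensor2} (hF : IsSmoothBilin F Ω) (hp : p ∈ Ω) :
    ContDiffAt ℝ ∞ (gtr g F) p :=
  ContDiffAt.sum fun c _ => ContDiffAt.sum fun d _ =>
    (hg.contDiffAt_inv hp c d).mul (hF.smooth p hp _ _)

end IsMetric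

end Hyperboloid

namespace Hyperboloid

namespace Spacetime

/-! ### Regions foliated by hyperboloids -/

/-- `ρ` is smooth and positive on the open set `Ω`, and `B = -D ρ` is a unit timelike field. -/
structure IsHyperboloidal (S : Spacetime) (Ω : Set Vec) : Prop where
  metric : IsMetric S.g Ω
  rho_smooth : ∀ q ∈ Ω, ContDiffAt ℝ ∞ S.rho q
  rho_pos : ∀ q ∈ Ω, 0 < S.rho q
  ip_B_B : ∀ q ∈ Ω, ip S.g q (S.B q) (S.B q) = -1

section

variable {S : Spacetime} {Ω : Set Vec} {p : Vec}

/-- The inverse induced metric is `g⁻¹ + B ⊗ B`. The correction vanishes for `k` and for the boost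
deformations, so their traces can be differentiated as spacetime traces. -/
lemma tr_eq {F : Tensor2} (hF : IsSmoothBilin F Ω) (hp : p ∈ Ω) :
    S.tr F p = gtr S.g F p + F p (S.B p) (S.B p) := by
  rw [hF.bilin p hp, tr, gtr]
  simp only [hbarInv, add_mul, Finset.sum_add_distrib, smul_eq_mul]

lemma proj_of_isTangent {x : Vec} (hx : S.IsTangent p x) : S.proj p x = x := by
  rw [proj, hx]
  simp

lemma hbar_of_isTangent {x : Vec} (hx : S.IsTangent p x) (y : Vec) :
    S.hbar p x y = ip S.g p x y := by
  rw [hbar, hx]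
  ring

end

namespace IsHyperboloidal

variable {S : Spacetime} {Ω : Set Vec} {p : Vec} (h : S.IsHyperboloidal Ω)
include h

lemma mem_nhds (hp : p ∈ Ω) : ∀ᶠ q in 𝓝 p, q ∈ Ω := h.metric.isOpen.mem_nhds hp

lemma B_smooth (hp : p ∈ Ω) : ContDiffAt ℝ ∞ S.B p :=
  (h.metric.contDiffAt_grad hp (h.rho_smooth p hp)).neg

lemma B_diff (hp : p ∈ Ω) : DifferentiableAt ℝ S.B p := (h.B_smooth hp).differentiableAt (by simp)

lemma ip_B (hp : p ∈ Ω) (x : Vec) : ip S.g p (S.B p) x = -fderiv ℝ S.rho p x := by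
  rw [B, h.metric.ipB.neg_left hp, h.metric.ip_grad hp]

/-- `DB` is minus the Hessian of `ρ`. -/
lemma ip_cov_B_comm (hp : p ∈ Ω) (x y : Vec) :
    ip S.g p (cov S.g S.B p x) y = ip S.g p (cov S.g S.B p y) x := by
  have hd : DifferentiableAt ℝ (grad S.g S.rho) p :=
    (h.metric.contDiffAt_grad hp (h.rho_smooth p hp)).differentiableAt (by simp)
  have e (x : Vec) : cov S.g S.B p x = -cov S.g (grad S.g S.rho) p x := by
    have : fderiv ℝ S.B p = -fderiv ℝ (grad S.g S.rho) p := fderiv_neg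
    rw [cov, cov, this, B, h.metric.christoffelB.neg_right hp]
    simp
    abel
  rw [e, e, h.metric.ipB.neg_left hp, h.metric.ipB.neg_left hp,
    h.metric.ip_cov_grad_comm hp (h.rho_smooth p hp)]

/-- Differentiate the constant `⟨B, B⟩ = -1`. -/
lemma ip_cov_B_B (hp : p ∈ Ω) (x : Vec) : ip S.g p (cov S.g S.B p x) (S.B p) = 0 := by
  have h1 := h.metric.fderiv_ip hp (h.B_diff hp) (h.B_diff hp) x
  have e : (fun q => ip S.g q (S.B q) (S.B q)) =ᶠ[𝓝 p] fun _ => -1 := by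
    filter_upwards [h.mem_nhds hp] with q hq using h.ip_B_B q hq
  rw [e.fderiv_eq, h.metric.ip_comm hp (S.B p)] at h1
  simp only [fderiv_fun_const, Pi.zero_apply, zero_apply] at h1
  linarith

/-- The integral curves of `B` are geodesics. -/
lemma cov_B_B (hp : p ∈ Ω) : cov S.g S.B p (S.B p) = 0 := by
  refine h.metric.ext_ip hp fun y => ?_
  rw [h.ip_cov_B_comm hp, h.ip_cov_B_B hp, h.metric.ipB.zero_left hp]

/-- The projections are redundant because `DB` kills `B` and its image is orthogonal to `B`. -/
lemma k_eq (hp : p ∈ Ω) (x y : Vec) : S.k p x y = ip S.g p (cov S.g S.B p x) y := by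
  have e : cov S.g S.B p (S.proj p x) = cov S.g S.B p x := by
    rw [proj, h.metric.cov_eq hp, map_add, map_smul, ← h.metric.cov_eq hp, ← h.metric.cov_eq hp,
      h.cov_B_B hp, smul_zero, add_zero]
  rw [k, e, proj, h.metric.ipB.add_right hp, h.metric.ipB.smul_right hp, h.ip_cov_B_B hp]
  simp

lemma k_comm (hp : p ∈ Ω) (x y : Vec) : S.k p x y = S.k p y x := by
  rw [h.k_eq hp, h.k_eq hp, h.ip_cov_B_comm hp]

lemma isSmoothBilin_k : IsSmoothBilin S.k Ω := by
  refine isSmoothBilin_of_pointwise h.metric.isOpen (fun q hq => ?_) fun q hq x y => ?_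
  · refine ⟨(bilinCLM (ip S.g) q).comp (covCLM S.g S.B q), fun x y => ?_⟩
    rw [h.k_eq hq, h.metric.cov_eq hq, h.metric.ipB.eq_bilinCLM hq]
    rfl
  · have e : (fun q => S.k q x y) =ᶠ[𝓝 q] fun q => ip S.g q (cov S.g S.B q x) y := by
      filter_upwards [h.mem_nhds hq] with r hr using h.k_eq hr x y
    exact (h.metric.ipB.contDiffAt_apply hq
      (h.metric.contDiffAt_cov hq (h.B_smooth hq) contDiffAt_const)
      contDiffAt_const).congr_of_eventuallyEq e

lemma isSmoothBilin_hbar : IsSmoothBilin S.hbar Ω := by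
  refine isSmoothBilin_of_pointwise h.metric.isOpen (fun q hq => ?_) fun q hq x y => ?_
  · refine ⟨bilinCLM (ip S.g) q + ((bilinCLM (ip S.g) q).flip (S.B q)).smulRight
      ((bilinCLM (ip S.g) q).flip (S.B q)), fun x y => ?_⟩
    simp [hbar, h.metric.ipB.eq_bilinCLM hq]
  · have e (x : Vec) := h.metric.ipB.contDiffAt_apply hq (contDiffAt_const (c := x)) (h.B_smooth hq)
    exact (h.metric.ipB.smooth q hq x y).add ((e x).mul (e y))

lemma contDiffAt_tr {F : Tensor2} (hF : IsSmoothBilin F Ω) (hp : p ∈ Ω) :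
    ContDiffAt ℝ ∞ (S.tr F) p := by
  have e : S.tr F =ᶠ[𝓝 p] fun q => gtr S.g F q + F q (S.B q) (S.B q) := by
    filter_upwards [h.mem_nhds hp] with q hq using tr_eq hF hq
  exact ((h.metric.contDiffAt_gtr hF hp).add
    (hF.contDiffAt_apply hp (h.B_smooth hp) (h.B_smooth hp))).congr_of_eventuallyEq e

lemma differentiableAt_tr {F : Tensor2} (hF : IsSmoothBilin F Ω) (hp : p ∈ Ω) :
    DifferentiableAt ℝ (S.tr F) p :=
  (h.contDiffAt_tr hF hp).differentiableAt (by simp)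

lemma isSmoothBilin_traceless {F : Tensor2} (hF : IsSmoothBilin F Ω) :
    IsSmoothBilin (S.traceless F) Ω := by
  refine isSmoothBilin_of_pointwise h.metric.isOpen (fun q hq => ?_) fun q hq x y => ?_
  · refine ⟨bilinCLM F q - (1 / 3 * S.tr F q) • bilinCLM S.hbar q, fun x y => ?_⟩
    simp [traceless, hF.eq_bilinCLM hq, h.isSmoothBilin_hbar.eq_bilinCLM hq]
  · exact (hF.smooth q hq x y).sub ((contDiffAt_const.mul (h.contDiffAt_tr hF hq)).mul
      (h.isSmoothBilin_hbar.smooth q hq x y))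

lemma hbarInv_comm (hp : p ∈ Ω) (c d : Fin 4) : S.hbarInv p c d = S.hbarInv p d c := by
  have := congrFun (congrFun (h.metric.inv_transpose hp) d) c
  simp only [Matrix.transpose_apply] at this
  rw [hbarInv, hbarInv, this]
  ring

lemma sum_hbarInv_ip (hp : p ∈ Ω) (z : Vec) (c : Fin 4) :
    ∑ d, S.hbarInv p c d * ip S.g p z (basisVec d) = z c + ip S.g p z (S.B p) * S.B p c := by
  have h1 := clm_eq_sum (bilinCLM (ip S.g) p z) (S.B p)
  simp only [← h.metric.ipB.eq_bilinCLM hp] at h1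
  simp only [hbarInv, add_mul, Finset.sum_add_distrib, h.metric.sum_inv_mul hp, mul_assoc,
    ← Finset.mul_sum, h1, smul_eq_mul]
  ring

/-- Composition of endomorphisms with values tangent to the hyperboloids. -/
lemma comp_eq {F G : Tensor2} (hG : IsSmoothBilin G Ω) (hp : p ∈ Ω) {x z : Vec}
    (hF : ∀ y, F p x y = ip S.g p z y) (hz : ip S.g p z (S.B p) = 0) (y : Vec) :
    S.comp F G p x y = G p z y := by
  have h1 := clm_eq_sum ((bilinCLM G p).flip y) z
  simp only [ContinuousLinearMap.flip_apply, ← hG.eq_bilinCLM hp] at h1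
  rw [h1, comp, Finset.sum_comm]
  refine Finset.sum_congr rfl fun d _ => ?_
  have h2 := h.sum_hbarInv_ip hp z d
  rw [hz, zero_mul, add_zero] at h2
  simp only [hF, h.hbarInv_comm hp _ d]
  rw [← Finset.sum_mul, h2, smul_eq_mul]

/-- The norm of the symmetric tensor given by an endomorphism. -/
lemma normSq_eq {F : Tensor2} (hp : p ∈ Ω) (P : Vec →L[ℝ] Vec)
    (hF : ∀ x y, F p x y = ip S.g p (P x) y) (hs : ∀ x y, F p x y = F p y x)
    (hB : P (S.B p) = 0) : S.normSq F p = ∑ c, P (P (basisVec c)) c := by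
  -- Symmetry turns `P B = 0` into tangency of the image of `P`, so raising an index with `hbarInv`
  -- recovers a vector in that image with no correction along `B`.
  have hz (x : Vec) : ip S.g p (P x) (S.B p) = 0 := by
    rw [← hF, hs, hF, hB, h.metric.ipB.zero_left hp]
  have h1 (z : Vec) (hz : ip S.g p z (S.B p) = 0) (c : Fin 4) :
      ∑ d, S.hbarInv p c d * ip S.g p z (basisVec d) = z c := by
    rw [h.sum_hbarInv_ip hp, hz, zero_mul, add_zero]
  rw [normSq]
  refine Finset.sum_congr rfl fun c _ => ?_
  have h2 (d' c' : Fin 4) : ∑ d, S.hbarInv p c c' * S.hbarInv p d d' * F p (basisVec c) (basisVec d)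
      * F p (basisVec c') (basisVec d')
      = S.hbarInv p c c' * (P (basisVec c) d' * F p (basisVec c') (basisVec d')) := by
    rw [← h1 _ (hz (basisVec c)) d', Finset.sum_mul, Finset.mul_sum]
    refine Finset.sum_congr rfl fun d _ => ?_
    rw [h.hbarInv_comm hp d, hF (basisVec c)]
    ring
  have h3 (c' : Fin 4) : ∑ d', P (basisVec c) d' * F p (basisVec c') (basisVec d')
      = ip S.g p (P (P (basisVec c))) (basisVec c') := by
    have := clm_eq_sum (bilinCLM (ip S.g) p (P (basisVec c'))) (P (basisVec c))
    simp only [← h.metric.ipB.eq_bilinCLM hp, smul_eq_mul] at this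
    simp only [hF]
    rw [← this, ← hF, ← hF, hs]
  rw [Finset.sum_comm]
  have h4 (c' : Fin 4) : ∑ d, ∑ d', S.hbarInv p c c' * S.hbarInv p d d'
      * F p (basisVec c) (basisVec d) * F p (basisVec c') (basisVec d')
      = S.hbarInv p c c' * ip S.g p (P (P (basisVec c))) (basisVec c') := by
    rw [Finset.sum_comm, ← h3, Finset.mul_sum]
    exact Finset.sum_congr rfl fun d' _ => h2 d' c'
  simp only [h4]
  exact h1 _ (hz _) c

/-! ### The structure equations for the second fundamental form -/

lemma tr_k_eq (hp : p ∈ Ω) : S.tr S.k p = ∑ c, cov S.g S.B p (basisVec c) c := by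
  rw [tr]
  refine Finset.sum_congr rfl fun c _ => ?_
  simp only [h.k_eq hp, h.sum_hbarInv_ip hp, h.ip_cov_B_B hp, zero_mul, add_zero]

/-- The endomorphism associated with the traceless part of `k`. -/
lemma kHat_eq (hp : p ∈ Ω) (x y : Vec) : S.kHat p x y
    = ip S.g p (cov S.g S.B p x - (1 / 3 * S.tr S.k p) • S.proj p x) y := by
  rw [kHat, traceless, h.k_eq hp, h.metric.ipB.sub_left hp, h.metric.ipB.smul_left hp, proj,
    h.metric.ipB.add_left hp, h.metric.ipB.smul_left hp, hbar, h.metric.ip_comm hp y]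
  simp

lemma hbar_comm (hp : p ∈ Ω) (x y : Vec) : S.hbar p x y = S.hbar p y x := by
  rw [hbar, hbar, h.metric.ip_comm hp x]
  ring

lemma kHat_comm (hp : p ∈ Ω) (x y : Vec) : S.kHat p x y = S.kHat p y x := by
  rw [kHat, traceless, traceless, h.k_comm hp, h.hbar_comm hp]

lemma proj_B (hp : p ∈ Ω) : S.proj p (S.B p) = 0 := by
  rw [proj, h.ip_B_B p hp]
  simp

lemma isTangent_proj (hp : p ∈ Ω) (x : Vec) : S.IsTangent p (S.proj p x) := by
  rw [IsTangent, proj, h.metric.ipB.add_left hp, h.metric.ipB.smul_left hp, h.ip_B_B p hp]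
  simp

/-- The endomorphism of `k̂` is `A - (θ/3) π`, with `A = DB`, `θ = tr A` and `π` the projection. As
`Aπ = πA = A`, `π² = π` and `tr π = 3`, its square has trace `tr A² - 2θ²/3 + θ²/3`. -/
lemma normSq_kHat (hp : p ∈ Ω) : S.normSq S.kHat p
    = ∑ c, cov S.g S.B p (cov S.g S.B p (basisVec c)) c - 1 / 3 * S.tr S.k p ^ 2 := by
  set θ := S.tr S.k p with hθ
  let A := covCLM S.g S.B p
  let π : Vec →L[ℝ] Vec := ContinuousLinearMap.id ℝ Vec
    + ((bilinCLM (ip S.g) p).flip (S.B p)).smulRight (S.B p)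
  have hπ (x : Vec) : π x = S.proj p x := by
    simp [π, proj, h.metric.ipB.eq_bilinCLM hp]
  have hA (x : Vec) : cov S.g S.B p x = A x := h.metric.cov_eq hp _ _
  rw [h.normSq_eq hp (A - (1 / 3 * θ) • π)]
  · have hAB : A (S.B p) = 0 := by rw [← hA, h.cov_B_B hp]
    have h1 (x : Vec) : A (π x) = A x := by
      rw [hπ, proj, map_add, map_smul, hAB, smul_zero, add_zero]
    have h2 (x : Vec) : π (A x) = A x := by
      rw [hπ, proj, ← hA, h.ip_cov_B_B hp, zero_smul, add_zero]
    have h3 (x : Vec) : π (π x) = π x := by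
      rw [hπ, hπ, proj_of_isTangent (h.isTangent_proj hp x)]
    have h4 : ∑ c, A (basisVec c) c = θ := by rw [hθ, h.tr_k_eq hp]; simp only [hA]
    -- The trace is `4 + ⟨B, B⟩`.
    have h5 : ∑ c, π (basisVec c) c = 3 := by
      have := clm_eq_sum ((bilinCLM (ip S.g) p).flip (S.B p)) (S.B p)
      simp only [ContinuousLinearMap.flip_apply, ← h.metric.ipB.eq_bilinCLM hp, h.ip_B_B p hp,
        smul_eq_mul] at this
      simp only [hπ, proj, Pi.add_apply, Pi.smul_apply, smul_eq_mul, Finset.sum_add_distrib,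
        mul_comm (ip _ _ _ _), ← this]
      simp [basisVec]
      norm_num
    have h6 (c : Fin 4) : (A - (1 / 3 * θ) • π) ((A - (1 / 3 * θ) • π) (basisVec c)) c
        = A (A (basisVec c)) c - 2 * (1 / 3 * θ) * A (basisVec c) c
          + (1 / 3 * θ) ^ 2 * π (basisVec c) c := by
      simp only [sub_apply, smul_apply, map_sub, map_smul, h1, h2, h3, Pi.sub_apply,
        Pi.smul_apply, smul_eq_mul]
      ring
    simp only [h6, Finset.sum_add_distrib, Finset.sum_sub_distrib, ← Finset.mul_sum, h4, h5, hA]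
    ring
  · intro x y
    rw [h.kHat_eq hp, hA, ← hπ]
    simp [hθ]
  · exact h.kHat_comm hp
  · rw [sub_apply, smul_apply, hπ, h.proj_B hp, ← hA, h.cov_B_B hp]
    simp

lemma eventually_cov_B_B (hp : p ∈ Ω) : ∀ᶠ q in 𝓝 p, cov S.g S.B q (S.B q) = 0 := by
  filter_upwards [h.mem_nhds hp] with q hq using h.cov_B_B hq

/-- The Raychaudhuri equation. -/
lemma derivB_tr_k (hp : p ∈ Ω) : S.derivB (S.tr S.k) p
    = -S.ricciBB p - ∑ c, cov S.g S.B p (cov S.g S.B p (basisVec c)) c := by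
  have e : S.tr S.k =ᶠ[𝓝 p] fun q => ∑ c, cov S.g S.B q (basisVec c) c := by
    filter_upwards [h.mem_nhds hp] with q hq using h.tr_k_eq hq
  have hd (x : Vec) : DifferentiableAt ℝ (fun q => cov S.g S.B q x) p :=
    (h.metric.contDiffAt_cov hp (h.B_smooth hp) contDiffAt_const).differentiableAt (by simp)
  have hdc (x : Vec) (c : Fin 4) : DifferentiableAt ℝ (fun q => cov S.g S.B q x c) p :=
    differentiableAt_pi.1 (hd x) c
  have hc (x : Vec) (c : Fin 4) : fderiv ℝ (fun q => cov S.g S.B q x c) p (S.B p)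
      = fderiv ℝ (fun q => cov S.g S.B q x) p (S.B p) c := by
    rw [fderiv_pi (differentiableAt_pi.1 (hd x))]
    rfl
  rw [derivB, e.fderiv_eq, fderiv_fun_sum fun c _ => hdc _ c]
  simp only [sum_apply, hc, h.metric.fderiv_cov_geodesic hp (h.B_smooth hp)
    (h.eventually_cov_B_B hp), Pi.sub_apply, Pi.add_apply, Finset.sum_sub_distrib,
    Finset.sum_add_distrib]
  -- The commutator of `DB` with `Γ(B, ·)` has no trace. The Ricci tensor traces over the first slot
  -- of the curvature operator, hence the swap and the sign that follow.
  have hcomm := sum_clm_comm (covCLM S.g S.B p) (bilinCLM (christoffel S.g) p (S.B p))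
  simp only [← h.metric.cov_eq hp, ← h.metric.christoffelB.eq_bilinCLM hp] at hcomm
  rw [hcomm, ricciBB, ricci]
  simp only [curvature_swap S.g p (S.B p), Pi.neg_apply, Finset.sum_neg_distrib]
  ring

lemma tr_k_equation (hp : p ∈ Ω) : S.derivB (S.tr S.k) p + 1 / 3 * S.tr S.k p ^ 2
    = -S.ricciBB p - S.normSq S.kHat p := by
  rw [h.derivB_tr_k hp, h.normSq_kHat hp]
  ring

lemma hasFDerivAt_three_div_rho (hp : p ∈ Ω) :
    HasFDerivAt (fun q => 3 / S.rho q) ((3 : ℝ) • (-(S.rho p ^ 2)⁻¹ • fderiv ℝ S.rho p)) p := by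
  have hr := ((h.rho_smooth p hp).differentiableAt (by simp)).hasFDerivAt
  have h1 := ((hasDerivAt_inv (h.rho_pos p hp).ne').comp_hasFDerivAt p hr).const_mul 3
  simp only [div_eq_mul_inv]
  exact h1

lemma differentiableAt_trkDev (hp : p ∈ Ω) : DifferentiableAt ℝ S.trkDev p :=
  (h.differentiableAt_tr h.isSmoothBilin_k hp).sub (h.hasFDerivAt_three_div_rho hp).differentiableAt

lemma fderiv_trkDev (hp : p ∈ Ω) (v : Vec) : fderiv ℝ S.trkDev p v
    = fderiv ℝ (S.tr S.k) p v - 3 / S.rho p ^ 2 * ip S.g p (S.B p) v := by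
  have h1 : fderiv ℝ S.trkDev p = _ := ((h.differentiableAt_tr h.isSmoothBilin_k hp).hasFDerivAt.sub
    (h.hasFDerivAt_three_div_rho hp)).fderiv
  rw [h1, h.ip_B hp]
  simp only [sub_apply, smul_apply, smul_eq_mul]
  ring

/-- Since `Bρ = 1`, `B(3/ρ) = -3/ρ²`. This cancels the constant term in the expansion of `(tr k)²/3`
about `3/ρ`, whose linear term has coefficient `2/ρ`. -/
lemma trkDev_equation (hp : p ∈ Ω) : S.derivB S.trkDev p + 2 / S.rho p * S.trkDev p
    = -(1 / 3 * S.trkDev p ^ 2) - S.ricciBB p - S.normSq S.kHat p := by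
  have h1 := h.tr_k_equation hp
  have hr := (h.rho_pos p hp).ne'
  rw [derivB] at h1
  rw [derivB, h.fderiv_trkDev hp, h.ip_B_B p hp, trkDev]
  have : fderiv ℝ (S.tr S.k) p (S.B p) =
    -S.ricciBB p - S.normSq S.kHat p - 1 / 3 * S.tr S.k p ^ 2 := by linarith
  rw [this]
  field_simp
  ring

/-- The Riccati equation with an index lowered. Skewness of the curvature operator turns `⟨x,
R(B,y)B⟩` into `-⟨B, R(B,y)x⟩`. -/
lemma covTensor_k (hp : p ∈ Ω) (x y : Vec) : covTensor S.g S.k p (S.B p) x y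
    = -riemann S.g p (S.B p) x (S.B p) y
      - ip S.g p (cov S.g S.B p x) (cov S.g S.B p y) := by
  have e : (fun q => S.k q x y) =ᶠ[𝓝 p] fun q => ip S.g q (cov S.g S.B q y) x := by
    filter_upwards [h.mem_nhds hp] with q hq using by rw [h.k_comm hq, h.k_eq hq]
  have hd : DifferentiableAt ℝ (fun q => cov S.g S.B q y) p :=
    (h.metric.contDiffAt_cov hp (h.B_smooth hp) contDiffAt_const).differentiableAt (by simp)
  have h1 := h.metric.fderiv_ip hp hd (differentiableAt_const x) (S.B p)
  have h2 : cov S.g (fun _ => x) p (S.B p) = christoffel S.g p (S.B p) x := by simp [cov]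
  rw [covTensor, e.fderiv_eq, h1, h2, cov, h.metric.fderiv_cov_geodesic hp (h.B_smooth hp)
    (h.eventually_cov_B_B hp), h.k_comm hp _ y, h.k_comm hp x, h.k_eq hp, h.k_eq hp, riemann,
    h.metric.ip_curvature_antisymm hp, h.metric.ip_comm hp x]
  simp only [h.metric.ipB.add_left hp, h.metric.ipB.sub_left hp]
  have h3 : ip S.g p (cov S.g S.B p (cov S.g S.B p y)) x
      = ip S.g p (cov S.g S.B p x) (cov S.g S.B p y) := h.ip_cov_B_comm hp _ _
  rw [h3]
  ring

/-- The derivative of the induced metric vanishes in tangential directions. -/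
lemma covTensor_hbar (hp : p ∈ Ω) {x y : Vec} (hx : S.IsTangent p x) (hy : S.IsTangent p y) (v : Vec) :
    covTensor S.g S.hbar p v x y = 0 := by
  have hd (x : Vec) : DifferentiableAt ℝ (fun q => ip S.g q x (S.B q)) p :=
    (h.metric.ipB.contDiffAt_apply hp contDiffAt_const (h.B_smooth hp)).differentiableAt (by simp)
  have hi : DifferentiableAt ℝ (fun q => ip S.g q x y) p :=
    (h.metric.ipB.smooth p hp x y).differentiableAt (by simp)
  rw [IsTangent] at hx hy
  -- Both factors of `⟨x, B⟩⟨y, B⟩` vanish at `p`, so the product has zero derivative there although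
  -- the constant extensions of `x, y` are not tangent nearby.
  have e : fderiv ℝ (fun q => S.hbar q x y) p v = fderiv ℝ (fun q => ip S.g q x y) p v := by
    simp only [hbar]
    rw [fderiv_fun_add hi ((hd x).fun_mul (hd y)), fderiv_fun_mul (hd x) (hd y), hx, hy]
    simp
  rw [covTensor, e, h.metric.fderiv_ip_const hp, hbar, hbar, hx, hy]
  ring

lemma kHat_endo_tangent (hp : p ∈ Ω) (x : Vec) : ip S.g p
    (cov S.g S.B p x - (1 / 3 * S.tr S.k p) • S.proj p x) (S.B p) = 0 := by
  have := h.isTangent_proj hp x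
  rw [IsTangent] at this
  rw [h.metric.ipB.sub_left hp, h.metric.ipB.smul_left hp, h.ip_cov_B_B hp, this]
  simp

/-- On tangent vectors, contraction with `k̂` is the action of `DB - (tr k/3) id`. -/
lemma star_kHat_eq {F : Tensor2} (hF : IsSmoothBilin F Ω) (hp : p ∈ Ω) {x y : Vec}
    (hx : S.IsTangent p x) (hy : S.IsTangent p y) : S.star S.kHat F p x y
    = F p (cov S.g S.B p x) y + F p (cov S.g S.B p y) x
      - 1 / 3 * S.tr S.k p * (F p x y + F p y x) := by
  rw [star, h.comp_eq hF hp (h.kHat_eq hp x) (h.kHat_endo_tangent hp x),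
    h.comp_eq hF hp (h.kHat_eq hp y) (h.kHat_endo_tangent hp y), proj_of_isTangent hx,
    proj_of_isTangent hy]
  simp only [hF.sub_left hp, hF.smul_left hp, smul_eq_mul]
  ring

/-- Subtract a third of the trace equation times the induced metric from `covTensor_k`. In the
square of `k = k̂ + (tr k/3) hbar` the cross term is `(2/3) tr k k̂`, and the `(tr k)²` terms
cancel. -/
lemma kHat_equation (hp : p ∈ Ω) {x y : Vec} (hx : S.IsTangent p x) (hy : S.IsTangent p y) :
    covTensor S.g S.kHat p (S.B p) x y + 2 / 3 * S.tr S.k p * S.kHat p x y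
      = -S.curvHat p x y - S.hatProd S.kHat p x y := by
  have e : covTensor S.g S.kHat p (S.B p) x y = _ := covTensor_sub_mul (v := S.B p) (g := S.g)
    ((h.isSmoothBilin_k.smooth p hp x y).differentiableAt (by simp))
    ((h.isSmoothBilin_hbar.smooth p hp x y).differentiableAt (by simp))
    (h.differentiableAt_tr h.isSmoothBilin_k hp)
  have h1 := h.tr_k_equation hp
  rw [derivB] at h1
  have h2 : fderiv ℝ (S.tr S.k) p (S.B p) =
    -S.ricciBB p - S.normSq S.kHat p - 1 / 3 * S.tr S.k p ^ 2 := by linarith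
  rw [e, h.covTensor_hbar hp hx hy, h2, h.covTensor_k hp, curvHat, hatProd,
    h.star_kHat_eq (F := S.kHat) (h.isSmoothBilin_traceless h.isSmoothBilin_k) hp hx hy]
  simp only [h.kHat_eq hp, proj_of_isTangent hx, proj_of_isTangent hy,
    h.metric.ipB.sub_left hp, h.metric.ipB.smul_left hp, hbar_of_isTangent hx, smul_eq_mul,
    proj_of_isTangent (h.ip_cov_B_B hp x), proj_of_isTangent (h.ip_cov_B_B hp y)]
  rw [h.ip_cov_B_comm hp (cov S.g S.B p x) y, h.ip_cov_B_comm hp (cov S.g S.B p y) x,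
    h.metric.ip_comm hp (cov S.g S.B p y) (cov S.g S.B p x), h.ip_cov_B_comm hp y x,
    h.metric.ip_comm hp y x]
  ring

end IsHyperboloidal

end Spacetime

end Hyperboloid

/-! ### Deformation tensors of fields commuting with `B`. -/

namespace Hyperboloid

lemma IsMetric.deformation_eq {g : MetricField} {Ω : Set Vec} {p : Vec} (hg : IsMetric g Ω)
    (hp : p ∈ Ω) (X : Vec → Vec) (x y : Vec) :
    deformation g X p x y = lieTensor X (ip g) p x y := by
  rw [deformation, lieTensor, hg.fderiv_ip_const hp, cov, cov, hg.ipB.add_left hp,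
    hg.ipB.add_left hp, hg.christoffel_comm hp x, hg.christoffel_comm hp y,
    hg.ip_comm hp (fderiv ℝ X p y), hg.ip_comm hp _ x]
  ring

namespace Spacetime

/-- `R` is a smooth field tangent to the hyperboloids which commutes with `B`. -/
structure IsHyperboloidalSymmetry (S : Spacetime) (Ω : Set Vec) (R : Vec → Vec) : Prop where
  smooth : ∀ q ∈ Ω, ContDiffAt ℝ ∞ R q
  ip_B : ∀ q ∈ Ω, ip S.g q (R q) (S.B q) = 0
  comm : ∀ q ∈ Ω, fderiv ℝ R q (S.B q) = fderiv ℝ S.B q (R q)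

namespace IsHyperboloidal

variable {S : Spacetime} {Ω : Set Vec} {p : Vec} {R : Vec → Vec} (h : S.IsHyperboloidal Ω)
include h

lemma lie_B_ip (hp : p ∈ Ω) (x y : Vec) : lieTensor S.B (ip S.g) p x y = 2 * S.k p x y := by
  rw [← h.metric.deformation_eq hp, deformation, ← h.k_eq hp, ← h.k_eq hp, h.k_comm hp y]
  ring

/-- The connection is torsion-free, so the two derivatives along `B` differ only by the algebraic
action of `DB`. -/
lemma covTensor_eq_lie {F : Tensor2} (hF : IsSmoothBilin F Ω) (hp : p ∈ Ω) (x y : Vec) :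
    covTensor S.g F p (S.B p) x y = lieTensor S.B F p x y
      - F p (cov S.g S.B p x) y - F p x (cov S.g S.B p y) := by
  rw [covTensor, lieTensor, cov, cov, hF.add_left hp, hF.add_right hp,
    h.metric.christoffel_comm hp x, h.metric.christoffel_comm hp y]
  ring

lemma lie_smooth (hR : S.IsHyperboloidalSymmetry Ω R) :
    IsSmoothBilin (lieTensor R (ip S.g)) Ω := h.metric.ipB.lie hR.smooth

lemma isSmoothBilin_deformation (hR : S.IsHyperboloidalSymmetry Ω R) :
    IsSmoothBilin (deformation S.g R) Ω := by
  have hl := h.lie_smooth hR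
  refine isSmoothBilin_of_pointwise h.metric.isOpen (fun q hq => ?_) fun q hq x y => ?_
  · exact ⟨bilinCLM (lieTensor R (ip S.g)) q, fun x y => by
      rw [h.metric.deformation_eq hq, hl.eq_bilinCLM hq]⟩
  · have e : (fun q => deformation S.g R q x y) =ᶠ[𝓝 q] fun q => lieTensor R (ip S.g) q x y := by
      filter_upwards [h.mem_nhds hq] with r hr using h.metric.deformation_eq hr R x y
    exact (hl.smooth q hq x y).congr_of_eventuallyEq e

/-- Exchange the two Lie derivatives of `g`, then use `L_B g = 2k`. -/
lemma lie_B_deformation (hR : S.IsHyperboloidalSymmetry Ω R) (hp : p ∈ Ω) (x y : Vec) :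
    lieTensor S.B (deformation S.g R) p x y = 2 * lieTensor R S.k p x y := by
  rw [lieTensor_congr h.metric.isOpen hp (fun q hq => h.metric.deformation_eq hq R),
    h.metric.ipB.lie_comm (fun q hq => h.B_smooth hq) hR.smooth hR.comm hp,
    lieTensor_congr h.metric.isOpen hp (fun q hq => h.lie_B_ip hq),
    lieTensor_const_mul _ ((h.isSmoothBilin_k.smooth p hp x y).differentiableAt (by simp))]

/-- Commutation gives `D_B R = D_R B`, which is orthogonal to `B`. -/
lemma deformation_B_B (hR : S.IsHyperboloidalSymmetry Ω R) (hp : p ∈ Ω) :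
    deformation S.g R p (S.B p) (S.B p) = 0 := by
  have e : cov S.g R p (S.B p) = cov S.g S.B p (R p) := by
    rw [cov, cov, hR.comm p hp, h.metric.christoffel_comm hp]
  rw [deformation, e, h.ip_cov_B_B hp, add_zero]

lemma tr_deformation (hR : S.IsHyperboloidalSymmetry Ω R) (hp : p ∈ Ω) :
    S.tr (deformation S.g R) p = gtr S.g (deformation S.g R) p := by
  rw [tr_eq (h.isSmoothBilin_deformation hR) hp, h.deformation_B_B hR hp, add_zero]

lemma tr_k_eq_gtr (hp : p ∈ Ω) : S.tr S.k p = gtr S.g S.k p := by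
  rw [tr_eq h.isSmoothBilin_k hp, h.k_eq hp, h.ip_cov_B_B hp, add_zero]

/-- Differentiating either trace produces, besides the Lie derivative, the contraction of `k` with
the deformation tensor. It occurs with the same coefficient on both sides and cancels. -/
lemma derivB_tr_deformation_eq (hR : S.IsHyperboloidalSymmetry Ω R) (hp : p ∈ Ω) :
    S.derivB (S.tr (deformation S.g R)) p = 2 * fderiv ℝ (S.tr S.k) p (R p) := by
  have e1 : S.tr (deformation S.g R) =ᶠ[𝓝 p] gtr S.g (deformation S.g R) := by
    filter_upwards [h.mem_nhds hp] with q hq using h.tr_deformation hR hq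
  have e2 : S.tr S.k =ᶠ[𝓝 p] gtr S.g S.k := by
    filter_upwards [h.mem_nhds hp] with q hq using h.tr_k_eq_gtr hq
  have c1 : contr S.g (lieTensor S.B (ip S.g)) (deformation S.g R) p
      = 2 * contr S.g S.k (deformation S.g R) p := by
    simp only [contr, h.lie_B_ip hp, Finset.mul_sum]
    refine Finset.sum_congr rfl fun _ _ => Finset.sum_congr rfl fun _ _ =>
      Finset.sum_congr rfl fun _ _ => Finset.sum_congr rfl fun _ _ => by ring
  have c2 : contr S.g (lieTensor R (ip S.g)) S.k p = contr S.g (deformation S.g R) S.k p := by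
    simp only [contr, h.metric.deformation_eq hp]
  have c3 : gtr S.g (lieTensor S.B (deformation S.g R)) p = 2 * gtr S.g (lieTensor R S.k) p := by
    simp only [gtr, h.lie_B_deformation hR hp, Finset.mul_sum]
    exact Finset.sum_congr rfl fun _ _ => Finset.sum_congr rfl fun _ _ => by ring
  rw [derivB, e1.fderiv_eq, e2.fderiv_eq, h.metric.fderiv_gtr (h.isSmoothBilin_deformation hR) hp,
    h.metric.fderiv_gtr h.isSmoothBilin_k hp, c1, c2, c3, h.metric.contr_comm hp]
  ring

/-- Subtracting `3/ρ` costs nothing because `R` is tangent to the level sets of `ρ`. -/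
lemma tr_deformation_equation (hR : S.IsHyperboloidalSymmetry Ω R) (hp : p ∈ Ω) :
    S.derivB (S.tr (deformation S.g R)) p = 2 * fderiv ℝ S.trkDev p (R p) := by
  rw [h.derivB_tr_deformation_eq hR hp, h.fderiv_trkDev hp, h.metric.ip_comm hp, hR.ip_B p hp]
  ring

lemma lie_hbar (hp : p ∈ Ω) {x y : Vec} (hx : S.IsTangent p x) (hy : S.IsTangent p y)
    (X : Vec → Vec) : lieTensor X S.hbar p x y = lieTensor X (ip S.g) p x y := by
  have hd (x : Vec) : DifferentiableAt ℝ (fun q => ip S.g q x (S.B q)) p :=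
    (h.metric.ipB.contDiffAt_apply hp contDiffAt_const (h.B_smooth hp)).differentiableAt (by simp)
  have hi : DifferentiableAt ℝ (fun q => ip S.g q x y) p :=
    (h.metric.ipB.smooth p hp x y).differentiableAt (by simp)
  rw [IsTangent] at hx hy
  have e : fderiv ℝ (fun q => S.hbar q x y) p (X p)
      = fderiv ℝ (fun q => ip S.g q x y) p (X p) := by
    simp only [hbar]
    rw [fderiv_fun_add hi ((hd x).fun_mul (hd y)), fderiv_fun_mul (hd x) (hd y), hx, hy]
    simp
  rw [lieTensor, lieTensor, e, hbar, hbar, hx, hy]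
  ring

/-- Passing from `D_B` to `L_B` creates two `DB` terms that `k̂ * π̂` absorbs up to traces. The
derivatives of the traces agree by `derivB_tr_deformation_eq`, and `L_R hbar`, equal to the
deformation tensor on tangent vectors, accounts for the remaining `tr k` term. -/
lemma traceless_deformation_equation (hR : S.IsHyperboloidalSymmetry Ω R) (hp : p ∈ Ω) {x y : Vec}
    (hx : S.IsTangent p x) (hy : S.IsTangent p y) :
    covTensor S.g (S.traceless (deformation S.g R)) p (S.B p) x y
        + S.star S.kHat (S.traceless (deformation S.g R)) p x y
      = 2 * lieTensor R S.kHat p x y - 2 / 3 * S.tr (deformation S.g R) p * S.kHat p x y := by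
  have hπ := h.isSmoothBilin_deformation hR
  have hd {F : Tensor2} (hF : IsSmoothBilin F Ω) : DifferentiableAt ℝ (fun q => F q x y) p :=
    (hF.smooth p hp x y).differentiableAt (by simp)
  have e1 : covTensor S.g (S.traceless (deformation S.g R)) p (S.B p) x y = _ :=
    covTensor_sub_mul (v := S.B p) (g := S.g) (hd hπ) (hd h.isSmoothBilin_hbar)
    (h.differentiableAt_tr hπ hp)
  have e2 : lieTensor R S.kHat p x y = _ := lieTensor_sub_mul (X := R) (hd h.isSmoothBilin_k)
    (hd h.isSmoothBilin_hbar) (h.differentiableAt_tr h.isSmoothBilin_k hp)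
  have e3 := h.derivB_tr_deformation_eq hR hp
  rw [derivB] at e3
  have hsymm (x y : Vec) : deformation S.g R p x y = deformation S.g R p y x := add_comm _ _
  rw [e1, e2, e3, h.covTensor_hbar hp hx hy, h.covTensor_eq_lie hπ hp, h.lie_B_deformation hR hp,
    h.lie_hbar hp hx hy, ← h.metric.deformation_eq hp,
    h.star_kHat_eq (h.isSmoothBilin_traceless hπ) hp hx hy, kHat]
  simp only [traceless]
  rw [hsymm y x, hsymm (cov S.g S.B p y) x, h.hbar_comm hp y x,
    hbar_of_isTangent (h.ip_cov_B_B hp x), hbar_of_isTangent (h.ip_cov_B_B hp y),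
    h.ip_cov_B_comm hp y x, h.k_eq hp]
  ring

end IsHyperboloidal

end Spacetime

end Hyperboloid

namespace Hyperboloid

/-! ### Lorentzian signature -/

lemma eta_apply (a b : Fin 4) : eta a b = if a = b then (if a = 0 then -1 else 1) else 0 := by
  fin_cases a <;> fin_cases b <;> simp [eta, Matrix.diagonal]

section frame

variable {g : MetricField} {p : Vec} {f : Fin 4 → Vec}

lemma frame_transpose_mul (hf : ∀ a b, ip g p (f a) (f b) = eta a b) :
    Matrix.of f * (g p * (Matrix.of f)ᵀ) = eta := by
  ext a b
  rw [← hf a b]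
  simp [ip, Matrix.mul_apply, Matrix.mulVec, dotProduct]

/-- As the product is nonzero, both the frame and the metric are nondegenerate. -/
lemma det_frame_mul (hf : ∀ a b, ip g p (f a) (f b) = eta a b) :
    (Matrix.of f).det * ((g p).det * (Matrix.of f).det) = -1 := by
  have := congrArg Matrix.det (frame_transpose_mul hf)
  rw [Matrix.det_mul, Matrix.det_mul, Matrix.det_transpose] at this
  rw [this]
  simp [eta, Fin.prod_univ_four]

lemma exists_frame_coord (hf : ∀ a b, ip g p (f a) (f b) = eta a b) (x : Vec) :
    ∃ c : Fin 4 → ℝ, x = ∑ a, c a • f a := by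
  have hu : IsUnit (Matrix.of f).det := isUnit_iff_ne_zero.2 fun h0 => by
    have := det_frame_mul hf
    simp [h0] at this
  refine ⟨x ᵥ* (Matrix.of f)⁻¹, ?_⟩
  have h1 : (x ᵥ* (Matrix.of f)⁻¹) ᵥ* Matrix.of f = x := by
    rw [Matrix.vecMul_vecMul, Matrix.nonsing_inv_mul _ hu, Matrix.vecMul_one]
  exact h1.symm.trans (Matrix.vecMul_eq_sum _ _)

lemma ip_sum_frame (hf : ∀ a b, ip g p (f a) (f b) = eta a b) (c d : Fin 4 → ℝ) :
    ip g p (∑ a, c a • f a) (∑ a, d a • f a) = -(c 0 * d 0) + ∑ i : Fin 3, c i.succ * d i.succ := by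
  have h1 : ip g p (∑ a, c a • f a) (∑ a, d a • f a) = ∑ a, ∑ b, c a * d b * ip g p (f a) (f b) := by
    simp only [ip, Matrix.mulVec_sum, Matrix.mulVec_smul, dotProduct_sum, sum_dotProduct,
      smul_dotProduct, dotProduct_smul, smul_eq_mul]
    rw [Finset.sum_comm]
    refine Finset.sum_congr rfl fun _ _ => ?_
    rw [Finset.mul_sum]
    exact Finset.sum_congr rfl fun _ _ => by ring
  rw [h1]
  simp [hf, eta_apply, Fin.sum_univ_succ]

/-- With `C`, `D` the squared spatial lengths, Cauchy–Schwarz gives `(c⁰d⁰)² ≤ C D ≤ C (d⁰)²`. Since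
`C < (c⁰)²`, this forces `d⁰ = 0`, and then `D = 0`. -/
lemma minkowski_orthogonal {c d : Fin 4 → ℝ}
    (hc : -(c 0 * c 0) + ∑ i : Fin 3, c i.succ * c i.succ < 0)
    (hd : -(d 0 * d 0) + ∑ i : Fin 3, d i.succ * d i.succ ≤ 0)
    (hcd : -(c 0 * d 0) + ∑ i : Fin 3, c i.succ * d i.succ = 0) : d = 0 := by
  have hcs := Finset.sum_mul_sq_le_sq_mul_sq Finset.univ (fun i : Fin 3 => c i.succ)
    (fun i : Fin 3 => d i.succ)
  simp only [pow_two] at hcs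
  set C := ∑ i : Fin 3, c i.succ * c i.succ
  set D := ∑ i : Fin 3, d i.succ * d i.succ
  have hC : 0 ≤ C := Finset.sum_nonneg fun i _ => mul_self_nonneg _
  have hD : 0 ≤ D := Finset.sum_nonneg fun i _ => mul_self_nonneg _
  have e : ∑ i : Fin 3, c i.succ * d i.succ = c 0 * d 0 := by linarith
  rw [e] at hcs
  have h0 : d 0 = 0 := by
    by_contra h
    have : 0 < d 0 * d 0 := mul_self_pos.2 h
    nlinarith [mul_le_mul_of_nonneg_left (show D ≤ d 0 * d 0 by linarith) hC]
  have hD0 : D = 0 := by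
    rw [h0] at hd
    linarith
  have hi := (Finset.sum_eq_zero_iff_of_nonneg fun i _ => mul_self_nonneg (d (Fin.succ i))).1 hD0
  ext a
  refine Fin.cases h0 (fun i => ?_) a
  simpa using hi i (Finset.mem_univ i)

/-- A nonzero vector orthogonal to a timelike vector is spacelike. -/
lemma eq_zero_of_orthogonal_timelike (hf : ∀ a b, ip g p (f a) (f b) = eta a b) {u x : Vec}
    (hu : ip g p u u < 0) (hx : ip g p x x ≤ 0) (hux : ip g p u x = 0) : x = 0 := by
  obtain ⟨c, rfl⟩ := exists_frame_coord hf u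
  obtain ⟨d, rfl⟩ := exists_frame_coord hf x
  rw [ip_sum_frame hf] at hu hx hux
  simp [minkowski_orthogonal hu hx hux]

end frame

namespace Spacetime

/-! ### The lapse and the unit normal of the time foliation. -/

section

variable (S : Spacetime) {p : Vec}

lemma isMetric : IsMetric S.g S.U where
  isOpen := S.isOpen_U
  smooth q hq a b := (S.g_smooth a b).contDiffAt (S.isOpen_U.mem_nhds hq)
  symm := S.g_symm
  det_ne q hq h0 := by
    obtain ⟨f, hf⟩ := S.g_lorentz q hq
    have := det_frame_mul hf
    simp [h0] at this

variable {S}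

lemma t_contDiffAt (hp : p ∈ S.U) : ContDiffAt ℝ ∞ S.t p :=
  S.t_smooth.contDiffAt (S.isOpen_U.mem_nhds hp)

lemma gradT_contDiffAt (hp : p ∈ S.U) : ContDiffAt ℝ ∞ (grad S.g S.t) p :=
  S.isMetric.contDiffAt_grad hp (t_contDiffAt hp)

lemma n_pos (hp : p ∈ S.U) : 0 < S.n p :=
  inv_pos.2 (Real.sqrt_pos.2 (neg_pos.2 (S.t_timelike p hp)))

lemma n_contDiffAt (hp : p ∈ S.U) : ContDiffAt ℝ ∞ S.n p := by
  have h := neg_pos.2 (S.t_timelike p hp)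
  exact (((S.isMetric.ipB.contDiffAt_apply hp (gradT_contDiffAt hp)
    (gradT_contDiffAt hp)).neg).sqrt h.ne').inv (Real.sqrt_pos.2 h).ne'

lemma T_contDiffAt (hp : p ∈ S.U) : ContDiffAt ℝ ∞ S.T p :=
  (n_contDiffAt hp).neg.smul (gradT_contDiffAt hp)

lemma ip_T (hp : p ∈ S.U) (x : Vec) : ip S.g p x (S.T p) = -S.n p * fderiv ℝ S.t p x := by
  rw [T, S.isMetric.ipB.smul_right hp, S.isMetric.ip_comm hp, S.isMetric.ip_grad hp, smul_eq_mul]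

lemma ip_T_T (hp : p ∈ S.U) : ip S.g p (S.T p) (S.T p) = -1 := by
  have h := neg_pos.2 (S.t_timelike p hp)
  rw [T, S.isMetric.ipB.smul_right hp, S.isMetric.ipB.smul_left hp, n]
  have h2 := Real.sq_sqrt h.le
  have h3 := (Real.sqrt_pos.2 h).ne'
  set s := √(-ip S.g p (grad S.g S.t p) (grad S.g S.t p))
  have h4 : ip S.g p (grad S.g S.t p) (grad S.g S.t p) = -s ^ 2 := by linarith
  rw [h4]
  simp only [smul_eq_mul]
  field_simp

lemma ip_cov_T_T (hp : p ∈ S.U) (x : Vec) : ip S.g p (cov S.g S.T p x) (S.T p) = 0 := by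
  have hd := (T_contDiffAt hp).differentiableAt (by simp)
  have h1 := S.isMetric.fderiv_ip hp hd hd x
  have e : (fun q => ip S.g q (S.T q) (S.T q)) =ᶠ[𝓝 p] fun _ => -1 := by
    filter_upwards [S.isMetric.mem_nhds hp] with q hq using ip_T_T hq
  rw [e.fderiv_eq, S.isMetric.ip_comm hp (S.T p)] at h1
  simp only [fderiv_fun_const, Pi.zero_apply, zero_apply] at h1
  linarith

lemma inv_b (p : Vec) : (S.b p)⁻¹ = -(S.rho p * ip S.g p (S.B p) (S.T p) / S.t p) := by
  rw [b, inv_neg, inv_div]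

end

/-! ### The equations for `n - b⁻¹` and `log (t / τ)`. -/

namespace IsHyperboloidal

variable {S : Spacetime} {Ω : Set Vec} {p : Vec} (h : S.IsHyperboloidal Ω) (hU : Ω ⊆ S.U)
include h

lemma fderiv_rho_B (hp : p ∈ Ω) : fderiv ℝ S.rho p (S.B p) = 1 := by
  have := h.ip_B hp (S.B p)
  rw [h.ip_B_B p hp] at this
  linarith

include hU

lemma differentiableAt_ip_B_T (hp : p ∈ Ω) :
    DifferentiableAt ℝ (fun q => ip S.g q (S.B q) (S.T q)) p :=
  (h.metric.ipB.contDiffAt_apply hp (h.B_smooth hp) (T_contDiffAt (hU hp))).differentiableAt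
    (by simp)

/-- The ingredients are `Bρ = 1`, `B⟨B,T⟩ = ⟨B, D_B T⟩` because `B` is geodesic, and `Bt = -⟨B,T⟩/n`
because `T = -n Dt`. -/
lemma hasFDerivAt_inv_b (hp : p ∈ Ω) (ht : 0 < S.t p) :
    DifferentiableAt ℝ (fun q => (S.b q)⁻¹) p ∧ fderiv ℝ (fun q => (S.b q)⁻¹) p (S.B p) =
      -((ip S.g p (S.B p) (S.T p) + S.rho p * ip S.g p (S.B p) (cov S.g S.T p (S.B p))) / S.t p
        + S.rho p * ip S.g p (S.B p) (S.T p) ^ 2 / (S.n p * S.t p ^ 2)) := by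
  have hβ := h.differentiableAt_ip_B_T hU hp
  have hρ := (h.rho_smooth p hp).differentiableAt (by simp)
  have htd := (t_contDiffAt (hU hp)).differentiableAt (by simp)
  have hT := (T_contDiffAt (hU hp)).differentiableAt (by simp)
  have e1 := h.metric.fderiv_ip hp (h.B_diff hp) hT (S.B p)
  rw [h.cov_B_B hp, h.metric.ipB.zero_left hp, zero_add] at e1
  have e2 := ip_T (hU hp) (S.B p)
  have hn := (n_pos (hU hp)).ne'
  have e3 : fderiv ℝ S.t p (S.B p) = -(ip S.g p (S.B p) (S.T p) / S.n p) := by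
    rw [e2]
    field_simp
  have hinv := (hasDerivAt_inv ht.ne').comp_hasFDerivAt p htd.hasFDerivAt
  have hb := ((hρ.hasFDerivAt.fun_mul hβ.hasFDerivAt).fun_mul hinv).neg
  have e : (fun q => (S.b q)⁻¹) = fun q => -(S.rho q * ip S.g q (S.B q) (S.T q) *
      ((fun y => y⁻¹) ∘ S.t) q) := by
    ext q
    rw [inv_b, div_eq_mul_inv]
    rfl
  rw [e]
  refine ⟨hb.differentiableAt, ?_⟩
  have hb' : fderiv ℝ (fun q => -(S.rho q * ip S.g q (S.B q) (S.T q) *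
      ((fun y => y⁻¹) ∘ S.t) q)) p = _ := hb.fderiv
  rw [hb']
  simp only [neg_apply, add_apply, smul_apply, smul_eq_mul, e1, e3, h.fderiv_rho_B hp,
    Function.comp_apply]
  field_simp
  ring

/-- Insert `B = |∇ρ| N - ⟨B,T⟩ T` in both slots and use `⟨DT, T⟩ = 0`. -/
lemma ip_B_cov_T_B (hp : p ∈ Ω) : ip S.g p (S.B p) (cov S.g S.T p (S.B p)) =
    S.normGradSlice p * (S.normGradSlice p * ip S.g p (cov S.g S.T p (S.N p)) (S.N p)
      - ip S.g p (S.B p) (S.T p) * ip S.g p (cov S.g S.T p (S.T p)) (S.N p)) := by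
  have hpU := hU hp
  have hB := h.metric.ipB
  set β := ip S.g p (S.B p) (S.T p)
  have hgs : S.gradSlice p = -(S.B p + β • S.T p) := by
    have : grad S.g S.rho p = -S.B p := by simp [B]
    rw [gradSlice, this, hB.neg_left hp]
    module
  have horth : ip S.g p (S.T p) (S.gradSlice p) = 0 := by
    rw [hgs, hB.neg_right hp, hB.add_right hp, hB.smul_right hp, ip_T_T hpU,
      h.metric.ip_comm hp (S.T p)]
    simp [β]
  by_cases hν : S.normGradSlice p = 0
  -- A zero value of `Real.sqrt` only says `⟨∇ρ,∇ρ⟩ ≤ 0`; orthogonality to the timelike `T` upgrades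
  -- this to `∇ρ = 0`. Then `B` is a multiple of `T` and both sides vanish.
  · have h0 : S.gradSlice p = 0 := by
      obtain ⟨f, hf⟩ := S.g_lorentz p hpU
      refine eq_zero_of_orthogonal_timelike hf (u := S.T p) (by rw [ip_T_T hpU]; norm_num) ?_ horth
      rwa [normGradSlice, Real.sqrt_eq_zero'] at hν
    have hBT : S.B p = -(β • S.T p) := by
      rw [hgs, neg_eq_zero] at h0
      exact eq_neg_of_add_eq_zero_left h0
    rw [hν, zero_mul, h.metric.ip_comm hp]
    conv_lhs => arg 4; rw [hBT]
    rw [hB.neg_right hp, hB.smul_right hp, ip_cov_T_T hpU]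
    simp
  · have hN : S.B p = S.normGradSlice p • S.N p - β • S.T p := by
      rw [N, hgs, smul_smul, mul_neg, mul_inv_cancel₀ hν]
      module
    have e1 : cov S.g S.T p (S.B p) = S.normGradSlice p • cov S.g S.T p (S.N p)
        - β • cov S.g S.T p (S.T p) := by
      conv_lhs => rw [hN]
      simp only [h.metric.cov_eq hp, map_sub, map_smul]
    have e2 (x : Vec) : ip S.g p (S.B p) (cov S.g S.T p x)
        = S.normGradSlice p * ip S.g p (cov S.g S.T p x) (S.N p) := by
      rw [h.metric.ip_comm hp]
      conv_lhs => rw [hN]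
      rw [hB.sub_right hp, hB.smul_right hp, hB.smul_right hp, ip_cov_T_T hpU]
      simp
    rw [e1, hB.sub_right hp, hB.smul_right hp, hB.smul_right hp, e2, e2]
    simp only [smul_eq_mul]
    ring

/-- Here `b⁻² t² = ρ²⟨B,T⟩²`, while `|∇ρ|² = ⟨B,T⟩² - 1`. -/
lemma rTilde_eq (hp : p ∈ Ω) (ht : 0 < S.t p) :
    S.rTilde p = S.rho p * S.normGradSlice p := by
  have hpU := hU hp
  have hB := h.metric.ipB
  have hρ := (h.rho_pos p hp).le
  have e : ip S.g p (S.gradSlice p) (S.gradSlice p) = ip S.g p (S.B p) (S.T p) ^ 2 - 1 := by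
    have : grad S.g S.rho p = -S.B p := by simp [B]
    rw [gradSlice, this]
    simp only [hB.add_left hp, hB.add_right hp, hB.smul_left hp, hB.smul_right hp, hB.neg_left hp,
      hB.neg_right hp, ip_T_T hpU, h.ip_B_B p hp, h.metric.ip_comm hp (S.T p), smul_eq_mul]
    ring
  rw [rTilde, normGradSlice, e, inv_b]
  have e2 : (-(S.rho p * ip S.g p (S.B p) (S.T p) / S.t p)) ^ 2 * S.t p ^ 2 - S.rho p ^ 2
      = S.rho p ^ 2 * (ip S.g p (S.B p) (S.T p) ^ 2 - 1) := by
    field_simp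
  rw [e2, Real.sqrt_mul (sq_nonneg _), Real.sqrt_sq hρ]

/-- In terms of `b`, the derivative found above reads `B(b⁻¹) = (n⁻¹b⁻¹/ρ)(n - b⁻¹) - (ρ/t)⟨B, D_B
T⟩`. The last term splits into the `π_NN` and `D_T T` terms. -/
lemma lapse_equation (hp : p ∈ Ω) (ht : 0 < S.t p) :
    DifferentiableAt ℝ (fun q => S.n q - (S.b q)⁻¹) p ∧
      S.derivB (fun q => S.n q - (S.b q)⁻¹) p
          + (S.n p)⁻¹ * (S.b p)⁻¹ / S.rho p * (S.n p - (S.b p)⁻¹)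
        = -(S.rTilde p / S.t p * (S.a p)⁻¹ * S.secondFormT p (S.N p) (S.N p))
          + S.rTilde p * (S.b p)⁻¹ / S.rho p
              * ip S.g p (cov S.g S.T p (S.T p)) (S.N p)
          + S.derivB S.n p := by
  obtain ⟨hb, hb'⟩ := h.hasFDerivAt_inv_b hU hp ht
  have hnd := (n_contDiffAt (hU hp)).differentiableAt (by simp)
  refine ⟨hnd.sub hb, ?_⟩
  have hn := (n_pos (hU hp)).ne'
  have hρ := (h.rho_pos p hp).ne'
  rw [derivB, derivB, fderiv_fun_sub hnd hb, sub_apply, hb', h.ip_B_cov_T_B hU hp,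
    h.rTilde_eq hU hp ht, inv_b, secondFormT, a, inv_inv]
  field_simp
  ring

lemma log_equation (hp : p ∈ Ω) (ht : 0 < S.t p) (hτ : 0 < S.tau p)
    (hτd : DifferentiableAt ℝ S.tau p) (hτB : fderiv ℝ S.tau p (S.B p) = S.tau p / S.rho p) :
    0 < S.t p / S.tau p ∧ DifferentiableAt ℝ (fun q => Real.log (S.t q / S.tau q)) p ∧
      S.derivB (fun q => Real.log (S.t q / S.tau q)) p
        = ((S.b p)⁻¹ * (S.n p)⁻¹ - 1) / S.rho p := by
  have htd := (t_contDiffAt (hU hp)).differentiableAt (by simp)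
  have hn := (n_pos (hU hp)).ne'
  have hρ := (h.rho_pos p hp).ne'
  have e : (fun q => Real.log (S.t q / S.tau q)) =ᶠ[𝓝 p]
      fun q => Real.log (S.t q) - Real.log (S.tau q) := by
    filter_upwards [htd.continuousAt.eventually_ne ht.ne', hτd.continuousAt.eventually_ne hτ.ne']
      with q h1 h2 using Real.log_div h1 h2
  have hl := (htd.hasFDerivAt.log ht.ne').fun_sub (hτd.hasFDerivAt.log hτ.ne')
  refine ⟨div_pos ht hτ, hl.differentiableAt.congr_of_eventuallyEq e, ?_⟩
  have e2 := ip_T (hU hp) (S.B p)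
  rw [derivB, e.fderiv_eq, hl.fderiv, inv_b, e2]
  simp only [sub_apply, smul_apply, smul_eq_mul, hτB]
  field_simp

end IsHyperboloidal

end Spacetime

end Hyperboloid

namespace Hyperboloid

/-! ### Geodesics -/

/-- `γ` is a geodesic in `U` with velocity `w`, on the time interval `[0, T]`. -/
def IsGeodesicOn (g : MetricField) (U : Set Vec) (γ w : ℝ → Vec) (T : ℝ) : Prop :=
  ∀ s ∈ Set.Icc (0 : ℝ) T, γ s ∈ U ∧ HasDerivWithinAt γ (w s) (Set.Icc 0 T) s ∧
    HasDerivWithinAt w (-christoffel g (γ s) (w s) (w s)) (Set.Icc 0 T) s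

/-- The geodesic vector field on the tangent bundle. -/
def geodesicField (g : MetricField) (z : Vec × Vec) : Vec × Vec :=
  (z.2, -christoffel g z.1 z.2 z.2)

/-- The acceleration is quadratic in the velocity, so both scale by `c²`. The value `c = 0` is
allowed, which covers the start of a ray. -/
lemma IsGeodesicOn.rescale {g : MetricField} {U : Set Vec} (hg : IsMetric g U) {γ w : ℝ → Vec}
    {T T' c : ℝ} (h : IsGeodesicOn g U γ w T) (hc : 0 ≤ c) (hT : c * T' ≤ T) :
    IsGeodesicOn g U (fun s => γ (c * s)) (fun s => c • w (c * s)) T' := by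
  intro s hs
  have hmaps : Set.MapsTo (fun s => c * s) (Set.Icc 0 T') (Set.Icc 0 T) := fun x hx =>
    ⟨mul_nonneg hc hx.1, (mul_le_mul_of_nonneg_left hx.2 hc).trans hT⟩
  obtain ⟨h1, h2, h3⟩ := h (c * s) (hmaps hs)
  have hm : HasDerivWithinAt (fun s : ℝ => c * s) c (Set.Icc 0 T') s := by
    simpa using (hasDerivWithinAt_id s _).const_mul c
  refine ⟨h1, h2.scomp s hm hmaps, ?_⟩
  have h4 := (h3.scomp s hm hmaps).const_smul c
  refine h4.congr_deriv ?_
  rw [hg.christoffelB.smul_left h1, hg.christoffelB.smul_right h1]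
  module

namespace IsMetric

variable {g : MetricField} {U : Set Vec} (hg : IsMetric g U)
include hg

lemma geodesicField_contDiffAt {z : Vec × Vec} (hz : z.1 ∈ U) :
    ContDiffAt ℝ ∞ (geodesicField g) z := by
  have h1 : ContDiffAt ℝ ∞ (fun z : Vec × Vec => bilinCLM (christoffel g) z.1) z :=
    (hg.christoffelB.contDiffAt_bilinCLM hz).comp (f := Prod.fst) z contDiffAt_fst
  have h2 : ContDiffAt ℝ ∞ (fun z : Vec × Vec => -bilinCLM (christoffel g) z.1 z.2 z.2) z :=
    ((h1.clm_apply contDiffAt_snd).clm_apply contDiffAt_snd).neg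
  refine (contDiffAt_snd.prodMk h2).congr_of_eventuallyEq ?_
  filter_upwards [continuousAt_fst.eventually_mem (hg.isOpen.mem_nhds hz)] with q hq
  rw [geodesicField, hg.christoffelB.eq_bilinCLM hq]

/-- Geodesics are determined by their initial data. -/
lemma geodesic_unique {γ₁ w₁ γ₂ w₂ : ℝ → Vec} {T : ℝ} (h₁ : IsGeodesicOn g U γ₁ w₁ T)
    (h₂ : IsGeodesicOn g U γ₂ w₂ T) (hγ : γ₁ 0 = γ₂ 0) (hw : w₁ 0 = w₂ 0) :
    Set.EqOn γ₁ γ₂ (Set.Icc 0 T) := by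
  have hd {γ w : ℝ → Vec} (h : IsGeodesicOn g U γ w T) (s : ℝ) (hs : s ∈ Set.Icc 0 T) :
      HasDerivWithinAt (fun s => (γ s, w s)) (geodesicField g (γ s, w s)) (Set.Icc 0 T) s :=
    (h s hs).2.1.prodMk (h s hs).2.2
  have hcont {γ w : ℝ → Vec} (h : IsGeodesicOn g U γ w T) :
      ContinuousOn (fun s => (γ s, w s)) (Set.Icc 0 T) := fun s hs =>
    (hd h s hs).continuousWithinAt
  have hd' {γ w : ℝ → Vec} (h : IsGeodesicOn g U γ w T) (s : ℝ) (hs : s ∈ Set.Ico 0 T) :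
      HasDerivWithinAt (fun s => (γ s, w s)) (geodesicField g (γ s, w s)) (Set.Ici s) s :=
    (hd h s (Set.Ico_subset_Icc_self hs)).mono_of_mem_nhdsWithin
      (mem_of_superset (Icc_mem_nhdsGE hs.2) (Set.Icc_subset_Icc_left hs.1))
  -- The geodesic field is only locally Lipschitz, and only over `U`; on the compact union of the
  -- two trajectories it has a uniform constant.
  set K := (fun s => (γ₁ s, w₁ s)) '' Set.Icc 0 T ∪ (fun s => (γ₂ s, w₂ s)) '' Set.Icc 0 T
  have hK : IsCompact K := (isCompact_Icc.image_of_continuousOn (hcont h₁)).union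
    (isCompact_Icc.image_of_continuousOn (hcont h₂))
  have hlip : LocallyLipschitzOn K (geodesicField g) := by
    intro z hz
    have hzU : z.1 ∈ U := by
      rcases hz with ⟨s, hs, rfl⟩ | ⟨s, hs, rfl⟩
      · exact (h₁ s hs).1
      · exact (h₂ s hs).1
    obtain ⟨C, t, ht, hC⟩ := ((hg.geodesicField_contDiffAt hzU).of_le
      (m := 1) (by exact_mod_cast le_top)).exists_lipschitzOnWith
    exact ⟨C, t, mem_nhdsWithin_of_mem_nhds ht, hC⟩
  obtain ⟨C, hC⟩ := hlip.exists_lipschitzOnWith_of_compact hK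
  have := ODE_solution_unique_of_mem_Icc_right (v := fun _ => geodesicField g) (s := fun _ => K)
    (fun _ _ => hC) (hcont h₁) (hd' h₁)
    (fun s hs => Or.inl ⟨s, Set.Ico_subset_Icc_self hs, rfl⟩) (hcont h₂) (hd' h₂)
    (fun s hs => Or.inr ⟨s, Set.Ico_subset_Icc_self hs, rfl⟩) (by simp [hγ, hw])
  exact fun s hs => congrArg Prod.fst (this hs)

/-- Uniqueness of geodesics makes the choice in `expMap` irrelevant. -/
lemma expMap_eq {O v c : Vec} (h : IsGeodesicEndpoint g U O v c) : expMap g U O v = c := by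
  have hex : ∃ c, IsGeodesicEndpoint g U O v c := ⟨c, h⟩
  obtain ⟨γ, w, h0, h0', h1, h2⟩ := h
  rw [expMap, dif_pos hex]
  obtain ⟨γ', w', k0, k0', k1, k2⟩ := hex.choose_spec
  rw [← h1, ← k1]
  exact hg.geodesic_unique k2 h2 (k0.trans h0.symm) (k0'.trans h0'.symm)
    (Set.right_mem_Icc.2 zero_le_one)

lemma expMap_smul_eq {O v : Vec} {γ w : ℝ → Vec} {T : ℝ} (h : IsGeodesicOn g U γ w T)
    (h0 : γ 0 = O) (h0' : w 0 = v) {s : ℝ} (hs : s ∈ Set.Icc 0 T) :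
    expMap g U O (s • v) = γ s := by
  refine hg.expMap_eq ⟨fun u => γ (s * u), fun u => s • w (s * u), by simpa using h0,
    by simp [h0'], by simp, ?_⟩
  exact h.rescale hg hs.1 (by simpa using hs.2)

/-- The exponential map is Lipschitz near the origin. -/
lemma exists_lipschitzOnWith_expMap {O : Vec} (hO : O ∈ U) :
    ∃ K, ∃ δ > 0, LipschitzOnWith K (expMap g U O) (Metric.ball 0 δ) := by
  obtain ⟨ε, hε, a, r, L, K, hr, hpl⟩ := IsPicardLindelof.of_contDiffAt_one
    ((hg.geodesicField_contDiffAt (z := (O, 0)) hO).of_le (m := 1) (by exact_mod_cast le_top))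
  obtain ⟨α, hα, K', hK'⟩ :=
    (hpl 0).exists_forall_mem_closedBall_eq_hasDerivWithinAt_lipschitzOnWith
  have hr' : (0 : ℝ) < r := hr
  set z₀ : Vec × Vec := (O, 0)
  have hz₀ : z₀ ∈ Metric.closedBall z₀ (r : ℝ) := Metric.mem_closedBall_self hr'.le
  have hopen : IsOpen {z : Vec × Vec | z.1 ∈ U} := hg.isOpen.preimage continuous_fst
  obtain ⟨η, hη, hηU⟩ := Metric.isOpen_iff.1 hopen z₀ hO
  have h0 : (0 : ℝ) ∈ Set.Icc (0 - ε) (0 + ε) := ⟨by linarith, by linarith⟩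
  have hcont : ContinuousAt (α z₀) 0 :=
    ((hα z₀ hz₀).2 0 h0).continuousWithinAt.continuousAt
      (Icc_mem_nhds (by linarith) (by linarith))
  obtain ⟨d, hd, hdη⟩ := Metric.continuousAt_iff.1 hcont (η / 2) (half_pos hη)
  rw [(hα z₀ hz₀).1] at hdη
  -- Up to time `s₁` the solution from `(O, 0)` stays within `η/2` of its start. The radius `r'`
  -- below keeps neighbouring solutions within another `η/2`, hence over `U`; the `+ 1` in it covers
  -- a vanishing Lipschitz constant.
  set s₁ := min ε (d / 2) with hs₁
  have hs₁0 : 0 < s₁ := lt_min hε (half_pos hd)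
  set r' := min (r : ℝ) (η / (2 * (K' + 1))) with hr'def
  have hK'0 : (0 : ℝ) < K' + 1 := by positivity
  have hr'0 : 0 < r' := lt_min hr' (by positivity)
  have hsub : Set.Icc 0 s₁ ⊆ Set.Icc (0 - ε) (0 + ε) := fun s hs =>
    ⟨by linarith [hs.1], by linarith [hs.2, min_le_left ε (d / 2)]⟩
  have hball {v : Vec} (hv : ‖v‖ < r') : (O, v) ∈ Metric.closedBall z₀ (r : ℝ) := by
    rw [Metric.mem_closedBall, Prod.dist_eq]
    simp only [z₀, dist_self, dist_zero_right]
    exact max_le hr'.le (hv.le.trans (min_le_left _ _))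
  have hgeo {v : Vec} (hv : ‖v‖ < r') : IsGeodesicOn g U (fun s => (α (O, v) s).1)
      (fun s => (α (O, v) s).2) s₁ := by
    intro s hs
    have h1 := ((hα _ (hball hv)).2 s (hsub hs)).mono hsub
    refine ⟨hηU ?_, ?_, ?_⟩
    · have h2 := (hK' s (hsub hs)).dist_le_mul _ (hball hv) _ hz₀
      have h3 : dist (O, v) z₀ = ‖v‖ := by
        rw [Prod.dist_eq]
        simp [z₀]
      have h4 : dist (α z₀ s) z₀ < η / 2 := by
        refine hdη ?_
        rw [Real.dist_eq, sub_zero, abs_of_nonneg hs.1]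
        linarith [hs.2, min_le_right ε (d / 2)]
      have h5 : (K' : ℝ) * ‖v‖ ≤ η / 2 := by
        have : ‖v‖ ≤ η / (2 * (K' + 1)) := hv.le.trans (min_le_right _ _)
        calc (K' : ℝ) * ‖v‖ ≤ (K' + 1) * (η / (2 * (K' + 1))) := by gcongr; linarith
          _ = η / 2 := by field_simp
      rw [h3] at h2
      rw [Metric.mem_ball]
      linarith [dist_triangle (α (O, v) s) (α z₀ s) z₀]
    · exact h1.hasFDerivWithinAt.fst.hasDerivWithinAt.congr_deriv (by simp [geodesicField])
    · exact h1.hasFDerivWithinAt.snd.hasDerivWithinAt.congr_deriv (by simp [geodesicField])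
  -- The local flow is controlled only up to time `s₁`, while `expMap` uses time one. Rescaling
  -- bridges the gap and contributes the factor `s₁⁻¹` to the constant.
  have hexp {v : Vec} (hv : ‖v‖ < r') : expMap g U O (s₁ • v) = (α (O, v) s₁).1 := by
    have h1 := (hα _ (hball hv)).1
    exact hg.expMap_smul_eq (hgeo hv) (by simpa using congrArg Prod.fst h1)
      (by simpa using congrArg Prod.snd h1) (Set.right_mem_Icc.2 hs₁0.le)
  have hs₁' : s₁ ∈ Set.Icc (0 - ε) (0 + ε) := hsub (Set.right_mem_Icc.2 hs₁0.le)
  refine ⟨K' * (s₁⁻¹).toNNReal, s₁ * r', mul_pos hs₁0 hr'0, LipschitzOnWith.of_dist_le_mul ?_⟩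
  intro x hx y hy
  have hn {x : Vec} (hx : x ∈ Metric.ball (0 : Vec) (s₁ * r')) : ‖s₁⁻¹ • x‖ < r' := by
    rw [mem_ball_zero_iff] at hx
    rw [norm_smul, norm_inv, Real.norm_of_nonneg hs₁0.le, inv_mul_lt_iff₀ hs₁0]
    exact hx
  have he {x : Vec} (hx : x ∈ Metric.ball (0 : Vec) (s₁ * r')) :
      expMap g U O x = (α (O, s₁⁻¹ • x) s₁).1 := by
    rw [← hexp (hn hx), smul_inv_smul₀ hs₁0.ne']
  rw [he hx, he hy]
  have h1 := (hK' s₁ hs₁').dist_le_mul _ (hball (hn hx)) _ (hball (hn hy))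
  have h2 : dist (O, s₁⁻¹ • x) (O, s₁⁻¹ • y) = s₁⁻¹ * dist x y := by
    rw [Prod.dist_eq, dist_self, dist_smul₀, Real.norm_of_nonneg (inv_nonneg.2 hs₁0.le)]
    exact max_eq_right (by positivity)
  rw [h2] at h1
  refine (le_trans (le_max_left _ _) h1).trans_eq ?_
  rw [NNReal.coe_mul, Real.coe_toNNReal _ (inv_nonneg.2 hs₁0.le), mul_assoc]

/-- The velocity of a geodesic has constant length. -/
lemma ip_velocity {γ w : ℝ → Vec} {T : ℝ} (h : IsGeodesicOn g U γ w T) {s : ℝ}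
    (hs : s ∈ Set.Icc 0 T) : ip g (γ s) (w s) (w s) = ip g (γ 0) (w 0) (w 0) := by
  have hd (s : ℝ) (hs : s ∈ Set.Icc 0 T) :
      HasDerivWithinAt (fun s => bilinCLM (ip g) (γ s) (w s) (w s)) 0 (Set.Icc 0 T) s := by
    obtain ⟨h1, h2, h3⟩ := h s hs
    have hL := ((hg.ipB.contDiffAt_bilinCLM h1).differentiableAt (by simp)).hasFDerivAt
    have h4 := ((hL.comp_hasDerivWithinAt s h2).clm_apply h3).clm_apply h3
    refine h4.congr_deriv ?_
    have h5 := hg.fderiv_ip_const h1 (w s) (w s) (w s)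
    rw [hg.ipB.fderiv_bilin h1, hg.ipB.eq_bilinCLM h1, hg.ipB.eq_bilinCLM h1] at h5
    simp only [Function.comp_apply, add_apply, h5, map_neg, neg_apply]
    ring
  have := constant_of_has_deriv_right_zero (fun s hs => (hd s hs).continuousWithinAt)
    (fun s hs => (hd s (Set.Ico_subset_Icc_self hs)).mono_of_mem_nhdsWithin
      (mem_of_superset (Icc_mem_nhdsGE hs.2) (Set.Icc_subset_Icc_left hs.1))) s hs
  have h0 : (0 : ℝ) ∈ Set.Icc 0 T := ⟨le_rfl, hs.1.trans hs.2⟩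
  rwa [← hg.ipB.eq_bilinCLM (h s hs).1, ← hg.ipB.eq_bilinCLM (h 0 h0).1] at this

/-- The derivative of the inner product of two vector fields along a map. -/
lemma fderiv_ip_along {φ X Y : Vec → Vec} {y : Vec} (hφ : DifferentiableAt ℝ φ y) (hy : φ y ∈ U)
    (hX : DifferentiableAt ℝ X y) (hY : DifferentiableAt ℝ Y y) :
    DifferentiableAt ℝ (fun q => ip g (φ q) (X q) (Y q)) y ∧ ∀ v,
    fderiv ℝ (fun q => ip g (φ q) (X q) (Y q)) y v =
      ip g (φ y) (fderiv ℝ X y v + christoffel g (φ y) (fderiv ℝ φ y v) (X y)) (Y y)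
        + ip g (φ y) (X y) (fderiv ℝ Y y v + christoffel g (φ y) (fderiv ℝ φ y v) (Y y)) := by
  have e : (fun q => ip g (φ q) (X q) (Y q)) =ᶠ[𝓝 y]
      fun q => bilinCLM (ip g) (φ q) (X q) (Y q) := by
    filter_upwards [hφ.continuousAt.eventually_mem (hg.isOpen.mem_nhds hy)] with q hq
      using hg.ipB.eq_bilinCLM hq _ _
  have hL := ((hg.ipB.contDiffAt_bilinCLM hy).differentiableAt (by simp)).hasFDerivAt
  have h1 := ((hL.comp y hφ.hasFDerivAt).clm_apply hX.hasFDerivAt).clm_apply hY.hasFDerivAt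
  refine ⟨h1.differentiableAt.congr_of_eventuallyEq e, fun v => ?_⟩
  have h2 : fderiv ℝ (fun q => bilinCLM (ip g) (φ q) (X q) (Y q)) y = _ := h1.fderiv
  have h5 := hg.fderiv_ip_const hy (fderiv ℝ φ y v) (X y) (Y y)
  rw [hg.ipB.fderiv_bilin hy] at h5
  rw [e.fderiv_eq, h2, hg.ipB.add_left hy, hg.ipB.add_right hy]
  simp only [Function.comp_apply, add_apply, ContinuousLinearMap.comp_apply,
    ContinuousLinearMap.flip_apply, h5, hg.ipB.eq_bilinCLM hy]
  ring

end IsMetric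

end Hyperboloid

namespace Hyperboloid

namespace Spacetime

/-! ### The future cone -/

/-- The Minkowski pairing with signature `(+,-,-,-)`. -/
def minkPair (y w : Vec) : ℝ := y 0 * w 0 - ∑ i : Fin 3, y i.succ * w i.succ

lemma minkPair_self (y : Vec) : minkPair y y = minkSq y := by
  simp [minkPair, minkSq, pow_two]

lemma minkPair_smul_left (c : ℝ) (y w : Vec) : minkPair (c • y) w = c * minkPair y w := by
  simp only [minkPair, Pi.smul_apply, smul_eq_mul, mul_sub, Finset.mul_sum, mul_assoc]

lemma minkPair_smul_right (c : ℝ) (y w : Vec) : minkPair y (c • w) = c * minkPair y w := by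
  simp only [minkPair, Pi.smul_apply, smul_eq_mul, mul_sub, Finset.mul_sum, mul_left_comm]

lemma minkSq_smul (c : ℝ) (y : Vec) : minkSq (c • y) = c ^ 2 * minkSq y := by
  rw [← minkPair_self, minkPair_smul_left, minkPair_smul_right, minkPair_self]
  ring

lemma contDiff_minkSq : ContDiff ℝ ∞ minkSq := by
  unfold minkSq
  fun_prop

lemma fderiv_minkSq (y w : Vec) : fderiv ℝ minkSq y w = 2 * minkPair y w := by
  have hp (a : Fin 4) : HasFDerivAt (fun y : Vec => y a)
    (ContinuousLinearMap.proj (R := ℝ) (φ := fun _ : Fin 4 => ℝ) a) y := hasFDerivAt_apply a y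
  have h : HasFDerivAt minkSq _ y := ((hp 0).pow 2).sub
    (HasFDerivAt.fun_sum (u := Finset.univ) fun (i : Fin 3) _ => (hp i.succ).pow 2)
  rw [h.fderiv, minkPair]
  simp [Finset.mul_sum, mul_sub, mul_assoc]

lemma isOpen_cone (r : ℝ≥0∞) : IsOpen (cone r) := by
  have h := contDiff_minkSq.continuous
  exact (isOpen_lt continuous_const (continuous_apply 0)).inter
    ((isOpen_lt continuous_const h).inter
      (isOpen_lt (ENNReal.continuous_ofReal.comp h.sqrt) continuous_const))

lemma smul_mem_cone {r : ℝ≥0∞} {y : Vec} (hy : y ∈ cone r) {s : ℝ} (hs : 0 < s) (hs1 : s ≤ 1) :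
    s • y ∈ cone r := by
  obtain ⟨h1, h2, h3⟩ := hy
  refine ⟨mul_pos hs h1, ?_, lt_of_le_of_lt (ENNReal.ofReal_le_ofReal (Real.sqrt_le_sqrt ?_)) h3⟩
  · rw [minkSq_smul]
    positivity
  · rw [minkSq_smul]
    exact mul_le_of_le_one_left h2.le (pow_le_one₀ hs.le hs1)

/-- Extending the ray slightly makes `y` an interior point of its geodesic, where one-sided
derivatives become two-sided. -/
lemma exists_smul_mem_cone {r : ℝ≥0∞} {y : Vec} (hy : y ∈ cone r) :
    ∃ c : ℝ, 1 < c ∧ c • y ∈ cone r := by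
  have hc : ContinuousAt (fun c : ℝ => c • y) 1 := by fun_prop
  have h1 : ∀ᶠ c in 𝓝 (1 : ℝ), c • y ∈ cone r :=
    hc.eventually_mem ((isOpen_cone r).mem_nhds (by simpa using hy))
  have h2 : ∀ᶠ c in 𝓝[>] (1 : ℝ), c • y ∈ cone r ∧ 1 < c :=
    (h1.filter_mono nhdsWithin_le_nhds).and self_mem_nhdsWithin
  obtain ⟨c, h3, h4⟩ := h2.exists
  exact ⟨c, h4, h3⟩

lemma exists_mem_cone_of_mem_iSup {P : ℝ → Prop} {y : Vec}
    (hy : y ∈ cone (⨆ (r : ℝ) (_ : P r), ENNReal.ofReal r)) :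
    ∃ r, P r ∧ y ∈ cone (ENNReal.ofReal r) := by
  obtain ⟨h1, h2, h3⟩ := hy
  simp only [lt_iSup_iff] at h3
  obtain ⟨r, hr, h⟩ := h3
  exact ⟨r, hr, h1, h2, h⟩

lemma cone_mono {r r' : ℝ≥0∞} (h : r ≤ r') : cone r ⊆ cone r' := fun _ hy =>
  ⟨hy.1, hy.2.1, hy.2.2.trans_le h⟩

variable {S : Spacetime} {y : Vec}

/-- The radius is a supremum that need not be attained, but each point already lies in an admissible
smaller cone. -/
lemma exists_isDiffeoUpTo (hy : y ∈ cone S.injRadius) :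
    ∃ r, S.IsDiffeoUpTo r ∧ y ∈ cone (ENNReal.ofReal r) ∧ ENNReal.ofReal r ≤ S.injRadius := by
  obtain ⟨r, hr, h⟩ := exists_mem_cone_of_mem_iSup hy
  exact ⟨r, hr.2, h, le_iSup₂_of_le r hr le_rfl⟩

lemma expO_contDiffAt (hy : y ∈ cone S.injRadius) : ContDiffAt ℝ ∞ S.expO y := by
  obtain ⟨r, ⟨-, Φ, hs, he, hd, -⟩, hyr, -⟩ := exists_isDiffeoUpTo hy
  have hn : Φ.source ∈ 𝓝 y := Φ.open_source.mem_nhds (hs ▸ hyr)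
  exact (hd.contDiffAt hn).congr_of_eventuallyEq (eventually_of_mem hn fun q hq => (he hq).symm)

lemma expO_differentiableAt (hy : y ∈ cone S.injRadius) : DifferentiableAt ℝ S.expO y :=
  (expO_contDiffAt hy).differentiableAt (by simp)

lemma injOn_expO : Set.InjOn S.expO (cone S.injRadius) := by
  intro y hy z hz hyz
  obtain ⟨r, hr, hyr, -⟩ := exists_isDiffeoUpTo hy
  obtain ⟨r', hr', hzr, -⟩ := exists_isDiffeoUpTo hz
  have key {r : ℝ} (hr : S.IsDiffeoUpTo r) (hy : y ∈ cone (ENNReal.ofReal r))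
      (hz : z ∈ cone (ENNReal.ofReal r)) : y = z := by
    obtain ⟨-, Φ, hs, he, -, -⟩ := hr
    rw [← hs] at hy hz
    exact Φ.injOn hy hz (by rw [he hy, he hz, hyz])
  rcases le_total r r' with h | h
  · exact key hr' (cone_mono (ENNReal.ofReal_le_ofReal h) hyr) hzr
  · exact key hr hyr (cone_mono (ENNReal.ofReal_le_ofReal h) hzr)

lemma normalCoord_expO (hy : y ∈ cone S.injRadius) : S.normalCoord (S.expO y) = y :=
  injOn_expO.leftInvOn_invFunOn hy

lemma normalCoord_contDiffAt (hy : y ∈ cone S.injRadius) :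
    S.future ∈ 𝓝 (S.expO y) ∧ ContDiffAt ℝ ∞ S.normalCoord (S.expO y) := by
  obtain ⟨r, ⟨-, Φ, hs, he, -, hd⟩, hyr, hle⟩ := exists_isDiffeoUpTo hy
  have hys : y ∈ Φ.source := hs ▸ hyr
  have hn : Φ.target ∈ 𝓝 (S.expO y) := Φ.open_target.mem_nhds (he hys ▸ Φ.map_source hys)
  have h1 {q : Vec} (hq : q ∈ Φ.target) : S.expO (Φ.symm q) = q := by
    rw [← he (Φ.map_target hq), Φ.right_inv hq]
  have h2 {q : Vec} (hq : q ∈ Φ.target) : Φ.symm q ∈ cone S.injRadius :=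
    cone_mono hle (hs ▸ Φ.map_target hq)
  refine ⟨mem_of_superset hn fun q hq => ⟨_, h2 hq, h1 hq⟩, ?_⟩
  refine (hd.contDiffAt hn).congr_of_eventuallyEq (eventually_of_mem hn fun q hq => ?_)
  conv_lhs => rw [← h1 hq]
  exact normalCoord_expO (h2 hq)

lemma isOpen_future : IsOpen S.future := by
  rw [isOpen_iff_mem_nhds]
  rintro _ ⟨y, hy, rfl⟩
  exact (normalCoord_contDiffAt hy).1

lemma eventually_mem_cone {r : ℝ≥0∞} (hy : y ∈ cone r) : ∀ᶠ q in 𝓝 y, q ∈ cone r :=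
  (isOpen_cone r).mem_nhds hy

/-- The chain rule in normal coordinates. -/
lemma fderiv_comp_expO {E : Type*} [NormedAddCommGroup E] [NormedSpace ℝ E] {f : Vec → E}
    {F : Vec → E} (hy : y ∈ cone S.injRadius) (hf : DifferentiableAt ℝ f (S.expO y))
    (h : ∀ q ∈ cone S.injRadius, f (S.expO q) = F q) (w : Vec) :
    fderiv ℝ f (S.expO y) (fderiv ℝ S.expO y w) = fderiv ℝ F y w := by
  have h1 := (hf.hasFDerivAt.comp y (expO_differentiableAt hy).hasFDerivAt).fderiv
  have e : f ∘ S.expO =ᶠ[𝓝 y] F := by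
    filter_upwards [eventually_mem_cone hy] with q hq using h q hq
  rw [← e.fderiv_eq, h1]
  rfl

lemma exists_fderiv_expO_eq (hy : y ∈ cone S.injRadius) (z : Vec) :
    ∃ w, fderiv ℝ S.expO y w = z := by
  have hN : HasFDerivAt S.normalCoord _ (S.expO y) :=
    ((normalCoord_contDiffAt hy).2.differentiableAt (by simp)).hasFDerivAt
  have hE : HasFDerivAt S.expO (fderiv ℝ S.expO y) (S.normalCoord (S.expO y)) := by
    rw [normalCoord_expO hy]
    exact (expO_differentiableAt hy).hasFDerivAt
  have h1 := (hE.comp _ hN).fderiv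
  have e : S.expO ∘ S.normalCoord =ᶠ[𝓝 (S.expO y)] id := by
    filter_upwards [(normalCoord_contDiffAt hy).1] with q hq
    obtain ⟨q', hq', rfl⟩ := hq
    simp [normalCoord_expO hq']
  rw [e.fderiv_eq, fderiv_id] at h1
  exact ⟨_, (congrArg (fun L : Vec →L[ℝ] Vec => L z) h1).symm⟩

/-! ### Radial geodesics -/

lemma exists_radial_geodesic (hy : y ∈ cone S.injRadius) : ∃ γ w : ℝ → Vec,
    γ 0 = S.O ∧ w 0 = ∑ a, y a • S.e a ∧ IsGeodesicOn S.g S.U γ w 1 ∧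
      ∀ s ∈ Set.Icc (0 : ℝ) 1, S.expO (s • y) = γ s := by
  obtain ⟨r, ⟨hr, -⟩, hyr, -⟩ := exists_isDiffeoUpTo hy
  obtain ⟨c, γ, w, h0, h0', -, h⟩ := hr y hyr
  refine ⟨γ, w, h0, h0', h, fun s hs => ?_⟩
  rw [← S.isMetric.expMap_smul_eq h h0 h0' hs, expO, Finset.smul_sum]
  simp [smul_smul]

lemma expO_mem_U (hy : y ∈ cone S.injRadius) : S.expO y ∈ S.U := by
  obtain ⟨γ, w, -, -, h, he⟩ := exists_radial_geodesic hy
  have := he 1 (Set.right_mem_Icc.2 zero_le_one)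
  rw [one_smul] at this
  rw [this]
  exact (h 1 (Set.right_mem_Icc.2 zero_le_one)).1

lemma future_subset_U : S.future ⊆ S.U := by
  rintro _ ⟨y, hy, rfl⟩
  exact expO_mem_U hy

lemma hasDerivAt_expO_smul {s : ℝ} (hy : s • y ∈ cone S.injRadius) :
    HasDerivAt (fun s : ℝ => S.expO (s • y)) (fderiv ℝ S.expO (s • y) y) s := by
  have h1 : HasDerivAt (fun s : ℝ => s • y) y s := by
    simpa using (hasDerivAt_id s).smul_const y
  exact HasFDerivAt.comp_hasDerivAt (l := S.expO) s (expO_differentiableAt hy).hasFDerivAt h1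

lemma radial_velocity (hy : y ∈ cone S.injRadius) {γ w : ℝ → Vec}
    (h : IsGeodesicOn S.g S.U γ w 1) (he : ∀ s ∈ Set.Icc (0 : ℝ) 1, S.expO (s • y) = γ s)
    {s : ℝ} (hs : s ∈ Set.Ioo (0 : ℝ) 1) : w s = fderiv ℝ S.expO (s • y) y := by
  have hn : Set.Icc (0 : ℝ) 1 ∈ 𝓝 s := Icc_mem_nhds hs.1 hs.2
  have h1 := ((h s (Set.Ioo_subset_Icc_self hs)).2.1).hasDerivAt hn
  have h2 := hasDerivAt_expO_smul (S := S) (smul_mem_cone hy hs.1 hs.2.le)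
  have e : (fun s : ℝ => S.expO (s • y)) =ᶠ[𝓝 s] γ := eventually_of_mem hn he
  exact h1.unique (h2.congr_of_eventuallyEq e.symm)

/-- The radial field: the image of the Euler field under the exponential map. -/
def radial (S : Spacetime) (y : Vec) : Vec := fderiv ℝ S.expO y y

lemma radial_contDiffAt (hy : y ∈ cone S.injRadius) : ContDiffAt ℝ ∞ S.radial y :=
  contDiffAt_fderiv_apply (expO_contDiffAt hy) contDiffAt_id

lemma ip_sum_e (c : Fin 4 → ℝ) : ip S.g S.O (∑ a, c a • S.e a) (∑ a, c a • S.e a) = -minkSq c := by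
  rw [ip_sum_frame S.e_orthonormal, ← minkPair_self, minkPair]
  ring

/-- Every point of the cone is an interior point of a radial geodesic. -/
lemma exists_radial_geodesic_through (hy : y ∈ cone S.injRadius) : ∃ (c : ℝ) (γ w : ℝ → Vec),
    1 < c ∧ c • y ∈ cone S.injRadius ∧ ip S.g (γ 0) (w 0) (w 0) = -minkSq (c • y) ∧
      IsGeodesicOn S.g S.U γ w 1 ∧ ∀ s ∈ Set.Icc (0 : ℝ) 1, S.expO (s • c • y) = γ s := by
  obtain ⟨c, hc, hcy⟩ := exists_smul_mem_cone hy
  obtain ⟨γ, w, h0, h0', h, he⟩ := exists_radial_geodesic hcy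
  exact ⟨c, γ, w, hc, hcy, by rw [h0, h0', ip_sum_e], h, he⟩

/-- The squared length of the velocity is conserved along the ray, and at `O` the orthonormal frame
evaluates it. -/
lemma ip_radial_radial (hy : y ∈ cone S.injRadius) :
    ip S.g (S.expO y) (S.radial y) (S.radial y) = -minkSq y := by
  obtain ⟨c, γ, w, hc, hcy, h0, h, he⟩ := exists_radial_geodesic_through hy
  have hc0 : 0 < c := by linarith
  have hs : c⁻¹ ∈ Set.Ioo (0 : ℝ) 1 := ⟨inv_pos.2 hc0, inv_lt_one_of_one_lt₀ hc⟩
  have h1 := radial_velocity hcy h he hs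
  have h2 := he _ (Set.Ioo_subset_Icc_self hs)
  have h3 := S.isMetric.ip_velocity h (Set.Ioo_subset_Icc_self hs)
  have hyU := expO_mem_U hy
  rw [inv_smul_smul₀ hc0.ne'] at h1 h2
  rw [h0, ← h2, h1, map_smul, S.isMetric.ipB.smul_left hyU, S.isMetric.ipB.smul_right hyU,
    minkSq_smul] at h3
  simp only [smul_eq_mul] at h3
  have h4 : c ^ 2 * (ip S.g (S.expO y) (S.radial y) (S.radial y) + minkSq y) = 0 := by
    rw [radial]
    linarith
  have := (mul_eq_zero.1 h4).resolve_left (by positivity)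
  linarith

/-- The geodesic equation for the radial field. -/
lemma fderiv_radial (hy : y ∈ cone S.injRadius) : fderiv ℝ S.radial y y
    + christoffel S.g (S.expO y) (S.radial y) (S.radial y) = S.radial y := by
  obtain ⟨c, γ, w, hc, hcy, h0, h, he⟩ := exists_radial_geodesic_through hy
  have hc0 : 0 < c := by linarith
  have hs : c⁻¹ ∈ Set.Ioo (0 : ℝ) 1 := ⟨inv_pos.2 hc0, inv_lt_one_of_one_lt₀ hc⟩
  have hn : Set.Ioo (0 : ℝ) 1 ∈ 𝓝 c⁻¹ := Ioo_mem_nhds hs.1 hs.2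
  have h1 := radial_velocity hcy h he hs
  have h2 := he _ (Set.Ioo_subset_Icc_self hs)
  have hyU := expO_mem_U hy
  rw [inv_smul_smul₀ hc0.ne'] at h1 h2
  have hw := ((h c⁻¹ (Set.Ioo_subset_Icc_self hs)).2.2).hasDerivAt (Icc_mem_nhds hs.1 hs.2)
  have h3 := (hasDerivAt_id' c⁻¹).fun_smul hw
  have h4 : HasDerivAt (fun s : ℝ => s • c • y) (c • y) c⁻¹ := by
    simpa using (hasDerivAt_id c⁻¹).smul_const (c • y)
  have h5 : HasFDerivAt S.radial (fderiv ℝ S.radial y) (c⁻¹ • c • y) := by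
    rw [inv_smul_smul₀ hc0.ne']
    exact ((radial_contDiffAt hy).differentiableAt (by simp)).hasFDerivAt
  have h6 := h5.comp_hasDerivAt c⁻¹ h4
  -- The radial field is `s` times the velocity, so the product rule leaves a velocity term. This is
  -- why the right-hand side is the radial field itself and not zero.
  have e : (S.radial ∘ fun s : ℝ => s • c • y) =ᶠ[𝓝 c⁻¹] fun s => s • w s := by
    filter_upwards [hn] with s hs
    simp [radial_velocity hcy h he hs, radial]
  have h7 := (h6.congr_of_eventuallyEq e.symm).unique h3
  have h8 : c⁻¹ • w c⁻¹ = S.radial y := by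
    rw [h1, map_smul, inv_smul_smul₀ hc0.ne', radial]
  have h9 := congrArg (fun z => c⁻¹ • z) h7
  simp only [map_smul, inv_smul_smul₀ hc0.ne', one_smul, smul_add, smul_neg, h8,
    ← h2] at h9
  rw [h9, ← h8, S.isMetric.christoffelB.smul_left hyU, S.isMetric.christoffelB.smul_right hyU]
  abel

/-- The derivative along the rays of the pairing in the Gauss lemma. -/
lemma fderiv_ip_radial (hy : y ∈ cone S.injRadius) (w : Vec) :
    DifferentiableAt ℝ (fun q => ip S.g (S.expO q) (S.radial q) (fderiv ℝ S.expO q w)) y ∧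
    fderiv ℝ (fun q => ip S.g (S.expO q) (S.radial q) (fderiv ℝ S.expO q w)) y y
      = -minkPair y w := by
  have hyU := expO_mem_U hy
  have hφ := expO_differentiableAt hy
  have hE := (radial_contDiffAt hy).differentiableAt (by simp)
  have hd : HasFDerivAt (fderiv ℝ S.expO) (fderiv ℝ (fderiv ℝ S.expO) y) y :=
    (((expO_contDiffAt hy).fderiv_right (m := ∞) (by simp)).differentiableAt (by simp)).hasFDerivAt
  have hJ := hd.clm_apply (hasFDerivAt_const w y)
  have hE' : fderiv ℝ S.radial y = _ := (hd.clm_apply (hasFDerivAt_id y)).fderiv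
  obtain ⟨h1, h2⟩ := S.isMetric.fderiv_ip_along hφ hyU hE hJ.differentiableAt
  obtain ⟨-, h3⟩ := S.isMetric.fderiv_ip_along hφ hyU hE hE
  refine ⟨h1, ?_⟩
  have e : (fun q => ip S.g (S.expO q) (S.radial q) (S.radial q)) =ᶠ[𝓝 y] fun q => -minkSq q := by
    filter_upwards [eventually_mem_cone hy] with q hq using ip_radial_radial hq
  have h4 := h3 w
  rw [e.fderiv_eq, fderiv_fun_neg, neg_apply, fderiv_minkSq,
    S.isMetric.ip_comm hyU (S.radial y)] at h4
  -- Write `E` for the radial field and `J = d exp w`. Symmetry of the second derivative turns `D_y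
  -- J` into `D_w E - J`; the `J` term cancels against the one from `fderiv_radial`, leaving `⟨E,
  -- D_w E⟩`, half the derivative of `-minkSq`.
  have h5 : fderiv ℝ (fderiv ℝ S.expO) y y w = fderiv ℝ S.radial y w - fderiv ℝ S.expO y w := by
    rw [hE', fderiv_fderiv_comm (expO_contDiffAt hy)]
    simp
  rw [h2, hJ.fderiv]
  change ip S.g _ (fderiv ℝ S.radial y y + christoffel S.g _ (S.radial y) (S.radial y)) _
    + ip S.g _ _ (_ + christoffel S.g _ (S.radial y) _) = _
  rw [fderiv_radial hy]
  simp only [add_apply, ContinuousLinearMap.comp_apply, ContinuousLinearMap.flip_apply, zero_apply,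
    map_zero, zero_add, h5]
  rw [S.isMetric.christoffel_comm hyU (S.radial y),
    S.isMetric.ip_comm hyU (S.radial y) (_ + _)]
  simp only [S.isMetric.ipB.add_left hyU, S.isMetric.ipB.sub_left hyU] at h4 ⊢
  rw [S.isMetric.ip_comm hyU (S.radial y) (fderiv ℝ S.expO y w)]
  linarith

/-- Only boundedness near the vertex is needed for the Gauss lemma, and a Lipschitz constant of the
exponential map supplies it. -/
lemma exists_bound_fderiv_expO : ∃ K : ℝ, ∃ δ > 0, ∀ y ∈ cone S.injRadius, ‖y‖ < δ →
    ‖fderiv ℝ S.expO y‖ ≤ K := by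
  obtain ⟨K, δ, hδ, hK⟩ := S.isMetric.exists_lipschitzOnWith_expMap S.O_mem
  let L : Vec →L[ℝ] Vec :=
    ∑ a, (ContinuousLinearMap.proj (R := ℝ) (φ := fun _ : Fin 4 => ℝ) a).smulRight (S.e a)
  have hL (y : Vec) : S.expO y = expMap S.g S.U S.O (L y) := by
    simp [expO, L]
  have hpre : L ⁻¹' Metric.ball 0 δ ∈ 𝓝 (0 : Vec) :=
    L.continuous.continuousAt.preimage_mem_nhds (by simpa using Metric.ball_mem_nhds _ hδ)
  obtain ⟨δ', hδ', hsub⟩ := Metric.mem_nhds_iff.1 hpre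
  refine ⟨(K * ‖L‖₊ : NNReal), δ', hδ', fun y hy hyn => ?_⟩
  have hlip : LipschitzOnWith (K * ‖L‖₊) S.expO (Metric.ball 0 δ') := by
    have : S.expO = expMap S.g S.U S.O ∘ L := funext hL
    rw [this]
    exact hK.comp (L.lipschitz.lipschitzOnWith) fun x hx => hsub hx
  exact norm_fderiv_le_of_lipschitzOn ℝ
    (Metric.isOpen_ball.mem_nhds (mem_ball_zero_iff.2 hyn)) hlip

/-- The Gauss lemma. -/
lemma gauss_lemma (hy : y ∈ cone S.injRadius) (w : Vec) :
    ip S.g (S.expO y) (S.radial y) (fderiv ℝ S.expO y w) = -minkPair y w := by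
  set f : Vec → ℝ := fun q => ip S.g (S.expO q) (S.radial q) (fderiv ℝ S.expO q w) with hf
  -- By `fderiv_ip_radial`, the pairing `f` changes along the ray at the constant rate `-minkPair y
  -- w`. The corrected function is constant on `(0, 1]`, so its limit at zero decides.
  set F : ℝ → ℝ := fun s => f (s • y) + s * minkPair y w with hF
  have hFd (s : ℝ) (hs : 0 < s) (hs1 : s ≤ 1) : HasDerivAt F 0 s := by
    have hsy := smul_mem_cone hy hs hs1
    obtain ⟨h1, h2⟩ := fderiv_ip_radial hsy w
    have h3 : HasDerivAt (fun s : ℝ => s • y) y s := by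
      simpa using (hasDerivAt_id s).smul_const y
    have h4 := (h1.hasFDerivAt.comp_hasDerivAt s h3).add
      ((hasDerivAt_id s).mul_const (minkPair y w))
    refine h4.congr_deriv ?_
    rw [map_smul, minkPair_smul_left, smul_eq_mul, ← mul_neg] at h2
    rw [mul_left_cancel₀ hs.ne' h2]
    ring
  have hconst (s : ℝ) (hs : 0 < s) (hs1 : s ≤ 1) : F s = F 1 := by
    refine (constant_of_has_deriv_right_zero (f := F) (a := s) (b := 1) ?_ ?_ 1 ⟨hs1, le_rfl⟩).symm
    · exact fun x hx => (hFd x (hs.trans_le hx.1) hx.2).continuousAt.continuousWithinAt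
    · exact fun x hx => (hFd x (hs.trans_le hx.1) hx.2.le).hasDerivWithinAt
  obtain ⟨γ, v, h0, h0', h, he⟩ := exists_radial_geodesic hy
  obtain ⟨K, δ, hδ, hK⟩ := exists_bound_fderiv_expO (S := S)
  have h01 : (0 : ℝ) ∈ Set.Icc (0 : ℝ) 1 := Set.left_mem_Icc.2 zero_le_one
  have hle : 𝓝[>] (0 : ℝ) ≤ 𝓝[Set.Icc 0 1] 0 := by
    rw [nhdsWithin_Icc_eq_nhdsGE zero_lt_one]
    exact nhdsWithin_mono _ Set.Ioi_subset_Ici_self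
  have hev : ∀ᶠ s in 𝓝[>] (0 : ℝ), s ∈ Set.Ioo (0 : ℝ) 1 := Ioo_mem_nhdsGT zero_lt_one
  have hid : Tendsto (fun s : ℝ => s) (𝓝[>] 0) (𝓝 0) := nhdsWithin_le_nhds
  have hγ : Tendsto γ (𝓝[>] 0) (𝓝 S.O) := by
    have := (h 0 h01).2.1.continuousWithinAt.mono_left hle
    rwa [h0] at this
  have hv : Tendsto v (𝓝[>] 0) (𝓝 (v 0)) := (h 0 h01).2.2.continuousWithinAt.mono_left hle
  have hG : Tendsto (fun s => ‖bilinCLM (ip S.g) (γ s)‖) (𝓝[>] 0) (𝓝 ‖bilinCLM (ip S.g) S.O‖) :=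
    (ContinuousAt.norm (E := Vec →L[ℝ] Vec →L[ℝ] ℝ)
      (S.isMetric.ipB.contDiffAt_bilinCLM S.O_mem).continuousAt).tendsto.comp hγ
  have hsmall : ∀ᶠ s in 𝓝[>] (0 : ℝ), ‖s • y‖ < δ := by
    have h1 : Tendsto (fun s : ℝ => ‖s • y‖) (𝓝[>] 0) (𝓝 ‖(0 : ℝ) • y‖) :=
      (hid.smul_const y).norm
    rw [zero_smul, norm_zero] at h1
    exact h1.eventually_lt_const hδ
  -- The radial field is `s • v s`, which tends to zero, while the metric and `d exp` stay bounded.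
  have hlim : Tendsto (fun s : ℝ => f (s • y)) (𝓝[>] 0) (𝓝 0) := by
    refine squeeze_zero_norm' (a := fun s => ‖bilinCLM (ip S.g) (γ s)‖ * ‖s • v s‖ * (K * ‖w‖))
      ?_ ?_
    · filter_upwards [hev, hsmall] with s hs hss
      have hsy := smul_mem_cone hy hs.1 hs.2.le
      have e1 : S.radial (s • y) = s • v s := by
        rw [radial_velocity hy h he hs, radial, map_smul]
      rw [hf]
      simp only
      rw [S.isMetric.ipB.eq_bilinCLM (expO_mem_U hsy), he s (Set.Ioo_subset_Icc_self hs), e1]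
      refine (ContinuousLinearMap.le_opNorm₂ _ _ _).trans ?_
      gcongr
      exact (ContinuousLinearMap.le_opNorm _ _).trans
        (mul_le_mul_of_nonneg_right (hK _ hsy hss) (norm_nonneg _))
    · have := (hG.mul (hid.smul hv).norm).mul_const (K * ‖w‖)
      simpa using this
  have hlim2 : Tendsto F (𝓝[>] 0) (𝓝 0) := by
    simpa using hlim.add (hid.mul_const (minkPair y w))
  have hlim3 : Tendsto F (𝓝[>] 0) (𝓝 (F 1)) := by
    refine tendsto_const_nhds.congr' ?_
    filter_upwards [hev] with s hs using (hconst s hs.1 hs.2.le).symm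
  have h1 := tendsto_nhds_unique hlim3 hlim2
  simp only [hF, one_smul, one_mul] at h1
  linarith

end Spacetime

end Hyperboloid

namespace Hyperboloid

namespace Spacetime

variable {S : Spacetime} {y : Vec} {p : Vec}

/-! ### The time function along radial geodesics -/

lemma fderiv_t_ne_zero (hp : p ∈ S.U) {w : Vec} (hw : ip S.g p w w < 0) :
    fderiv ℝ S.t p w ≠ 0 := by
  intro h0
  obtain ⟨f, hf⟩ := S.g_lorentz p hp
  have ht := S.t_timelike p hp
  rw [← S.isMetric.ip_grad hp, S.isMetric.ip_comm hp] at h0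
  rw [eq_zero_of_orthogonal_timelike hf hw ht.le h0, S.isMetric.ipB.zero_left hp] at ht
  exact lt_irrefl _ ht

/-- The reversed Cauchy–Schwarz argument: the time components dominate the spatial pairing, and
`e_future` fixes the sign. -/
lemma fderiv_t_frame_pos {r : ℝ≥0∞} (hy : y ∈ cone r) :
    0 < fderiv ℝ S.t S.O (∑ a, y a • S.e a) := by
  have hf := S.e_orthonormal
  have ht := S.t_timelike S.O S.O_mem
  obtain ⟨c, hc⟩ := exists_frame_coord hf (grad S.g S.t S.O)
  have key (d : Fin 4 → ℝ) : fderiv ℝ S.t S.O (∑ a, d a • S.e a)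
      = -(c 0 * d 0) + ∑ i : Fin 3, c i.succ * d i.succ := by
    rw [← S.isMetric.ip_grad S.O_mem, hc, ip_sum_frame hf]
  have h0 : fderiv ℝ S.t S.O (S.e 0) = -c 0 := by
    have := key (Pi.single 0 1)
    simpa [Pi.single_apply, ite_smul, Fin.sum_univ_succ] using this
  have hfut := S.e_future
  rw [h0] at hfut
  rw [hc, ip_sum_frame hf] at ht
  obtain ⟨hy0, hy1, -⟩ := hy
  rw [← minkPair_self, minkPair] at hy1
  rw [key]
  have hcs := Finset.sum_mul_sq_le_sq_mul_sq Finset.univ (fun i : Fin 3 => c i.succ)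
    (fun i : Fin 3 => y i.succ)
  simp only [pow_two] at hcs
  set C := ∑ i : Fin 3, c i.succ * c i.succ
  set D := ∑ i : Fin 3, y i.succ * y i.succ
  set X := ∑ i : Fin 3, c i.succ * y i.succ
  have hC : 0 ≤ C := Finset.sum_nonneg fun i _ => mul_self_nonneg _
  have hD : 0 ≤ D := Finset.sum_nonneg fun i _ => mul_self_nonneg _
  have h1 : X * X < (-c 0 * y 0) * (-c 0 * y 0) := by
    calc X * X ≤ C * D := hcs
      _ ≤ (c 0 * c 0) * D := mul_le_mul_of_nonneg_right (by linarith) hD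
      _ < (c 0 * c 0) * (y 0 * y 0) :=
        mul_lt_mul_of_pos_left (by linarith) (mul_self_pos.2 (by linarith))
      _ = _ := by ring
  rw [← pow_two, ← pow_two] at h1
  linarith [(abs_lt_of_sq_lt_sq' h1 (mul_pos hfut hy0).le).1]

/-- The time function is positive in the chronological future. -/
lemma t_pos (hy : y ∈ cone S.injRadius) : 0 < S.t (S.expO y) := by
  obtain ⟨γ, w, h0, h0', h, he⟩ := exists_radial_geodesic hy
  have hU (s : ℝ) (hs : s ∈ Set.Icc (0 : ℝ) 1) : γ s ∈ S.U := (h s hs).1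
  have hd (s : ℝ) (hs : s ∈ Set.Icc (0 : ℝ) 1) :
      HasDerivWithinAt (S.t ∘ γ) (fderiv ℝ S.t (γ s) (w s)) (Set.Icc 0 1) s :=
    ((t_contDiffAt (hU s hs)).differentiableAt (by simp)).hasFDerivAt.comp_hasDerivWithinAt s
      (h s hs).2.1
  have h01 : (0 : ℝ) ∈ Set.Icc (0 : ℝ) 1 := Set.left_mem_Icc.2 zero_le_one
  have h11 : (1 : ℝ) ∈ Set.Icc (0 : ℝ) 1 := Set.right_mem_Icc.2 zero_le_one
  have hne (s : ℝ) (hs : s ∈ Set.Icc (0 : ℝ) 1) : fderiv ℝ S.t (γ s) (w s) ≠ 0 := by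
    refine fderiv_t_ne_zero (hU s hs) ?_
    rw [S.isMetric.ip_velocity h hs, h0, h0', ip_sum_e]
    exact neg_lt_zero.2 hy.2.1
  have hc : ContinuousOn (fun s => fderiv ℝ S.t (γ s) (w s)) (Set.Icc 0 1) := fun s hs =>
    (((t_contDiffAt (hU s hs)).fderiv_right (m := ∞) (by simp)).continuousAt.comp_continuousWithinAt
      (h s hs).2.1.continuousWithinAt).clm_apply (h s hs).2.2.continuousWithinAt
  have hinit : 0 < fderiv ℝ S.t (γ 0) (w 0) := by
    rw [h0, h0']
    exact fderiv_t_frame_pos hy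
  -- The derivative of `t` along the geodesic starts positive and never vanishes, so it cannot
  -- change sign.
  have hpos (s : ℝ) (hs : s ∈ Set.Icc (0 : ℝ) 1) : 0 < fderiv ℝ S.t (γ s) (w s) := by
    by_contra hneg
    obtain ⟨r, hr, hr0⟩ := isPreconnected_Icc.intermediate_value hs h01 hc
      ⟨not_lt.1 hneg, hinit.le⟩
    exact hne r hr hr0
  have hmono : StrictMonoOn (S.t ∘ γ) (Set.Icc 0 1) :=
    strictMonoOn_of_hasDerivWithinAt_pos (f' := fun s => fderiv ℝ S.t (γ s) (w s))
      (convex_Icc 0 1) (fun s hs => (hd s hs).continuousWithinAt)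
      (fun s hs => (hd s (interior_subset hs)).mono interior_subset)
      fun s hs => hpos s (interior_subset hs)
  have h1 := hmono h01 h11 zero_lt_one
  simp only [Function.comp_apply, h0, S.t_O] at h1
  have h2 := he 1 h11
  rw [one_smul] at h2
  rwa [h2]

/-! ### The future of the origin is foliated by hyperboloids -/

lemma rho_expO (hy : y ∈ cone S.injRadius) : S.rho (S.expO y) = √(minkSq y) := by
  rw [rho, normalCoord_expO hy]

lemma tau_expO (hy : y ∈ cone S.injRadius) : S.tau (S.expO y) = y 0 := by
  rw [tau, normalCoord_expO hy]

lemma rho_contDiffAt (hy : y ∈ cone S.injRadius) : ContDiffAt ℝ ∞ S.rho (S.expO y) := by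
  have h1 : ContDiffAt ℝ ∞ (fun q => minkSq (S.normalCoord q)) (S.expO y) :=
    contDiff_minkSq.contDiffAt.comp _ (normalCoord_contDiffAt hy).2
  refine h1.sqrt ?_
  rw [normalCoord_expO hy]
  exact hy.2.1.ne'

lemma fderiv_rho_expO (hy : y ∈ cone S.injRadius) (w : Vec) :
    fderiv ℝ S.rho (S.expO y) (fderiv ℝ S.expO y w) = (√(minkSq y))⁻¹ * minkPair y w := by
  rw [fderiv_comp_expO hy ((rho_contDiffAt hy).differentiableAt (by simp))
    (fun q hq => rho_expO hq)]
  have h1 := ((contDiff_minkSq.contDiffAt (x := y)).differentiableAt (by simp)).hasFDerivAt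
  rw [(h1.sqrt hy.2.1.ne').fderiv, smul_apply, fderiv_minkSq, smul_eq_mul]
  field_simp

/-- By the Gauss lemma both sides pair equally with every vector `d exp w`, and these exhaust the
tangent space. -/
lemma B_expO (hy : y ∈ cone S.injRadius) :
    S.B (S.expO y) = fderiv ℝ S.expO y ((√(minkSq y))⁻¹ • y) := by
  have hyU := expO_mem_U hy
  refine S.isMetric.ext_ip hyU fun z => ?_
  obtain ⟨w, rfl⟩ := exists_fderiv_expO_eq hy z
  rw [B, S.isMetric.ipB.neg_left hyU, S.isMetric.ip_grad hyU, fderiv_rho_expO hy, map_smul,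
    S.isMetric.ipB.smul_left hyU]
  have := gauss_lemma hy w
  rw [radial] at this
  rw [this, smul_eq_mul]
  ring

lemma isHyperboloidal_future : S.IsHyperboloidal S.future where
  metric := S.isMetric.mono isOpen_future future_subset_U
  rho_smooth := by
    rintro _ ⟨y, hy, rfl⟩
    exact rho_contDiffAt hy
  rho_pos := by
    rintro _ ⟨y, hy, rfl⟩
    rw [rho_expO hy]
    exact Real.sqrt_pos.2 hy.2.1
  ip_B_B := by
    rintro _ ⟨y, hy, rfl⟩
    have hyU := expO_mem_U hy
    have h := Real.sqrt_pos.2 hy.2.1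
    have h2 := Real.sq_sqrt hy.2.1.le
    have h3 := ip_radial_radial hy
    rw [radial] at h3
    rw [B_expO hy, map_smul, S.isMetric.ipB.smul_left hyU, S.isMetric.ipB.smul_right hyU, h3]
    simp only [smul_eq_mul]
    field_simp
    linarith

/-- The linear map of the boost in Minkowski space. -/
def boostGen (i : Fin 3) : Vec →L[ℝ] Vec :=
  (ContinuousLinearMap.proj (R := ℝ) (φ := fun _ : Fin 4 => ℝ) i.succ).smulRight (basisVec 0)
    + (ContinuousLinearMap.proj (R := ℝ) (φ := fun _ : Fin 4 => ℝ) 0).smulRight (basisVec i.succ)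

lemma boost_expO (i : Fin 3) (hy : y ∈ cone S.injRadius) :
    S.boost i (S.expO y) = fderiv ℝ S.expO y (boostGen i y) := by
  rw [boost, normalCoord_expO hy]
  simp [boostGen]

lemma minkPair_boostGen (i : Fin 3) (y : Vec) : minkPair y (boostGen i y) = 0 := by
  simp [minkPair, boostGen, basisVec, Pi.single_apply, Fin.succ_ne_zero, (Fin.succ_ne_zero _).symm]
  ring

lemma boost_contDiffAt (i : Fin 3) (hp : p ∈ S.future) : ContDiffAt ℝ ∞ (S.boost i) p := by
  obtain ⟨y, hy, rfl⟩ := hp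
  have hN := (normalCoord_contDiffAt hy).2
  have h1 : ContDiffAt ℝ ∞ (fun q => fderiv ℝ S.expO (S.normalCoord q)) (S.expO y) := by
    refine ContDiffAt.comp (g := fderiv ℝ S.expO) _ ?_ hN
    rw [normalCoord_expO hy]
    exact (expO_contDiffAt hy).fderiv_right (m := ∞) (by simp)
  have h2 := h1.clm_apply ((boostGen i).contDiff.contDiffAt.comp _ hN)
  refine h2.congr_of_eventuallyEq (Eventually.of_forall fun q => ?_)
  simp [boost, boostGen]

/-- The derivative of a push-forward by the exponential map. -/
lemma fderiv_pushforward {X ξ : Vec → Vec} (hy : y ∈ cone S.injRadius)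
    (hX : DifferentiableAt ℝ X (S.expO y)) (hξ : DifferentiableAt ℝ ξ y)
    (h : ∀ q ∈ cone S.injRadius, X (S.expO q) = fderiv ℝ S.expO q (ξ q)) (w : Vec) :
    fderiv ℝ X (S.expO y) (fderiv ℝ S.expO y w)
      = fderiv ℝ (fderiv ℝ S.expO) y w (ξ y) + fderiv ℝ S.expO y (fderiv ℝ ξ y w) := by
  have hd : HasFDerivAt (fderiv ℝ S.expO) (fderiv ℝ (fderiv ℝ S.expO) y) y :=
    (((expO_contDiffAt hy).fderiv_right (m := ∞) (by simp)).differentiableAt (by simp)).hasFDerivAt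
  rw [fderiv_comp_expO hy hX h, (hd.clm_apply hξ.hasFDerivAt).fderiv, add_apply, add_comm]
  rfl

/-- Tangency is the Gauss lemma applied to a direction orthogonal to `y`. For the commutator, second
derivatives of `exp_O` cancel by symmetry; in normal coordinates the boost is linear and annihilates
`minkSq`, hence commutes with `y/√(minkSq y)`. -/
lemma boost_isHyperboloidalSymmetry (i : Fin 3) :
    S.IsHyperboloidalSymmetry S.future (S.boost i) where
  smooth _ hq := boost_contDiffAt i hq
  ip_B := by
    rintro _ ⟨y, hy, rfl⟩
    have hyU := expO_mem_U hy
    have h1 := gauss_lemma hy (boostGen i y)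
    rw [minkPair_boostGen, neg_zero, radial] at h1
    rw [S.isMetric.ip_comm hyU, B_expO hy, boost_expO i hy, map_smul,
      S.isMetric.ipB.smul_left hyU, h1, smul_zero]
  comm := by
    rintro _ ⟨y, hy, rfl⟩
    have hp : S.expO y ∈ S.future := ⟨y, hy, rfl⟩
    have h1 := ((contDiff_minkSq.contDiffAt (x := y)).differentiableAt (by simp)).hasFDerivAt
    have hr := (h1.sqrt hy.2.1.ne')
    have hi := (hasDerivAt_inv (Real.sqrt_pos.2 hy.2.1).ne').comp_hasFDerivAt y hr
    have hξ : HasFDerivAt (fun q : Vec => (√(minkSq q))⁻¹ • q) _ y := hi.smul (hasFDerivAt_id y)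
    have e1 := fderiv_pushforward hy ((boost_contDiffAt i hp).differentiableAt (by simp))
      (boostGen i).differentiableAt (fun q hq => boost_expO i hq) ((√(minkSq y))⁻¹ • y)
    have e2 := fderiv_pushforward hy (isHyperboloidal_future.B_diff hp) hξ.differentiableAt
      (fun q hq => B_expO hq) (boostGen i y)
    rw [← B_expO hy] at e1
    rw [← boost_expO i hy] at e2
    rw [e1, e2, fderiv_fderiv_comm (expO_contDiffAt hy), hξ.fderiv]
    congr 2
    simp [fderiv_minkSq, minkPair_boostGen]

lemma tau_differentiableAt (hy : y ∈ cone S.injRadius) : DifferentiableAt ℝ S.tau (S.expO y) :=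
  differentiableAt_pi.1 ((normalCoord_contDiffAt hy).2.differentiableAt (by simp)) 0

lemma fderiv_tau_B (hy : y ∈ cone S.injRadius) :
    fderiv ℝ S.tau (S.expO y) (S.B (S.expO y)) = S.tau (S.expO y) / S.rho (S.expO y) := by
  have h0 : HasFDerivAt (fun y : Vec => y 0)
    (ContinuousLinearMap.proj (R := ℝ) (φ := fun _ : Fin 4 => ℝ) 0) y := hasFDerivAt_apply 0 y
  rw [B_expO hy, fderiv_comp_expO hy (tau_differentiableAt hy) (fun q hq => tau_expO hq),
    h0.fderiv, tau_expO hy, rho_expO hy]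
  simp [div_eq_inv_mul]

/-- By `B_expO`, the curve `s ↦ exp_O(sV)` has velocity `B`. -/
lemma dRho_eq (hy : y ∈ cone S.injRadius) {f : Vec → ℝ} (hf : DifferentiableAt ℝ f (S.expO y)) :
    S.dRho f (S.expO y) = S.derivB f (S.expO y) := by
  have hr := (Real.sqrt_pos.2 hy.2.1).ne'
  rw [dRho, derivB, B_expO hy, rho_expO hy, normalCoord_expO hy]
  have e : √(minkSq y) • ((√(minkSq y))⁻¹ • y) = y := smul_inv_smul₀ hr y
  have h1 := hasDerivAt_expO_smul (S := S) (y := (√(minkSq y))⁻¹ • y) (s := √(minkSq y))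
    (by rwa [e])
  rw [e] at h1
  exact (HasFDerivAt.comp_hasDerivAt_of_eq (l := f) _ hf.hasFDerivAt h1 (by rw [e])).deriv

end Spacetime

end Hyperboloid
end

/-! ### The structure equations on the future of the origin. -/

theorem mainTheorem9 (S : Hyperboloid.Spacetime) (p : Hyperboloid.Vec) (hp : p ∈ S.future) :
    -- the equation for n - b⁻¹
    (DifferentiableAt ℝ (fun q => S.n q - (S.b q)⁻¹) p ∧
      S.derivB (fun q => S.n q - (S.b q)⁻¹) p
          + (S.n p)⁻¹ * (S.b p)⁻¹ / S.rho p * (S.n p - (S.b p)⁻¹)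
        = -(S.rTilde p / S.t p * (S.a p)⁻¹ * S.secondFormT p (S.N p) (S.N p))
          + S.rTilde p * (S.b p)⁻¹ / S.rho p
              * Hyperboloid.ip S.g p (Hyperboloid.cov S.g S.T p (S.T p)) (S.N p)
          + S.dRho S.n p) ∧
    -- the equation for log (t / τ)
    (0 < S.t p / S.tau p ∧ DifferentiableAt ℝ (fun q => Real.log (S.t q / S.tau q)) p ∧
      S.derivB (fun q => Real.log (S.t q / S.tau q)) p
        = ((S.b p)⁻¹ * (S.n p)⁻¹ - 1) / S.rho p) ∧
    -- the equations for tr k and for tr k - 3 / ρ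
    (DifferentiableAt ℝ (S.tr S.k) p ∧
      S.derivB (S.tr S.k) p + 1 / 3 * S.tr S.k p ^ 2 = -S.ricciBB p - S.normSq S.kHat p) ∧
    (DifferentiableAt ℝ S.trkDev p ∧
      S.derivB S.trkDev p + 2 / S.rho p * S.trkDev p
        = -(1 / 3 * S.trkDev p ^ 2) - S.ricciBB p - S.normSq S.kHat p) ∧
    -- the equation for the traceless part of k
    (∀ x y : Hyperboloid.Vec, S.IsTangent p x → S.IsTangent p y →
      DifferentiableAt ℝ (fun q => S.kHat q x y) p ∧
      Hyperboloid.covTensor S.g S.kHat p (S.B p) x y + 2 / 3 * S.tr S.k p * S.kHat p x y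
        = -S.curvHat p x y - S.hatProd S.kHat p x y) ∧
    -- the equations for the deformation tensors of the boost fields
    (∀ i : Fin 3,
      (DifferentiableAt ℝ (S.tr (S.boostPi i)) p ∧
        S.derivB (S.tr (S.boostPi i)) p = 2 * fderiv ℝ S.trkDev p (S.boost i p)) ∧
      ∀ x y : Hyperboloid.Vec, S.IsTangent p x → S.IsTangent p y →
        DifferentiableAt ℝ (fun q => S.traceless (S.boostPi i) q x y) p ∧
        Hyperboloid.covTensor S.g (S.traceless (S.boostPi i)) p (S.B p) x y
            + S.star S.kHat (S.traceless (S.boostPi i)) p x y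
          = 2 * Hyperboloid.lieTensor (S.boost i) S.kHat p x y
            - 2 / 3 * S.tr (S.boostPi i) p * S.kHat p x y) := by
  have h : S.IsHyperboloidal S.future := Hyperboloid.Spacetime.isHyperboloidal_future
  have hU : S.future ⊆ S.U := Hyperboloid.Spacetime.future_subset_U
  have hk := h.isSmoothBilin_k
  have hp' := hp
  obtain ⟨y, hy, hyp⟩ := hp'
  have ht : 0 < S.t p := hyp ▸ Hyperboloid.Spacetime.t_pos hy
  refine ⟨?_, ?_, ⟨h.differentiableAt_tr hk hp, h.tr_k_equation hp⟩,
    ⟨h.differentiableAt_trkDev hp, h.trkDev_equation hp⟩, fun x y hx hy => ⟨?_, ?_⟩,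
    fun i => ⟨⟨?_, ?_⟩, fun x y hx hy => ⟨?_, ?_⟩⟩⟩
  · have hd : S.dRho S.n p = S.derivB S.n p := by
      have hn := (Hyperboloid.Spacetime.n_contDiffAt (hU hp)).differentiableAt (by simp)
      rw [← hyp] at hn ⊢
      exact Hyperboloid.Spacetime.dRho_eq hy hn
    rw [hd]
    exact h.lapse_equation hU hp ht
  · subst hyp
    exact h.log_equation hU hp ht (by rw [Hyperboloid.Spacetime.tau_expO hy]; exact hy.1) (Hyperboloid.Spacetime.tau_differentiableAt hy)
      (Hyperboloid.Spacetime.fderiv_tau_B hy)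
  · exact ((h.isSmoothBilin_traceless hk).smooth p hp x y).differentiableAt (by simp)
  · exact h.kHat_equation hp hx hy
  · exact h.differentiableAt_tr (h.isSmoothBilin_deformation (Hyperboloid.Spacetime.boost_isHyperboloidalSymmetry i)) hp
  · exact h.tr_deformation_equation (Hyperboloid.Spacetime.boost_isHyperboloidalSymmetry i) hp
  · exact ((h.isSmoothBilin_traceless (h.isSmoothBilin_deformation
      (Hyperboloid.Spacetime.boost_isHyperboloidalSymmetry i))).smooth p hp x y).differentiableAt (by simp)
  · exact h.traceless_deformation_equation (Hyperboloid.Spacetime.boost_isHyperboloidalSymmetry i) hp hx hy
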